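/- All manifolds are smooth and without boundary. A Finsler metric on $M$ is a function $F:TM\to[0,\infty)$ that is smooth off the zero section, satisfies $F(cy)=cF(y)$ for $c>0$, and has positive definite fundamental tensor $g_y(u,v)=\frac12\frac{\partial^2}{\partial s\,\partial t}F^2(y+su+tv)\big|_{s=t=0}$ for every $y\neq0$. It is Riemannian if $F^2$ is the quadratic form of an inner product on every tangent space. In local coordinates $(x^i,y^i)$ of $TM$, with $n=\dim M$, put $$G^i=\tfrac14 g^{il}\{[F^2]_{x^ky^l}y^k-[F^2]_{x^l}\},\qquad B^i_{jkl}=\frac{\partial^3G^i}{\partial y^j\partial y^k\partial y^l},\qquad E_{jk}=\tfrac12B^m_{jkm},$$ $$D^i_{jkl}=B^i_{jkl}-\frac2{n+1}\Big\{E_{jk}\delta^i_l+E_{jl}\delta^i_k+E_{kl}\delta^i_j+\frac{\partial E_{jk}}{\partial y^l}y^i\Big\}.$$ $F$ is Berwald, weakly Berwald or Douglas if $B=0$, $E=0$ or $D=0$, respectively. Let $(M_1,F_1)$ and $(M_2,F_2)$ be Finsler manifolds, $M_1$ connected, $\dim M_1=2$, $\dim M_2=n_2\ge1$, and let $f_i:M_i\to(0,\infty)$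 be smooth, $i=1,2$. If $n_2=1$, assume moreover that $F_2$ is reversible, that is, $F_2(-v)=F_2(v)$. The doubly warped product ${M_1}_{f_2}\times_{f_1}M_2$ is $M_1\times M_2$ with the metric $$F(y,v)=\sqrt{f_2^2F_1^2(y)+f_1^2F_2^2(v)},$$ and the warped product $M_1\times_{f_1}M_2$ is the case $f_2=1$. The vanishing of $B$, $E$ and $D$ for these products is required at all tangent vectors $(y,v)$ with $y\ne0$ and $v\neq0$, where $F$ is smooth. Then: 1. If $f_1$ is not constant, then $M_1\times_{f_1}M_2$ is a Berwald manifold if and only if it is Riemannian. 2. If $n_2=2$ and neither $f_1$ nor $f_2$ is constant on any nonempty open subset of its manifold, then ${M_1}_{f_2}\times_{f_1}M_2$ is weakly Berwald if and only if it is Riemannian. 3. If $f_1$ is not constant, then $M_1\times_{f_1}M_2$ is a Douglas manifold if and only if it is Riemannian. -/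

import Mathlib

open scoped Manifold ContDiff

noncomputable section

namespace FinslerGeom

/-- The fundamental tensor of a function `L` on a real vector space (`L` plays the role of `F ^ 2`
on one tangent space): `g_y(u, v) = 1/2 * ∂²/∂s∂t L (y + s u + t v)` at `s = t = 0`. -/
def fundTensor {V : Type*} [AddCommGroup V] [Module ℝ V] (L : V → ℝ) (y u v : V) : ℝ :=
  (1 / 2 : ℝ) * lineDeriv ℝ (fun z => lineDeriv ℝ L z v) y u

/-! ### Computations in one coordinate chart

`L ξ η` is the square of the metric at the point with coordinates `ξ` on the tangent vector with
coordinates `η`. All tensors below are written without indices on the coordinate space `E`. -/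

section Local

variable {E : Type*} [NormedAddCommGroup E] [NormedSpace ℝ E]

/-- The covector `w ↦ 1/4 * ([F²]_{x^k y^l} y^k w^l - [F²]_{x^l} w^l)` at `(x, y) = (ξ, η)`. -/
def sprayCovector (L : E → E → ℝ) (ξ η w : E) : ℝ :=
  (1 / 4 : ℝ) *
    (lineDeriv ℝ (fun x => lineDeriv ℝ (fun y => L x y) η w) ξ η
      - lineDeriv ℝ (fun x => L x η) ξ w)

open Classical in
/-- The spray coefficients `G^i = 1/4 g^{il} ([F²]_{x^k y^l} y^k - [F²]_{x^l})`, as a vector of `E`: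
the vector `G` with `g_y(G, w) = sprayCovector L ξ η w` for all `w`. It exists and is unique
wherever `g_y` is nondegenerate; the value `0` elsewhere is never used. -/
def sprayCoeff (L : E → E → ℝ) (ξ η : E) : E :=
  if h : ∃ G : E, ∀ w : E, fundTensor (L ξ) η G w = sprayCovector L ξ η w then h.choose else 0

/-- The Berwald curvature `B_y(u, v, w) = B^i_{jkl} u^j v^k w^l`, where
`B^i_{jkl} = ∂³ G^i / ∂y^j ∂y^k ∂y^l`, as a linear map in the last argument `w`. -/
def berwaldCurv (L : E → E → ℝ) (ξ η u v : E) : E →L[ℝ] E :=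
  fderiv ℝ (fun y => fderiv ℝ (fun z => fderiv ℝ (sprayCoeff L ξ) z u) y v) η

/-- The mean Berwald curvature `E_y(u, v) = E_{jk} u^j v^k`, where `E_{jk} = 1/2 B^m_{jkm}`. -/
def meanBerwaldCurv (L : E → E → ℝ) (ξ η u v : E) : ℝ :=
  (1 / 2 : ℝ) * LinearMap.trace ℝ E (berwaldCurv L ξ η u v : E →ₗ[ℝ] E)

/-- The Douglas curvature `D_y(u, v, w) = D^i_{jkl} u^j v^k w^l`, where `D^i_{jkl} = B^i_{jkl}
- 2/(n+1) (E_{jk} δ^i_l + E_{jl} δ^i_k + E_{kl} δ^i_j + (∂E_{jk}/∂y^l) y^i)` and `n = dim E`. -/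
def douglasCurv (L : E → E → ℝ) (ξ η u v w : E) : E :=
  berwaldCurv L ξ η u v w
    - (2 / ((Module.finrank ℝ E : ℝ) + 1)) •
      (meanBerwaldCurv L ξ η u v • w + meanBerwaldCurv L ξ η u w • v
        + meanBerwaldCurv L ξ η v w • u
        + fderiv ℝ (fun y => meanBerwaldCurv L ξ y u v) η w • η)

end Local

/-! ### Finsler metrics on manifolds -/

section Manifold

variable {E : Type*} [NormedAddCommGroup E] [NormedSpace ℝ E] {H : Type*} [TopologicalSpace H]
  (I : ModelWithCorners ℝ E H) (M : Type*) [TopologicalSpace M] [ChartedSpace H M]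

/-- A Finsler metric on `M`: a nonnegative function on `TM`, smooth off the zero section,
positively homogeneous of degree one on the fibres, with positive definite fundamental tensor. -/
structure FinslerMetric [IsManifold I ∞ M] where
  toFun : TangentBundle I M → ℝ
  nonneg : ∀ p, 0 ≤ toFun p
  smooth : ContMDiffOn I.tangent 𝓘(ℝ, ℝ) ∞ toFun {p | p.2 ≠ 0}
  homog : ∀ (x : M) (y : TangentSpace I x) (c : ℝ), 0 < c → toFun ⟨x, c • y⟩ = c * toFun ⟨x, y⟩
  posDef : ∀ (x : M) (y u : TangentSpace I x), y ≠ 0 → u ≠ 0 →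
    0 < fundTensor (fun z : TangentSpace I x => toFun ⟨x, z⟩ ^ 2) y u u

variable {M}

/-- `F ^ 2` in the coordinates `(x^i, y^i)` of `TM` induced by the chart `e` of `M`. -/
def localSq (F : TangentBundle I M → ℝ) (e : OpenPartialHomeomorph M H) (ξ η : E) : ℝ :=
  F (tangentMap 𝓘(ℝ, E) I (e.extend I).symm ⟨ξ, η⟩) ^ 2

/-- `P L ξ η` holds in the coordinates of every chart of the atlas, at every tangent vector that
lies in `S`. Here `L` is `F ^ 2` in these coordinates and `(ξ, η)` are the coordinates of the
tangent vector. It is used only for conditions `P` that do not depend on the chart, namely the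
vanishing of a curvature tensor. -/
def InCharts (F : TangentBundle I M → ℝ) (S : Set (TangentBundle I M))
    (P : (E → E → ℝ) → E → E → Prop) : Prop :=
  ∀ e ∈ atlas H M, ∀ ξ ∈ (e.extend I).target, ∀ η : E,
    tangentMap 𝓘(ℝ, E) I (e.extend I).symm ⟨ξ, η⟩ ∈ S → P (localSq I F e) ξ η

/-- The metric `F`, considered on the set `S` of tangent vectors, is a Berwald metric: `B = 0`. -/
def IsBerwald (F : TangentBundle I M → ℝ) (S : Set (TangentBundle I M)) : Prop :=
  InCharts I F S fun L ξ η => ∀ u v w, berwaldCurv L ξ η u v w = 0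

/-- The metric `F`, considered on the set `S` of tangent vectors, is weakly Berwald: `E = 0`. -/
def IsWeaklyBerwald (F : TangentBundle I M → ℝ) (S : Set (TangentBundle I M)) : Prop :=
  InCharts I F S fun L ξ η => ∀ u v, meanBerwaldCurv L ξ η u v = 0

/-- The metric `F`, considered on the set `S` of tangent vectors, is a Douglas metric: `D = 0`. -/
def IsDouglas (F : TangentBundle I M → ℝ) (S : Set (TangentBundle I M)) : Prop :=
  InCharts I F S fun L ξ η => ∀ u v w, douglasCurv L ξ η u v w = 0

/-- `F` is Riemannian: on every tangent space `F ^ 2` is the quadratic form of an inner product.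
(If `F ^ 2` is smooth on a dense open set of tangent vectors that spans every tangent space, these
inner products automatically depend smoothly on the point.) -/
def IsRiemannian (F : TangentBundle I M → ℝ) : Prop :=
  ∀ x : M, ∃ Q : LinearMap.BilinForm ℝ (TangentSpace I x),
    (∀ y z, Q y z = Q z y) ∧ (∀ y, y ≠ 0 → 0 < Q y y) ∧ ∀ y, F ⟨x, y⟩ ^ 2 = Q y y

end Manifold

/-! ### Doubly warped products -/

section Product

variable {E₁ : Type*} [NormedAddCommGroup E₁] [NormedSpace ℝ E₁]
  {H₁ : Type*} [TopologicalSpace H₁] {I₁ : ModelWithCorners ℝ E₁ H₁}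
  {M₁ : Type*} [TopologicalSpace M₁] [ChartedSpace H₁ M₁] [IsManifold I₁ ∞ M₁]
  {E₂ : Type*} [NormedAddCommGroup E₂] [NormedSpace ℝ E₂]
  {H₂ : Type*} [TopologicalSpace H₂] {I₂ : ModelWithCorners ℝ E₂ H₂}
  {M₂ : Type*} [TopologicalSpace M₂] [ChartedSpace H₂ M₂] [IsManifold I₂ ∞ M₂]

/-- The doubly warped product metric `F(y, v) = √(f₂² F₁(y)² + f₁² F₂(v)²)` on `M₁ × M₂`. -/
def doublyWarped (F₁ : FinslerMetric I₁ M₁) (F₂ : FinslerMetric I₂ M₂) (f₁ : M₁ → ℝ) (f₂ : M₂ → ℝ)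
    (p : TangentBundle (I₁.prod I₂) (M₁ × M₂)) : ℝ :=
  Real.sqrt (f₂ p.1.2 ^ 2 * F₁.toFun ⟨p.1.1, p.2.1⟩ ^ 2
    + f₁ p.1.1 ^ 2 * F₂.toFun ⟨p.1.2, p.2.2⟩ ^ 2)

/-- The warped product metric `M₁ ×_{f₁} M₂`, the case `f₂ = 1`. -/
def warped (F₁ : FinslerMetric I₁ M₁) (F₂ : FinslerMetric I₂ M₂) (f₁ : M₁ → ℝ) :
    TangentBundle (I₁.prod I₂) (M₁ × M₂) → ℝ :=
  doublyWarped F₁ F₂ f₁ fun _ => 1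

variable (I₁ M₁ I₂ M₂) in
/-- The set `TM₁⁰ × TM₂⁰` of the tangent vectors of `M₁ × M₂` with both components nonzero, the
domain on which a doubly warped product metric is smooth. -/
def slitProd : Set (TangentBundle (I₁.prod I₂) (M₁ × M₂)) :=
  {p | p.2.1 ≠ 0 ∧ p.2.2 ≠ 0}

end Product

end FinslerGeom

end

namespace FinslerGeom

open Set Filter Topology

/-! ### Smooth and homogeneous functions -/

section Calculus

variable {E : Type*} [NormedAddCommGroup E] [NormedSpace ℝ E]
  {F : Type*} [NormedAddCommGroup F] [NormedSpace ℝ F]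

lemma contDiffOn_fderiv_of_isOpen {O : Set E} (hO : IsOpen O) {f : E → F}
    (hf : ContDiffOn ℝ ∞ f O) : ContDiffOn ℝ ∞ (fderiv ℝ f) O :=
  hf.fderiv_of_isOpen hO (m := ∞) (by simp)

lemma contDiffOn_fderiv_apply {O : Set E} (hO : IsOpen O) {f : E → F} (hf : ContDiffOn ℝ ∞ f O)
    (u : E) : ContDiffOn ℝ ∞ (fun z => fderiv ℝ f z u) O :=
  (contDiffOn_fderiv_of_isOpen hO hf).clm_apply contDiffOn_const

lemma differentiableAt_of_contDiffOn {O : Set E} (hO : IsOpen O) {f : E → F}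
    (hf : ContDiffOn ℝ ∞ f O) {z : E} (hz : z ∈ O) : DifferentiableAt ℝ f z :=
  (hf.contDiffAt (hO.mem_nhds hz)).differentiableAt (by simp)

lemma fderiv_eq_of_eqOn {O : Set E} (hO : IsOpen O) {f g : E → F} (h : EqOn f g O) {z : E}
    (hz : z ∈ O) : fderiv ℝ f z = fderiv ℝ g z :=
  Filter.EventuallyEq.fderiv_eq (h.eventuallyEq_of_mem (hO.mem_nhds hz))

lemma fderiv_smul_of_homog {f : E → F} {c a : ℝ} (h : ∀ z, z ≠ 0 → f (c • z) = a • f z) {z : E}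
    (hz : z ≠ 0) (hf : DifferentiableAt ℝ f z) :
    c • fderiv ℝ f (c • z) = a • fderiv ℝ f z := by
  rw [← fderiv_comp_smul, ← fderiv_const_smul hf]
  exact fderiv_eq_of_eqOn isOpen_compl_singleton (fun y hy => h y hy) hz

/-- Euler's relation. -/
lemma fderiv_self_of_homog {f : E → F} {p : ℝ → ℝ} {k : ℝ} (hp : HasDerivAt p k 1) {z : E}
    (h : ∀ c : ℝ, 0 < c → f (c • z) = p c • f z) (hf : DifferentiableAt ℝ f z) :
    fderiv ℝ f z z = k • f z := by
  have h1 : HasDerivAt (fun c : ℝ => f (c • z)) (fderiv ℝ f z z) 1 := by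
    have h2 : HasDerivAt (fun c : ℝ => c • z) z 1 := by
      simpa using (hasDerivAt_id (1 : ℝ)).smul_const z
    have h3 : HasFDerivAt f (fderiv ℝ f z) ((1 : ℝ) • z) := by simpa using hf.hasFDerivAt
    exact h3.comp_hasDerivAt 1 h2
  have h2 : HasDerivAt (fun c : ℝ => f (c • z)) (k • f z) 1 := by
    refine (hp.smul_const (f z)).congr_of_eventuallyEq ?_
    filter_upwards [lt_mem_nhds (zero_lt_one (α := ℝ))] with c hc using h c hc
  exact h1.unique h2

lemma lineDeriv_comp_linear {E' : Type*} [AddCommGroup E'] [Module ℝ E'] (f : E' → F)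
    (A : E →ₗ[ℝ] E') (z v : E) :
    lineDeriv ℝ (fun y => f (A y)) z v = lineDeriv ℝ f (A z) (A v) := by
  simp [lineDeriv, map_add, map_smul]

lemma fundTensor_comp_linear {E' : Type*} [AddCommGroup E'] [Module ℝ E']
    (f : E' → ℝ) (A : E →ₗ[ℝ] E') (y u v : E) :
    fundTensor (fun y => f (A y)) y u v = fundTensor f (A y) (A u) (A v) := by
  unfold fundTensor
  simp_rw [lineDeriv_comp_linear f A]
  rw [lineDeriv_comp_linear (fun z => lineDeriv ℝ f z (A v)) A]

lemma lineDeriv_smul_point {f : E → ℝ} {c k : ℝ} (hc : 0 < c) (hf : ∀ z, f (c • z) = k * f z)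
    (z w : E) : lineDeriv ℝ f (c • z) w = c⁻¹ * k * lineDeriv ℝ f z w := by
  have h := lineDeriv_comp_linear f (c • LinearMap.id : E →ₗ[ℝ] E) z (c⁻¹ • w)
  simp only [LinearMap.smul_apply, LinearMap.id_apply, smul_smul, mul_inv_cancel₀ hc.ne',
    one_smul, hf] at h
  rw [← h, lineDeriv_smul, smul_eq_mul, mul_assoc]
  congr 1
  simp [lineDeriv]

end Calculus

/-! ### Finsler metrics in one chart -/

section Local

variable {E : Type*} [NormedAddCommGroup E] [NormedSpace ℝ E]

/-- `L` is the square of a Finsler metric on the open subset `U` of `E`. -/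
structure LocalFinsler (U : Set E) (L : E → E → ℝ) : Prop where
  isOpen : IsOpen U
  smooth : ContDiffOn ℝ ∞ (fun p : E × E => L p.1 p.2) (U ×ˢ {0}ᶜ)
  homog : ∀ (ξ η : E) (c : ℝ), 0 < c → L ξ (c • η) = c ^ 2 * L ξ η
  posDef : ∀ ξ ∈ U, ∀ η u : E, η ≠ 0 → u ≠ 0 → 0 < fundTensor (L ξ) η u u

/-- The fundamental tensor as a continuous linear map to the dual space. -/
noncomputable def fundOp (L : E → E → ℝ) (p : E × E) : E →L[ℝ] E →L[ℝ] ℝ :=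
  (1 / 2 : ℝ) • ((ContinuousLinearMap.compL ℝ E (E × E) ℝ).flip
    (ContinuousLinearMap.inr ℝ E E)).comp
      ((fderiv ℝ (fderiv ℝ fun p : E × E => L p.1 p.2) p).comp (ContinuousLinearMap.inr ℝ E E))

/-- The covector defining the spray coefficients as a continuous linear map. -/
noncomputable def covOp (L : E → E → ℝ) (p : E × E) : E →L[ℝ] ℝ :=
  (1 / 4 : ℝ) • ((fderiv ℝ (fderiv ℝ fun p : E × E => L p.1 p.2) p (p.2, 0)).comp
      (ContinuousLinearMap.inr ℝ E E)
    - (fderiv ℝ (fun p : E × E => L p.1 p.2) p).comp (ContinuousLinearMap.inl ℝ E E))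

lemma fundOp_apply (L : E → E → ℝ) (p : E × E) (u w : E) : fundOp L p u w =
    (1 / 2 : ℝ) * fderiv ℝ (fderiv ℝ fun p : E × E => L p.1 p.2) p (0, u) (0, w) := by
  simp [fundOp]

lemma covOp_apply (L : E → E → ℝ) (p : E × E) (w : E) : covOp L p w =
    (1 / 4 : ℝ) * (fderiv ℝ (fderiv ℝ fun p : E × E => L p.1 p.2) p (p.2, 0) (0, w)
      - fderiv ℝ (fun p : E × E => L p.1 p.2) p (w, 0)) := by
  simp [covOp]

namespace LocalFinsler

variable {U : Set E} {L : E → E → ℝ}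

lemma isOpen_dom (h : LocalFinsler U L) : IsOpen (U ×ˢ ({0}ᶜ : Set E)) :=
  h.isOpen.prod isOpen_compl_singleton

lemma contDiffOn_fibre (h : LocalFinsler U L) {ξ : E} (hξ : ξ ∈ U) :
    ContDiffOn ℝ ∞ (L ξ) {0}ᶜ :=
  h.smooth.comp (f := fun η : E => (ξ, η)) (by fun_prop) (fun η hη => ⟨hξ, hη⟩)

lemma contDiffOn_base (h : LocalFinsler U L) {η : E} (hη : η ≠ 0) :
    ContDiffOn ℝ ∞ (fun ξ => L ξ η) U :=
  h.smooth.comp (f := fun ξ : E => (ξ, η)) (by fun_prop) (fun ξ hξ => ⟨hξ, hη⟩)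

lemma hasFDerivAt (h : LocalFinsler U L) {ξ η : E} (hξ : ξ ∈ U) (hη : η ≠ 0) :
    HasFDerivAt (fun p : E × E => L p.1 p.2) (fderiv ℝ (fun p : E × E => L p.1 p.2) (ξ, η))
      (ξ, η) :=
  (differentiableAt_of_contDiffOn h.isOpen_dom h.smooth (z := (ξ, η)) ⟨hξ, hη⟩).hasFDerivAt

lemma hasFDerivAt_fderiv (h : LocalFinsler U L) {ξ η : E} (hξ : ξ ∈ U) (hη : η ≠ 0) :
    HasFDerivAt (fderiv ℝ fun p : E × E => L p.1 p.2)
      (fderiv ℝ (fderiv ℝ fun p : E × E => L p.1 p.2) (ξ, η)) (ξ, η) :=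
  (differentiableAt_of_contDiffOn h.isOpen_dom
    (contDiffOn_fderiv_of_isOpen h.isOpen_dom h.smooth) (z := (ξ, η)) ⟨hξ, hη⟩).hasFDerivAt

lemma lineDeriv_fibre (h : LocalFinsler U L) {ξ η : E} (hξ : ξ ∈ U) (hη : η ≠ 0) (w : E) :
    lineDeriv ℝ (L ξ) η w = fderiv ℝ (fun p : E × E => L p.1 p.2) (ξ, η) (0, w) := by
  have h1 := (h.hasFDerivAt hξ hη).comp η (hasFDerivAt_prodMk_right (𝕜 := ℝ) ξ η)
  exact (h1.hasLineDerivAt w).lineDeriv.trans (by simp)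

lemma fderiv_fibre (h : LocalFinsler U L) {ξ η : E} (hξ : ξ ∈ U) (hη : η ≠ 0) (w : E) :
    fderiv ℝ (L ξ) η w = fderiv ℝ (fun p : E × E => L p.1 p.2) (ξ, η) (0, w) := by
  rw [← h.lineDeriv_fibre hξ hη, DifferentiableAt.lineDeriv_eq_fderiv]
  exact differentiableAt_of_contDiffOn isOpen_compl_singleton (h.contDiffOn_fibre hξ) hη

lemma lineDeriv_base (h : LocalFinsler U L) {ξ η : E} (hξ : ξ ∈ U) (hη : η ≠ 0) (w : E) :
    lineDeriv ℝ (fun x => L x η) ξ w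
      = fderiv ℝ (fun p : E × E => L p.1 p.2) (ξ, η) (w, 0) := by
  have h1 := (h.hasFDerivAt hξ hη).comp ξ (hasFDerivAt_prodMk_left (𝕜 := ℝ) ξ η)
  exact (h1.hasLineDerivAt w).lineDeriv.trans (by simp)

lemma hasFDerivAt_fderiv_apply (h : LocalFinsler U L) {ξ η : E} (hξ : ξ ∈ U) (hη : η ≠ 0)
    (v : E × E) :
    HasFDerivAt (fun p : E × E => fderiv ℝ (fun p : E × E => L p.1 p.2) p v)
      ((fderiv ℝ (fderiv ℝ fun p : E × E => L p.1 p.2) (ξ, η)).flip v) (ξ, η) := by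
  simpa using (h.hasFDerivAt_fderiv hξ hη).clm_apply (hasFDerivAt_const v (ξ, η))

lemma fundTensor_eq (h : LocalFinsler U L) {ξ η : E} (hξ : ξ ∈ U) (hη : η ≠ 0) (u w : E) :
    fundTensor (L ξ) η u w = fundOp L (ξ, η) u w := by
  have h1 := (h.hasFDerivAt_fderiv_apply hξ hη (0, w)).comp η
    (hasFDerivAt_prodMk_right (𝕜 := ℝ) ξ η)
  have h2 := (h1.hasLineDerivAt u).lineDeriv
  rw [fundTensor, fundOp_apply]
  congr 1
  refine (Filter.EventuallyEq.lineDeriv_eq ?_).trans (by simpa using h2)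
  filter_upwards [isOpen_compl_singleton.mem_nhds hη] with z hz
  simpa using h.lineDeriv_fibre hξ hz w

lemma sprayCovector_eq (h : LocalFinsler U L) {ξ η : E} (hξ : ξ ∈ U) (hη : η ≠ 0) (w : E) :
    sprayCovector L ξ η w = covOp L (ξ, η) w := by
  have h1 := (h.hasFDerivAt_fderiv_apply hξ hη (0, w)).comp ξ
    (hasFDerivAt_prodMk_left (𝕜 := ℝ) ξ η)
  have h2 := (h1.hasLineDerivAt η).lineDeriv
  rw [sprayCovector, covOp_apply, h.lineDeriv_base hξ hη]
  congr 2
  refine (Filter.EventuallyEq.lineDeriv_eq ?_).trans (by simpa using h2)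
  filter_upwards [h.isOpen.mem_nhds hξ] with z hz
  simpa using h.lineDeriv_fibre hz hη w

lemma fderiv_fderiv_symm (h : LocalFinsler U L) {ξ η : E} (hξ : ξ ∈ U) (hη : η ≠ 0)
    (v w : E × E) :
    fderiv ℝ (fderiv ℝ fun p : E × E => L p.1 p.2) (ξ, η) v w
      = fderiv ℝ (fderiv ℝ fun p : E × E => L p.1 p.2) (ξ, η) w v := by
  have := h.smooth.contDiffAt (h.isOpen_dom.mem_nhds (show (ξ, η) ∈ _ from ⟨hξ, hη⟩))
  exact this.isSymmSndFDerivAt (by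
    rw [minSmoothness_of_isRCLikeNormedField]
    exact WithTop.coe_le_coe.2 (le_top : (2 : ℕ∞) ≤ ⊤)) v w

lemma fundOp_symm (h : LocalFinsler U L) {ξ η : E} (hξ : ξ ∈ U) (hη : η ≠ 0) (u w : E) :
    fundOp L (ξ, η) u w = fundOp L (ξ, η) w u := by
  rw [fundOp_apply, fundOp_apply, h.fderiv_fderiv_symm hξ hη]

lemma fundOp_pos (h : LocalFinsler U L) {ξ η u : E} (hξ : ξ ∈ U) (hη : η ≠ 0) (hu : u ≠ 0) :
    0 < fundOp L (ξ, η) u u := by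
  rw [← h.fundTensor_eq hξ hη]; exact h.posDef ξ hξ η u hη hu

lemma fundOp_injective (h : LocalFinsler U L) {ξ η : E} (hξ : ξ ∈ U) (hη : η ≠ 0) :
    Function.Injective (fundOp L (ξ, η)) := by
  rw [injective_iff_map_eq_zero]
  intro u hu
  by_contra hne
  have := h.fundOp_pos hξ hη hne
  simp [hu] at this

/-- Euler's relation for the derivative of the square of the metric. -/
lemma fderiv_fibre_self (h : LocalFinsler U L) {ξ η : E} (hξ : ξ ∈ U) (hη : η ≠ 0) :
    fderiv ℝ (L ξ) η η = 2 * L ξ η := by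
  have := fderiv_self_of_homog (f := L ξ) (p := fun c => c ^ 2) (k := 2) (z := η)
    (by simpa using hasDerivAt_pow 2 (1 : ℝ)) (fun c hc => h.homog ξ η c hc)
    (differentiableAt_of_contDiffOn isOpen_compl_singleton (h.contDiffOn_fibre hξ) hη)
  simpa using this

lemma fderiv_fibre_smul (h : LocalFinsler U L) {ξ η : E} (hξ : ξ ∈ U) (hη : η ≠ 0) {c : ℝ}
    (hc : 0 < c) : fderiv ℝ (L ξ) (c • η) = c • fderiv ℝ (L ξ) η := by
  have := fderiv_smul_of_homog (f := L ξ) (fun z _ => h.homog ξ z c hc) hη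
    (differentiableAt_of_contDiffOn isOpen_compl_singleton (h.contDiffOn_fibre hξ) hη)
  have h2 := congrArg (fun A => c⁻¹ • A) this
  simp only [smul_smul, inv_mul_cancel₀ hc.ne', one_smul] at h2
  rw [h2]; congr 1; field_simp

lemma fderiv_fderiv_fibre (h : LocalFinsler U L) {ξ η : E} (hξ : ξ ∈ U) (hη : η ≠ 0) (u w : E) :
    fderiv ℝ (fun z => fderiv ℝ (L ξ) z w) η u = 2 * fundOp L (ξ, η) u w := by
  have h1 := (h.hasFDerivAt_fderiv_apply hξ hη (0, w)).comp η
    (hasFDerivAt_prodMk_right (𝕜 := ℝ) ξ η)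
  rw [fderiv_eq_of_eqOn isOpen_compl_singleton (fun z hz => h.fderiv_fibre hξ hz w) hη]
  erw [h1.fderiv]
  simp [fundOp_apply]

lemma fundOp_self_left (h : LocalFinsler U L) {ξ η : E} (hξ : ξ ∈ U) (hη : η ≠ 0) (w : E) :
    2 * fundOp L (ξ, η) η w = fderiv ℝ (L ξ) η w := by
  rw [← h.fderiv_fderiv_fibre hξ hη]
  have := fderiv_self_of_homog (f := fun z => fderiv ℝ (L ξ) z w) (p := fun c => c) (k := 1)
    (z := η) (hasDerivAt_id 1) (fun c hc => by simp [h.fderiv_fibre_smul hξ hη hc])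
    (differentiableAt_of_contDiffOn isOpen_compl_singleton
      (contDiffOn_fderiv_apply isOpen_compl_singleton (h.contDiffOn_fibre hξ) w) hη)
  simpa using this

lemma fundOp_self_self (h : LocalFinsler U L) {ξ η : E} (hξ : ξ ∈ U) (hη : η ≠ 0) :
    fundOp L (ξ, η) η η = L ξ η := by
  have h1 := h.fundOp_self_left hξ hη η
  have h2 := h.fderiv_fibre_self hξ hη
  linarith

lemma pos (h : LocalFinsler U L) {ξ η : E} (hξ : ξ ∈ U) (hη : η ≠ 0) : 0 < L ξ η := by
  rw [← h.fundOp_self_self hξ hη]; exact h.fundOp_pos hξ hη hη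

lemma map_zero (h : LocalFinsler U L) (ξ : E) : L ξ 0 = 0 := by
  have := h.homog ξ 0 2 (by norm_num)
  rw [smul_zero] at this; linarith

lemma fundOp_smul (h : LocalFinsler U L) {ξ η : E} (hξ : ξ ∈ U) (hη : η ≠ 0) {c : ℝ}
    (hc : 0 < c) : fundOp L (ξ, c • η) = fundOp L (ξ, η) := by
  have hcη : c • η ≠ 0 := smul_ne_zero hc.ne' hη
  ext u w
  have h1 := fderiv_smul_of_homog (f := fun z => fderiv ℝ (L ξ) z w) (c := c) (a := c)
    (fun z hz => by simp [h.fderiv_fibre_smul hξ hz hc]) hη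
    (differentiableAt_of_contDiffOn isOpen_compl_singleton
      (contDiffOn_fderiv_apply isOpen_compl_singleton (h.contDiffOn_fibre hξ) w) hη)
  have h2 := congrArg (fun A : E →L[ℝ] ℝ => A u) (smul_right_injective _ hc.ne' h1)
  simp only [h.fderiv_fderiv_fibre hξ hη, h.fderiv_fderiv_fibre hξ hcη] at h2
  linarith

lemma contDiffOn_fundOp (h : LocalFinsler U L) : ContDiffOn ℝ ∞ (fundOp L) (U ×ˢ {0}ᶜ) := by
  have h2 := contDiffOn_fderiv_of_isOpen h.isOpen_dom
    (contDiffOn_fderiv_of_isOpen h.isOpen_dom h.smooth)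
  unfold fundOp
  refine ContDiffOn.const_smul _ (ContDiffOn.clm_comp (g := fun _ =>
    (ContinuousLinearMap.compL ℝ E (E × E) ℝ).flip (ContinuousLinearMap.inr ℝ E E))
    contDiffOn_const
    (h2.clm_comp (contDiffOn_const (c := ContinuousLinearMap.inr ℝ E E))))

lemma contDiffOn_covOp (h : LocalFinsler U L) : ContDiffOn ℝ ∞ (covOp L) (U ×ˢ {0}ᶜ) := by
  have h1 := contDiffOn_fderiv_of_isOpen h.isOpen_dom h.smooth
  have h2 := contDiffOn_fderiv_of_isOpen h.isOpen_dom h1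
  unfold covOp
  refine ContDiffOn.const_smul _
    (((h2.clm_apply (g := fun p : E × E => (p.2, (0 : E))) (by fun_prop)).clm_comp
      (contDiffOn_const (c := ContinuousLinearMap.inr ℝ E E))).sub
      (h1.clm_comp (contDiffOn_const (c := ContinuousLinearMap.inl ℝ E E))))

lemma sprayCovector_smul (h : LocalFinsler U L) (ξ η w : E) {c : ℝ} (hc : 0 < c) :
    sprayCovector L ξ (c • η) w = c ^ 2 * sprayCovector L ξ η w := by
  have h1 : (fun x => lineDeriv ℝ (fun y => L x y) (c • η) w)
      = fun x => c * lineDeriv ℝ (fun y => L x y) η w := by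
    funext x
    rw [lineDeriv_smul_point hc (fun z => h.homog x z c hc)]
    field_simp
  have h2 : (fun x => L x (c • η)) = fun x => c ^ 2 * L x η := by
    funext x; exact h.homog x η c hc
  have h3 : ∀ (a : ℝ) (f : E → ℝ) (x v : E),
      lineDeriv ℝ (fun x => a * f x) x v = a * lineDeriv ℝ f x v := by
    intro a f x v; simp [lineDeriv]
  rw [sprayCovector, sprayCovector, h1, h2, h3, h3, lineDeriv_smul, smul_eq_mul]
  ring

lemma grad_smul (h : LocalFinsler U L) {ξ η : E} (hξ : ξ ∈ U) (hη : η ≠ 0) (φ : E →L[ℝ] ℝ)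
    {c : ℝ} (hc : 0 < c) :
    (fundOp L (ξ, c • η)).inverse φ = (fundOp L (ξ, η)).inverse φ := by
  rw [h.fundOp_smul hξ hη hc]

variable [FiniteDimensional ℝ E]

lemma exists_equiv (h : LocalFinsler U L) {ξ η : E} (hξ : ξ ∈ U) (hη : η ≠ 0) :
    ∃ e : E ≃L[ℝ] (E →L[ℝ] ℝ), (e : E →L[ℝ] E →L[ℝ] ℝ) = fundOp L (ξ, η) := by
  have hfr : Module.finrank ℝ E = Module.finrank ℝ (E →L[ℝ] ℝ) := by
    rw [← LinearMap.toContinuousLinearMap.finrank_eq]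
    exact Subspace.dual_finrank_eq.symm
  refine ⟨(LinearEquiv.ofInjectiveOfFinrankEq (fundOp L (ξ, η) : E →ₗ[ℝ] E →L[ℝ] ℝ)
    (h.fundOp_injective hξ hη) hfr).toContinuousLinearEquiv, ?_⟩
  ext u w
  rfl

lemma contDiffAt_inverse_fundOp (h : LocalFinsler U L) {ξ η : E} (hξ : ξ ∈ U) (hη : η ≠ 0) :
    ContDiffAt ℝ ∞ (fun p => (fundOp L p).inverse) (ξ, η) := by
  obtain ⟨e, he⟩ := h.exists_equiv hξ hη
  have h1 := contDiffAt_map_inverse (n := ∞) e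
  rw [he] at h1
  exact h1.comp (ξ, η) (h.contDiffOn_fundOp.contDiffAt (h.isOpen_dom.mem_nhds ⟨hξ, hη⟩))

lemma fundOp_inverse (h : LocalFinsler U L) {ξ η : E} (hξ : ξ ∈ U) (hη : η ≠ 0)
    (φ : E →L[ℝ] ℝ) : fundOp L (ξ, η) ((fundOp L (ξ, η)).inverse φ) = φ := by
  obtain ⟨e, he⟩ := h.exists_equiv hξ hη
  rw [← he, ContinuousLinearMap.inverse_equiv]
  simp

lemma eq_inverse_iff (h : LocalFinsler U L) {ξ η : E} (hξ : ξ ∈ U) (hη : η ≠ 0)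
    (φ : E →L[ℝ] ℝ) (X : E) :
    X = (fundOp L (ξ, η)).inverse φ ↔ ∀ w, fundOp L (ξ, η) X w = φ w := by
  constructor
  · rintro rfl w; rw [h.fundOp_inverse hξ hη]
  · intro hX
    apply h.fundOp_injective hξ hη
    rw [h.fundOp_inverse hξ hη]
    ext w; exact hX w

lemma sprayCoeff_eq (h : LocalFinsler U L) {ξ η : E} (hξ : ξ ∈ U) (hη : η ≠ 0) :
    sprayCoeff L ξ η = (fundOp L (ξ, η)).inverse (covOp L (ξ, η)) := by
  have hex : ∃ G : E, ∀ w : E, fundTensor (L ξ) η G w = sprayCovector L ξ η w :=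
    ⟨(fundOp L (ξ, η)).inverse (covOp L (ξ, η)), fun w => by
      rw [h.fundTensor_eq hξ hη, h.sprayCovector_eq hξ hη, h.fundOp_inverse hξ hη]⟩
  rw [sprayCoeff, dif_pos hex, h.eq_inverse_iff hξ hη]
  intro w
  rw [← h.fundTensor_eq hξ hη, hex.choose_spec w, h.sprayCovector_eq hξ hη]

lemma fundOp_sprayCoeff (h : LocalFinsler U L) {ξ η : E} (hξ : ξ ∈ U) (hη : η ≠ 0) (w : E) :
    fundOp L (ξ, η) (sprayCoeff L ξ η) w = covOp L (ξ, η) w := by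
  rw [h.sprayCoeff_eq hξ hη, h.fundOp_inverse hξ hη]

lemma contDiffOn_sprayCoeff (h : LocalFinsler U L) :
    ContDiffOn ℝ ∞ (fun p : E × E => sprayCoeff L p.1 p.2) (U ×ˢ {0}ᶜ) := by
  have h1 : ContDiffOn ℝ ∞ (fun p => (fundOp L p).inverse (covOp L p)) (U ×ˢ {0}ᶜ) :=
    ContDiffOn.clm_apply (fun p hp => (h.contDiffAt_inverse_fundOp hp.1 hp.2).contDiffWithinAt)
      h.contDiffOn_covOp
  exact h1.congr fun p hp => h.sprayCoeff_eq hp.1 hp.2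

lemma contDiffOn_sprayCoeff_fibre (h : LocalFinsler U L) {ξ : E} (hξ : ξ ∈ U) :
    ContDiffOn ℝ ∞ (sprayCoeff L ξ) {0}ᶜ :=
  h.contDiffOn_sprayCoeff.comp (f := fun η : E => (ξ, η)) (by fun_prop) (fun η hη => ⟨hξ, hη⟩)

lemma sprayCoeff_smul (h : LocalFinsler U L) {ξ η : E} (hξ : ξ ∈ U) (hη : η ≠ 0) {c : ℝ}
    (hc : 0 < c) : sprayCoeff L ξ (c • η) = c ^ 2 • sprayCoeff L ξ η := by
  have hcη : c • η ≠ 0 := smul_ne_zero hc.ne' hη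
  apply h.fundOp_injective hξ hcη
  ext w
  rw [h.fundOp_sprayCoeff hξ hcη, ← h.sprayCovector_eq hξ hcη, h.sprayCovector_smul _ _ _ hc,
    h.fundOp_smul hξ hη hc, map_smul]
  simp [h.fundOp_sprayCoeff hξ hη, ← h.sprayCovector_eq hξ hη]

/-! The gradient `X(y)` of a covector `φ`, i.e. the vector with `g_y(X(y), w) = φ(w)`. -/

lemma contDiffOn_grad (h : LocalFinsler U L) {ξ : E} (hξ : ξ ∈ U) (φ : E →L[ℝ] ℝ) :
    ContDiffOn ℝ ∞ (fun η => (fundOp L (ξ, η)).inverse φ) {0}ᶜ := by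
  intro η hη
  have h1 : ContDiffAt ℝ ∞ (fun η => (fundOp L (ξ, η)).inverse) η :=
    (h.contDiffAt_inverse_fundOp hξ hη).comp η (f := fun η : E => (ξ, η)) (by fun_prop)
  exact (h1.clm_apply contDiffAt_const).contDiffWithinAt

lemma fderiv_grad_self (h : LocalFinsler U L) {ξ η : E} (hξ : ξ ∈ U) (hη : η ≠ 0)
    (φ : E →L[ℝ] ℝ) : fderiv ℝ (fun η => (fundOp L (ξ, η)).inverse φ) η η = 0 := by
  have := fderiv_self_of_homog (f := fun η => (fundOp L (ξ, η)).inverse φ) (p := fun _ => 1)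
    (k := 0) (z := η) (hasDerivAt_const _ _) (fun c hc => by simp [h.grad_smul hξ hη φ hc])
    (differentiableAt_of_contDiffOn isOpen_compl_singleton (h.contDiffOn_grad hξ φ) hη)
  simpa using this

end LocalFinsler

end Local

/-! ### Quadratic forms -/

section Quadratic

variable {E : Type*} [AddCommGroup E] [Module ℝ E] {F : Type*} [AddCommGroup F] [Module ℝ F]

/-- `ℓ` is the quadratic form of a symmetric bilinear form. -/
def IsQuad (ℓ : E → ℝ) : Prop :=
  ∃ Q : LinearMap.BilinForm ℝ E, (∀ y z, Q y z = Q z y) ∧ ∀ y, ℓ y = Q y y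

lemma IsQuad.comp_linear {ℓ : E → ℝ} (h : IsQuad ℓ) (A : F →ₗ[ℝ] E) :
    IsQuad fun y => ℓ (A y) := by
  obtain ⟨Q, hs, hQ⟩ := h
  exact ⟨Q.compl₁₂ A A, fun y z => hs _ _, fun y => hQ _⟩

lemma isQuad_comp_linear_iff {ℓ : E → ℝ} (A : F ≃ₗ[ℝ] E) :
    IsQuad (fun y => ℓ (A y)) ↔ IsQuad ℓ := by
  refine ⟨fun h => ?_, fun h => h.comp_linear (A : F →ₗ[ℝ] E)⟩
  simpa using h.comp_linear (A.symm : E →ₗ[ℝ] F)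

end Quadratic

section QuadraticCalculus

variable {E : Type*} [NormedAddCommGroup E] [NormedSpace ℝ E]
  {F : Type*} [NormedAddCommGroup F] [NormedSpace ℝ F]

lemma lineDeriv_quadratic {Q : LinearMap.BilinForm ℝ E} (hs : ∀ y z, Q y z = Q z y) (z w : E) :
    lineDeriv ℝ (fun y => Q y y) z w = 2 * Q z w := by
  have h : (fun t : ℝ => Q (z + t • w) (z + t • w))
      = fun t => Q z z + t * (2 * Q z w) + t ^ 2 * Q w w := by
    funext t
    simp only [map_add, map_smul, LinearMap.add_apply, LinearMap.smul_apply, smul_eq_mul, hs w z]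
    ring
  have h2 : HasDerivAt (fun t : ℝ => Q z z + t * (2 * Q z w) + t ^ 2 * Q w w) (2 * Q z w) 0 := by
    have h3 := (((hasDerivAt_id (0 : ℝ)).mul_const (2 * Q z w)).const_add (Q z z)).add
      ((hasDerivAt_pow 2 (0 : ℝ)).mul_const (Q w w))
    exact h3.congr_deriv (by norm_num)
  rw [lineDeriv, h, h2.deriv]

lemma fundTensor_quadratic {Q : LinearMap.BilinForm ℝ E} (hs : ∀ y z, Q y z = Q z y)
    (y u w : E) : fundTensor (fun y => Q y y) y u w = Q u w := by
  simp only [fundTensor, lineDeriv_quadratic hs]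
  have : HasDerivAt (fun t : ℝ => 2 * Q (y + t • u) w) (2 * Q u w) 0 := by
    have h : (fun t : ℝ => 2 * Q (y + t • u) w) = fun t => 2 * Q y w + t * (2 * Q u w) := by
      funext t
      simp only [map_add, map_smul, LinearMap.add_apply, LinearMap.smul_apply, smul_eq_mul]
      ring
    rw [h]
    simpa using ((hasDerivAt_id (0 : ℝ)).mul_const (2 * Q u w)).const_add (2 * Q y w)
  rw [lineDeriv, this.deriv]; ring

/-- `f` is the homogeneous quadratic map of a continuous bilinear map. -/
def HomQuad (f : E → F) : Prop := ∃ B : E →L[ℝ] E →L[ℝ] F, ∀ y, f y = B y y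

lemma HomQuad.add {f g : E → F} (hf : HomQuad f) (hg : HomQuad g) :
    HomQuad fun y => f y + g y := by
  obtain ⟨B, hB⟩ := hf
  obtain ⟨C, hC⟩ := hg
  exact ⟨B + C, fun y => by simp [hB, hC]⟩

lemma HomQuad.comp {F' : Type*} [NormedAddCommGroup F'] [NormedSpace ℝ F'] {f : E → F}
    (hf : HomQuad f) (A : F' →L[ℝ] E) : HomQuad fun y => f (A y) := by
  obtain ⟨B, hB⟩ := hf
  exact ⟨B.bilinearComp A A, fun y => by simp [hB]⟩

lemma HomQuad.map {F' : Type*} [NormedAddCommGroup F'] [NormedSpace ℝ F'] {f : E → F}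
    (hf : HomQuad f) (A : F →L[ℝ] F') : HomQuad fun y => A (f y) := by
  obtain ⟨B, hB⟩ := hf
  exact ⟨(ContinuousLinearMap.compL ℝ E F F' A).comp B, fun y => by simp [hB]⟩

lemma homQuad_smul (α : E →L[ℝ] ℝ) (A : E →L[ℝ] F) : HomQuad fun y => α y • A y :=
  ⟨((ContinuousLinearMap.lsmul ℝ ℝ (E := F)).bilinearComp α A), fun y => by simp⟩

lemma HomQuad.third_fderiv {O : Set E} (hO : IsOpen O) {f g : E → F} (hf : HomQuad f)
    (hg : EqOn g f O) {η : E} (hη : η ∈ O) (u v : E) :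
    fderiv ℝ (fun y => fderiv ℝ (fun z => fderiv ℝ g z u) y v) η = 0 := by
  obtain ⟨B, hB⟩ := hf
  have h1 : ∀ z ∈ O, fderiv ℝ g z u = (B u + B.flip u) z := by
    intro z hz
    have h2 : HasFDerivAt f (B z + B.flip z) z := by
      rw [show f = fun y => B y y from funext hB]
      have h4 := B.hasFDerivAt (x := z)
      have h5 := h4.clm_apply (hasFDerivAt_id z)
      rw [ContinuousLinearMap.comp_id] at h5
      exact h5
    rw [fderiv_eq_of_eqOn hO hg hz, h2.fderiv]
    simp [add_comm]
  have h2 : ∀ y ∈ O, fderiv ℝ (fun z => fderiv ℝ g z u) y v = (B u + B.flip u) v := by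
    intro y hy
    rw [fderiv_eq_of_eqOn hO h1 hy]
    rw [ContinuousLinearMap.fderiv]
  rw [fderiv_eq_of_eqOn hO h2 hη]
  simp

end QuadraticCalculus

section Local

variable {E : Type*} [NormedAddCommGroup E] [NormedSpace ℝ E] {U : Set E} {L : E → E → ℝ}

namespace LocalFinsler

lemma fundOp_of_quadratic (h : LocalFinsler U L) {ξ η : E} (hξ : ξ ∈ U) (hη : η ≠ 0)
    {Q : LinearMap.BilinForm ℝ E} (hs : ∀ y z, Q y z = Q z y) (hQ : ∀ y, L ξ y = Q y y)
    (u w : E) : fundOp L (ξ, η) u w = Q u w := by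
  rw [← h.fundTensor_eq hξ hη, show L ξ = fun y => Q y y from funext hQ, fundTensor_quadratic hs]

lemma isQuad_iff (h : LocalFinsler U L) {ξ η : E} (hξ : ξ ∈ U) (hη : η ≠ 0) :
    IsQuad (L ξ) ↔ ∀ y, L ξ y = fundOp L (ξ, η) y y := by
  constructor
  · rintro ⟨Q, hs, hQ⟩ y
    rw [h.fundOp_of_quadratic hξ hη hs hQ, hQ]
  · intro hy
    exact ⟨(fundOp L (ξ, η)).toLinearMap₁₂, fun y z => h.fundOp_symm hξ hη y z, hy⟩

lemma fundOp_eq_of_isQuad (h : LocalFinsler U L) {ξ : E} (hξ : ξ ∈ U) (hq : IsQuad (L ξ))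
    {η η' : E} (hη : η ≠ 0) (hη' : η' ≠ 0) : fundOp L (ξ, η) = fundOp L (ξ, η') := by
  obtain ⟨Q, hs, hQ⟩ := hq
  ext u w
  rw [h.fundOp_of_quadratic hξ hη hs hQ, h.fundOp_of_quadratic hξ hη' hs hQ]

/-- Being quadratic is a closed condition on the base point. -/
lemma isQuad_of_mem_closure (h : LocalFinsler U L) {ξ : E} (hξ : ξ ∈ U)
    (hc : ξ ∈ closure {x ∈ U | IsQuad (L x)}) : IsQuad (L ξ) := by
  by_cases hE : ∃ η : E, η ≠ 0
  · obtain ⟨η, hη⟩ := hE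
    rw [h.isQuad_iff hξ hη]
    intro y
    by_cases hy : y = 0
    · simp [hy, h.map_zero]
    obtain ⟨s, hs, hlim⟩ := mem_closure_iff_seq_limit.1 hc
    have h1 : ContinuousAt (fun x => L x y) ξ :=
      (h.contDiffOn_base hy).continuousOn.continuousAt (h.isOpen.mem_nhds hξ)
    have h2 : ContinuousAt (fun x => fundOp L (x, η) y y) ξ := by
      have : ContinuousAt (fun x => fundOp L (x, η)) ξ :=
        (h.contDiffOn_fundOp.continuousOn.continuousAt
          (h.isOpen_dom.mem_nhds (show (ξ, η) ∈ _ from ⟨hξ, hη⟩))).comp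
          (f := fun x : E => (x, η)) (by fun_prop)
      fun_prop
    refine tendsto_nhds_unique (h1.tendsto.comp hlim) ?_
    refine (h2.tendsto.comp hlim).congr fun n => ?_
    exact (((h.isQuad_iff (hs n).1 hη).1 (hs n).2) y).symm
  · push Not at hE
    exact ⟨0, by simp, fun y => by simp [hE y, h.map_zero]⟩

lemma isQuad_of_fderiv_eq_zero (h : LocalFinsler U L) (hE : 1 < Module.rank ℝ E) {ξ : E}
    (hξ : ξ ∈ U)
    (h3 : ∀ η, η ≠ 0 → ∀ u v w,
      fderiv ℝ (fun y => fderiv ℝ (fun z => fderiv ℝ (L ξ) z u) y v) η w = 0) :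
    IsQuad (L ξ) := by
  have : Nontrivial E := rank_pos_iff_nontrivial.1 (lt_trans zero_lt_one hE)
  obtain ⟨η₀, hη₀⟩ := exists_ne (0 : E)
  rw [h.isQuad_iff hξ hη₀]
  intro y
  by_cases hy : y = 0
  · simp [hy, h.map_zero]
  rw [← h.fundOp_self_self hξ hy]
  have key : ∀ u v, ∀ η ∈ ({0}ᶜ : Set E), ∀ η' ∈ ({0}ᶜ : Set E),
      fderiv ℝ (fun z => fderiv ℝ (L ξ) z u) η v = fderiv ℝ (fun z => fderiv ℝ (L ξ) z u) η' v := by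
    intro u v η hη η' hη'
    refine isOpen_compl_singleton.is_const_of_fderiv_eq_zero (𝕜 := ℝ)
      (f := fun η => fderiv ℝ (fun z => fderiv ℝ (L ξ) z u) η v)
      (isConnected_compl_singleton_of_one_lt_rank hE 0).isPreconnected ?_ ?_ hη hη'
    · exact (contDiffOn_fderiv_apply isOpen_compl_singleton (contDiffOn_fderiv_apply
        isOpen_compl_singleton (h.contDiffOn_fibre hξ) u) v).differentiableOn (by simp)
    · intro z hz
      ext w
      exact h3 z hz u v w
  have := key y y y hy η₀ hη₀
  rw [h.fderiv_fderiv_fibre hξ hy, h.fderiv_fderiv_fibre hξ hη₀] at this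
  linarith

lemma isQuad_of_reversible (h : LocalFinsler U L) (hE : Module.finrank ℝ E = 1) {ξ : E}
    (hξ : ξ ∈ U) (hr : ∀ η, L ξ (-η) = L ξ η) : IsQuad (L ξ) := by
  obtain ⟨η, hη, hspan⟩ := finrank_eq_one_iff'.1 hE
  rw [h.isQuad_iff hξ hη]
  intro y
  obtain ⟨c, rfl⟩ := hspan y
  simp only [map_smul, smul_apply, smul_eq_mul, h.fundOp_self_self hξ hη]
  rcases lt_trichotomy c 0 with hc | rfl | hc
  · have h1 := h.homog ξ η (-c) (by linarith)
    rw [neg_smul, hr] at h1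
    rw [h1]; ring
  · simp [h.map_zero]
  · rw [h.homog ξ η c hc]; ring

/-- The gradient is constant on a fibre on which the metric is quadratic. -/
lemma grad_eq_of_isQuad (h : LocalFinsler U L) {ξ : E} (hξ : ξ ∈ U) (hq : IsQuad (L ξ))
    (φ : E →L[ℝ] ℝ) {η η' : E} (hη : η ≠ 0) (hη' : η' ≠ 0) :
    (fundOp L (ξ, η)).inverse φ = (fundOp L (ξ, η')).inverse φ := by
  rw [h.fundOp_eq_of_isQuad hξ hq hη hη']

section Grad

variable [FiniteDimensional ℝ E]

lemma homQuad_sprayCoeff (h : LocalFinsler U L) (hq : ∀ ξ ∈ U, IsQuad (L ξ)) {ξ : E}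
    (hξ : ξ ∈ U) : ∃ f : E → E, HomQuad f ∧ ∀ η, η ≠ 0 → sprayCoeff L ξ η = f η := by
  by_cases hE : ∃ η : E, η ≠ 0
  swap
  · push Not at hE
    exact ⟨fun _ => 0, ⟨0, by simp⟩, fun η hη => absurd (hE η) hη⟩
  obtain ⟨η₀, hη₀⟩ := hE
  set g : E → E →L[ℝ] E →L[ℝ] ℝ := fun x => fundOp L (x, η₀) with hg
  have hgd : HasFDerivAt g (fderiv ℝ g ξ) ξ := by
    have h1 : ContDiffOn ℝ ∞ g U :=
      h.contDiffOn_fundOp.comp (f := fun x : E => (x, η₀)) (by fun_prop) (fun x hx => ⟨hx, hη₀⟩)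
    exact (differentiableAt_of_contDiffOn h.isOpen h1 hξ).hasFDerivAt
  have hgq : ∀ x ∈ U, ∀ y w, lineDeriv ℝ (L x) y w = 2 * g x y w := by
    intro x hx y w
    have h2 := lineDeriv_quadratic (Q := (g x).toLinearMap₁₂)
      (fun y z => h.fundOp_symm hx hη₀ y z) y w
    rw [show L x = fun y => g x y y from funext ((h.isQuad_iff hx hη₀).1 (hq x hx))]
    exact h2
  set g' := fderiv ℝ g ξ with hg'
  have hgw : ∀ η w, HasFDerivAt (fun x => g x η w) ((g'.flip η).flip w) ξ := by
    intro η w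
    have h1 := (hgd.clm_apply (hasFDerivAt_const η ξ)).clm_apply (hasFDerivAt_const w ξ)
    rwa [ContinuousLinearMap.comp_zero, ContinuousLinearMap.comp_zero, zero_add, zero_add] at h1
  have hcov : ∀ η w, sprayCovector L ξ η w = (1 / 4 : ℝ) * (2 * g' η η w - g' w η η) := by
    intro η w
    rw [sprayCovector]
    congr 2
    · have h3 : HasFDerivAt (fun x => 2 * g x η w) ((2 : ℝ) • (g'.flip η).flip w) ξ :=
        (hgw η w).const_mul 2
      refine (Filter.EventuallyEq.lineDeriv_eq ?_).trans
        ((h3.hasLineDerivAt η).lineDeriv.trans (by simp))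
      filter_upwards [h.isOpen.mem_nhds hξ] with x hx using hgq x hx η w
    · have h3 := hgw η η
      refine (Filter.EventuallyEq.lineDeriv_eq ?_).trans
        ((h3.hasLineDerivAt w).lineDeriv.trans (by simp))
      filter_upwards [h.isOpen.mem_nhds hξ] with x hx using (h.isQuad_iff hx hη₀).1 (hq x hx) η
  obtain ⟨B, hB⟩ : ∃ B : E →L[ℝ] E →L[ℝ] E →L[ℝ] ℝ, ∀ η w,
      B η η w = (1 / 4 : ℝ) * (2 * g' η η w - g' w η η) := by
    let T := (ContinuousLinearMap.flipₗᵢ ℝ E E ℝ).toContinuousLinearEquiv.toContinuousLinearMap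
    refine ⟨(1 / 2 : ℝ) • g' + (-(1 / 4) : ℝ) • T.comp g'.flip, fun η w => ?_⟩
    have hT : T.comp g'.flip η η w = g' w η η := rfl
    simp only [add_apply, smul_apply, smul_eq_mul, hT]
    ring
  refine ⟨fun η => (g ξ).inverse (B η η), HomQuad.map ⟨B, fun _ => rfl⟩ _, fun η hη => ?_⟩
  rw [h.sprayCoeff_eq hξ hη, h.fundOp_eq_of_isQuad hξ (hq ξ hξ) hη hη₀]
  congr 1
  ext w
  rw [← h.sprayCovector_eq hξ hη, hcov, hB]

end Grad

end LocalFinsler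

end Local

section Plane

variable {E : Type*} [NormedAddCommGroup E] [NormedSpace ℝ E] [FiniteDimensional ℝ E]
  {U : Set E} {L : E → E → ℝ}

omit [FiniteDimensional ℝ E] in
lemma exists_basis_of_ne_zero (hE : Module.finrank ℝ E = 2) {y : E} (hy : y ≠ 0) :
    ∃ b : Module.Basis (Fin 2) ℝ E, b 0 = y := by
  have : FiniteDimensional ℝ E := Module.finite_of_finrank_eq_succ hE
  obtain ⟨m, hm⟩ := exists_linearIndependent_pair_of_one_lt_finrank (R := ℝ) (by omega) hy
  exact ⟨basisOfLinearIndependentOfCardEqFinrank hm (by simp [hE]), by simp⟩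

namespace LocalFinsler

lemma fderiv_grad_mem_ker (h : LocalFinsler U L) {ξ η : E} (hξ : ξ ∈ U) (hη : η ≠ 0)
    (φ : E →L[ℝ] ℝ) (m : E) :
    fderiv ℝ (L ξ) η (fderiv ℝ (fun z => (fundOp L (ξ, z)).inverse φ) η m) = 0 := by
  set X : E → E := fun z => (fundOp L (ξ, z)).inverse φ with hX
  have h1 : HasFDerivAt X (fderiv ℝ X η) η :=
    (differentiableAt_of_contDiffOn isOpen_compl_singleton (h.contDiffOn_grad hξ φ) hη).hasFDerivAt
  have h2 : HasFDerivAt (fderiv ℝ (L ξ)) (fderiv ℝ (fderiv ℝ (L ξ)) η) η :=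
    (differentiableAt_of_contDiffOn isOpen_compl_singleton (contDiffOn_fderiv_of_isOpen
      isOpen_compl_singleton (h.contDiffOn_fibre hξ)) hη).hasFDerivAt
  have h3 : ∀ z ∈ ({0}ᶜ : Set E), fderiv ℝ (L ξ) z (X z) = ((2 : ℝ) • φ) z := by
    intro z hz
    rw [← h.fundOp_self_left hξ hz, h.fundOp_symm hξ hz, h.fundOp_inverse hξ hz]
    simp
  have h4 := (h2.clm_apply h1).fderiv
  rw [fderiv_eq_of_eqOn isOpen_compl_singleton h3 hη, ContinuousLinearMap.fderiv] at h4
  have h5 := congrArg (fun A : E →L[ℝ] ℝ => A m) h4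
  have h6 : fderiv ℝ (fderiv ℝ (L ξ)) η m (X η) = 2 * φ m := by
    have h7 := (h2.clm_apply (hasFDerivAt_const (X η) η)).fderiv
    have h8 := h.fderiv_fderiv_fibre hξ hη m (X η)
    rw [h7, h.fundOp_symm hξ hη, h.fundOp_inverse hξ hη] at h8
    simpa using h8
  simp only [add_apply, smul_apply, ContinuousLinearMap.comp_apply,
    ContinuousLinearMap.flip_apply, smul_eq_mul] at h5
  linarith

/-- In dimension two, a gradient field without fibre divergence is constant on the fibre. -/
lemma fderiv_grad_eq_zero (h : LocalFinsler U L) (hE : Module.finrank ℝ E = 2) {ξ η : E}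
    (hξ : ξ ∈ U) (hη : η ≠ 0) (φ : E →L[ℝ] ℝ)
    (htr : LinearMap.trace ℝ E
      (fderiv ℝ (fun z => (fundOp L (ξ, z)).inverse φ) η : E →ₗ[ℝ] E) = 0) :
    fderiv ℝ (fun z => (fundOp L (ξ, z)).inverse φ) η = 0 := by
  obtain ⟨b, hb⟩ := exists_basis_of_ne_zero hE hη
  set A := fderiv ℝ (fun z => (fundOp L (ξ, z)).inverse φ) η with hA
  have hA0 : A (b 0) = 0 := by rw [hb]; exact h.fderiv_grad_self hξ hη φ
  rw [LinearMap.trace_eq_matrix_trace ℝ b, Matrix.trace_fin_two, LinearMap.toMatrix_apply,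
    LinearMap.toMatrix_apply] at htr
  have h0 : b.repr (A (b 1)) 1 = 0 := by simpa [hA0] using htr
  have h1 : A (b 1) = b.repr (A (b 1)) 0 • η := by
    have h6 := (b.sum_repr (A (b 1))).symm
    rwa [Fin.sum_univ_two, h0, zero_smul, add_zero, hb] at h6
  have h2 := h.fderiv_grad_mem_ker hξ hη φ (b 1)
  rw [← hA, h1, map_smul, h.fderiv_fibre_self hξ hη, smul_eq_mul] at h2
  have h3 := h.pos hξ hη
  have h4 : b.repr (A (b 1)) 0 = 0 := by
    rcases mul_eq_zero.1 h2 with h | h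
    · exact h
    · linarith
  rw [h4, zero_smul] at h1
  have h5 : (A : E →ₗ[ℝ] E) = 0 := b.ext fun i => by fin_cases i <;> simp [hA0, h1]
  ext v
  exact congrArg (fun B : E →ₗ[ℝ] E => B v) h5

/-- In dimension two, the metric is quadratic on a fibre on which a nonzero gradient field is
constant. -/
lemma isQuad_of_fderiv_grad_eq_zero (h : LocalFinsler U L) (hE : Module.finrank ℝ E = 2) {ξ : E}
    (hξ : ξ ∈ U) {φ : E →L[ℝ] ℝ} (hφ : φ ≠ 0)
    (hD : ∀ η, η ≠ 0 → fderiv ℝ (fun z => (fundOp L (ξ, z)).inverse φ) η = 0) :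
    IsQuad (L ξ) := by
  obtain ⟨η₀, hη₀⟩ : ∃ η : E, η ≠ 0 := by
    by_contra! hne
    exact hφ (by ext v; simp [hne v])
  set X := (fundOp L (ξ, η₀)).inverse φ with hX
  have hrank : 1 < Module.rank ℝ E := by
    rw [← Module.finrank_eq_rank, hE]; norm_num
  have hXφ : ∀ η, η ≠ 0 → ∀ w, fundOp L (ξ, η) X w = φ w := by
    intro η hη
    rw [← h.eq_inverse_iff hξ hη φ X, hX]
    exact isOpen_compl_singleton.is_const_of_fderiv_eq_zero (𝕜 := ℝ)
      (f := fun η => (fundOp L (ξ, η)).inverse φ)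
      (isConnected_compl_singleton_of_one_lt_rank hrank 0).isPreconnected
      ((h.contDiffOn_grad hξ φ).differentiableOn (by simp)) (fun η hη => hD η hη) hη₀ hη
  have hX0 : X ≠ 0 := by
    intro h0
    apply hφ
    ext w
    rw [← hXφ η₀ hη₀ w, h0]; simp
  have hφX : 0 < φ X := by rw [← hXφ X hX0 X]; exact h.fundOp_pos hξ hX0 hX0
  obtain ⟨Y, hYφ, hY0⟩ : ∃ Y, φ Y = 0 ∧ Y ≠ 0 := by
    have := LinearMap.ker_ne_bot_of_finrank_lt (f := (φ : E →ₗ[ℝ] ℝ)) (by simp [hE])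
    obtain ⟨Y, hY, hY0⟩ := (Submodule.ne_bot_iff _).1 this
    exact ⟨Y, hY, hY0⟩
  have hne : ∀ s t : ℝ, t ≠ 0 ∨ s ≠ 0 → s • X + t • Y ≠ 0 := by
    intro s t hst h0
    have h1 : s = 0 := by
      have := congrArg φ h0
      simpa [hYφ, hφX.ne'] using this
    rw [h1, zero_smul, zero_add] at h0
    rcases hst with hst | hst
    · exact (smul_ne_zero hst hY0) h0
    · exact hst h1
  have hLd : ∀ z, z ≠ 0 → HasFDerivAt (L ξ) (fderiv ℝ (L ξ) z) z := fun z hz =>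
    (differentiableAt_of_contDiffOn isOpen_compl_singleton (h.contDiffOn_fibre hξ) hz).hasFDerivAt
  have hDX : ∀ z, z ≠ 0 → fderiv ℝ (L ξ) z X = 2 * φ z := by
    intro z hz
    rw [← h.fundOp_self_left hξ hz, h.fundOp_symm hξ hz, hXφ z hz]
  -- the metric on lines parallel to `X`
  have hline : ∀ s t : ℝ, t ≠ 0 → L ξ (s • X + t • Y) = s ^ 2 * φ X + L ξ (t • Y) := by
    intro s t ht
    have hd : ∀ s : ℝ, HasDerivAt (fun s : ℝ => L ξ (s • X + t • Y) - s ^ 2 * φ X) 0 s := by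
      intro s
      have h1 : HasDerivAt (fun s : ℝ => s • X + t • Y) X s := by
        simpa using ((hasDerivAt_id s).smul_const X).add_const (t • Y)
      have h2 := ((hLd _ (hne s t (Or.inl ht))).comp_hasDerivAt s h1).sub
        ((hasDerivAt_pow 2 s).mul_const (φ X))
      refine h2.congr_deriv ?_
      rw [hDX _ (hne s t (Or.inl ht))]
      simp [hYφ]; ring
    have := is_const_of_deriv_eq_zero (fun s => (hd s).differentiableAt)
      (fun s => (hd s).deriv) s 0
    simp only [zero_smul, zero_add] at this
    linarith [this]
  have hX1 : L ξ X = φ X := by rw [← h.fundOp_self_self hξ hX0, hXφ X hX0]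
  -- the second derivative at `X` in the direction `Y`, from both sides
  set k : ℝ → ℝ := fun t => fderiv ℝ (L ξ) (X + t • Y) Y with hk
  have hk0 : HasDerivAt k (2 * fundOp L (ξ, X) Y Y) 0 := by
    have h1 := differentiableAt_of_contDiffOn isOpen_compl_singleton (contDiffOn_fderiv_apply
      isOpen_compl_singleton (h.contDiffOn_fibre hξ) Y) hX0
    have h2 := h1.hasFDerivAt.hasLineDerivAt Y
    rw [h.fderiv_fderiv_fibre hξ hX0] at h2
    exact h2
  have hkpos : ∀ t : ℝ, t ≠ 0 → ∀ a : ℝ, (∀ᶠ r in 𝓝 t, L ξ (r • Y) = r ^ 2 * a) →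
      k t = 2 * a * t := by
    intro t ht a ha
    have hne' : X + t • Y ≠ 0 := by simpa using hne 1 t (Or.inl ht)
    have h1 : HasDerivAt (fun r : ℝ => X + r • Y) Y t := by
      simpa using ((hasDerivAt_id t).smul_const Y).const_add X
    have h2 := (hLd _ hne').comp_hasDerivAt t h1
    have h3 : HasDerivAt (fun r : ℝ => φ X + r ^ 2 * a) (2 * t * a) t := by
      simpa using ((hasDerivAt_pow 2 t).mul_const a).const_add (φ X)
    have h4 : HasDerivAt (L ξ ∘ fun r : ℝ => X + r • Y) (2 * t * a) t := by
      refine h3.congr_of_eventuallyEq ?_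
      filter_upwards [ha, isOpen_ne.mem_nhds ht] with r hr hr0
      have := hline 1 r hr0
      rw [one_smul, one_pow, one_mul] at this
      simp only [Function.comp, this, hr]
    rw [hk]
    simp only
    rw [h2.unique h4]; ring
  have hk00 : k 0 = 0 := by
    simp only [hk, zero_smul, add_zero]
    rw [← h.fundOp_self_left hξ hX0, hXφ X hX0, hYφ, mul_zero]
  have hp : fundOp L (ξ, X) Y Y = L ξ Y := by
    have h1 : HasDerivWithinAt k (2 * L ξ Y) (Ici 0) 0 := by
      have : HasDerivWithinAt (fun t : ℝ => 2 * L ξ Y * t) (2 * L ξ Y) (Ici 0) 0 := by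
        simpa using ((hasDerivAt_id (0 : ℝ)).const_mul (2 * L ξ Y)).hasDerivWithinAt
      refine this.congr (fun t ht => ?_) (by simp [hk00])
      rcases eq_or_lt_of_le (show (0 : ℝ) ≤ t from ht) with rfl | ht
      · simp [hk00]
      · refine hkpos t ht.ne' _ ?_
        filter_upwards [lt_mem_nhds ht] with r hr using h.homog ξ Y r hr
    have := (uniqueDiffWithinAt_Ici (0 : ℝ)).eq_deriv _ hk0.hasDerivWithinAt h1
    linarith
  have hm : fundOp L (ξ, X) Y Y = L ξ (-Y) := by
    have hneg : ∀ r : ℝ, r < 0 → L ξ (r • Y) = r ^ 2 * L ξ (-Y) := by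
      intro r hr
      have := h.homog ξ (-Y) (-r) (by linarith)
      rw [smul_neg, neg_smul, neg_neg] at this
      rw [this]; ring
    have h1 : HasDerivWithinAt k (2 * L ξ (-Y)) (Iic 0) 0 := by
      have : HasDerivWithinAt (fun t : ℝ => 2 * L ξ (-Y) * t) (2 * L ξ (-Y)) (Iic 0) 0 := by
        simpa using ((hasDerivAt_id (0 : ℝ)).const_mul (2 * L ξ (-Y))).hasDerivWithinAt
      refine this.congr (fun t ht => ?_) (by simp [hk00])
      rcases eq_or_lt_of_le (show t ≤ (0 : ℝ) from ht) with rfl | ht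
      · simp [hk00]
      · refine hkpos t ht.ne _ ?_
        filter_upwards [gt_mem_nhds ht] with r hr using hneg r hr
    have := (uniqueDiffWithinAt_Iic (0 : ℝ)).eq_deriv _ hk0.hasDerivWithinAt h1
    linarith
  have htY : ∀ t : ℝ, L ξ (t • Y) = t ^ 2 * fundOp L (ξ, X) Y Y := by
    intro t
    rcases lt_trichotomy t 0 with ht | rfl | ht
    · have := h.homog ξ (-Y) (-t) (by linarith)
      rw [smul_neg, neg_smul, neg_neg] at this
      rw [this, hm]; ring
    · simp [h.map_zero]
    · rw [h.homog ξ Y t ht, hp]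
  rw [h.isQuad_iff hξ hX0]
  intro y
  obtain ⟨s, t, rfl⟩ : ∃ s t : ℝ, y = s • X + t • Y := by
    have hli : LinearIndependent ℝ ![X, Y] := by
      rw [LinearIndependent.pair_iff]
      intro s t hst
      by_contra hcon
      exact hne s t (by tauto) hst
    set b := basisOfLinearIndependentOfCardEqFinrank hli (by simp [hE]) with hb
    refine ⟨b.repr y 0, b.repr y 1, ?_⟩
    have := (b.sum_repr y).symm
    simpa [Fin.sum_univ_two, hb] using this
  have hYX : fundOp L (ξ, X) Y X = 0 := by rw [h.fundOp_symm hξ hX0, hXφ X hX0, hYφ]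
  simp only [map_add, map_smul, add_apply, smul_apply, smul_eq_mul, hXφ X hX0, hYφ, hYX]
  by_cases ht : t = 0
  · subst ht
    by_cases hs : s = 0
    · simp [hs, h.map_zero]
    have hsX : s • X ≠ 0 := smul_ne_zero hs hX0
    have h1 : fundOp L (ξ, s • X) (s • X) (s • X) = s * (s * φ X) := by
      rw [ContinuousLinearMap.map_smul (fundOp L (ξ, s • X)), smul_apply, hXφ _ hsX, map_smul]
      rfl
    rw [zero_smul, add_zero, ← h.fundOp_self_self hξ hsX, h1]
    ring
  · rw [hline s t ht, htY]; ring

end LocalFinsler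

end Plane

/-! ### Parallel transport for Berwald metrics -/

section Transport

variable {E : Type*} [NormedAddCommGroup E] [NormedSpace ℝ E] [FiniteDimensional ℝ E]
  {U : Set E} {L : E → E → ℝ}

namespace LocalFinsler

lemma two_mul_fderiv_sprayCoeff (h : LocalFinsler U L) {ξ η : E} (hξ : ξ ∈ U) (hη : η ≠ 0) :
    2 * fderiv ℝ (fun p : E × E => L p.1 p.2) (ξ, η) (0, sprayCoeff L ξ η)
      = fderiv ℝ (fun p : E × E => L p.1 p.2) (ξ, η) (η, 0) := by
  have h1 := h.fundOp_sprayCoeff hξ hη η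
  have h2 : fderiv ℝ (fderiv ℝ fun p : E × E => L p.1 p.2) (ξ, η) (η, 0) (0, η)
      = 2 * fderiv ℝ (fun p : E × E => L p.1 p.2) (ξ, η) (η, 0) := by
    have h3 := (h.hasFDerivAt_fderiv_apply hξ hη (0, η)).comp ξ
      (hasFDerivAt_prodMk_left (𝕜 := ℝ) ξ η)
    have h4 := ((h.hasFDerivAt hξ hη).comp ξ (hasFDerivAt_prodMk_left (𝕜 := ℝ) ξ η)).const_mul 2
    have h5 : EqOn ((fun p : E × E => fderiv ℝ (fun p : E × E => L p.1 p.2) p (0, η)) ∘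
        fun x => (x, η)) (fun x => 2 * L x η) U := by
      intro x hx
      simp only [Function.comp]
      rw [← h.fderiv_fibre hx hη, h.fderiv_fibre_self hx hη]
    have h6 := fderiv_eq_of_eqOn h.isOpen h5 hξ
    rw [h3.fderiv] at h6
    erw [h4.fderiv] at h6
    simpa using congrArg (fun A : E →L[ℝ] ℝ => A η) h6
  rw [h.fundOp_symm hξ hη, covOp_apply, h2] at h1
  have h3 := h.fundOp_self_left hξ hη (sprayCoeff L ξ η)
  rw [h.fderiv_fibre hξ hη] at h3
  linarith

/-- The metric is constant along horizontal curves. -/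
lemma fderiv_base_eq (h : LocalFinsler U L) {ξ η : E} (hξ : ξ ∈ U) (hη : η ≠ 0) (w : E) :
    fderiv ℝ (fun p : E × E => L p.1 p.2) (ξ, η) (w, 0)
      = fderiv ℝ (fun p : E × E => L p.1 p.2) (ξ, η) (0, fderiv ℝ (sprayCoeff L ξ) η w) := by
  have hG : HasFDerivAt (sprayCoeff L ξ) (fderiv ℝ (sprayCoeff L ξ) η) η :=
    (differentiableAt_of_contDiffOn isOpen_compl_singleton (h.contDiffOn_sprayCoeff_fibre hξ)
      hη).hasFDerivAt
  have h1 : HasFDerivAt (fun z : E => fderiv ℝ (fun p : E × E => L p.1 p.2) (ξ, z))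
      ((fderiv ℝ (fderiv ℝ fun p : E × E => L p.1 p.2) (ξ, η)).comp
        (ContinuousLinearMap.inr ℝ E E)) η :=
    (h.hasFDerivAt_fderiv hξ hη).comp η (hasFDerivAt_prodMk_right (𝕜 := ℝ) ξ η)
  have h2 := (h1.clm_apply
    ((ContinuousLinearMap.inr ℝ E E).hasFDerivAt.comp η hG)).const_mul (2 : ℝ)
  have h3 := h1.clm_apply ((ContinuousLinearMap.inl ℝ E E).hasFDerivAt (x := η))
  have h4 : EqOn (fun z : E => 2 * fderiv ℝ (fun p : E × E => L p.1 p.2) (ξ, z)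
        ((ContinuousLinearMap.inr ℝ E E ∘ sprayCoeff L ξ) z))
      (fun z : E => fderiv ℝ (fun p : E × E => L p.1 p.2) (ξ, z)
        (ContinuousLinearMap.inl ℝ E E z)) {0}ᶜ := by
    intro z hz
    simpa using h.two_mul_fderiv_sprayCoeff hξ hz
  have h5 := fderiv_eq_of_eqOn isOpen_compl_singleton h4 hη
  rw [h2.fderiv, h3.fderiv] at h5
  have h6 := congrArg (fun A : E →L[ℝ] ℝ => A w) h5
  have h7 := h.fundOp_sprayCoeff hξ hη w
  rw [fundOp_apply, covOp_apply] at h7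
  simp only [smul_apply, add_apply, ContinuousLinearMap.comp_apply,
    ContinuousLinearMap.flip_apply, smul_eq_mul, Function.comp, ContinuousLinearMap.inr_apply,
    ContinuousLinearMap.inl_apply] at h6 h7
  rw [h.fderiv_fderiv_symm hξ hη (0, w) (0, sprayCoeff L ξ η),
    h.fderiv_fderiv_symm hξ hη (0, w) (η, 0)] at h6
  linarith

/-- The Berwald connection in the direction `w`, computed at the reference vector `η₀`. -/
noncomputable def _root_.FinslerGeom.connection (L : E → E → ℝ) (η₀ w ξ : E) : E →L[ℝ] E :=
  fderiv ℝ (fun z => fderiv ℝ (sprayCoeff L ξ) z w) η₀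

lemma fderiv_sprayCoeff_eq_connection (h : LocalFinsler U L) (hE : 1 < Module.rank ℝ E)
    {η₀ : E} (hη₀ : η₀ ≠ 0) {ξ : E} (hξ : ξ ∈ U)
    (hB : ∀ η, η ≠ 0 → ∀ u v, berwaldCurv L ξ η u v = 0) {η : E} (hη : η ≠ 0) (w : E) :
    fderiv ℝ (sprayCoeff L ξ) η w = connection L η₀ w ξ η := by
  have hs := h.contDiffOn_sprayCoeff_fibre hξ
  have hs1 := contDiffOn_fderiv_apply isOpen_compl_singleton hs w
  have h1 : fderiv ℝ (fun z => fderiv ℝ (sprayCoeff L ξ) z w) η η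
      = fderiv ℝ (sprayCoeff L ξ) η w := by
    have := fderiv_self_of_homog (f := fun z => fderiv ℝ (sprayCoeff L ξ) z w)
      (p := fun c => c) (k := 1) (z := η) (hasDerivAt_id 1) (fun c hc => ?_)
      (differentiableAt_of_contDiffOn isOpen_compl_singleton hs1 hη)
    · simpa using this
    · have h2 := fderiv_smul_of_homog (f := sprayCoeff L ξ)
        (fun z hz => h.sprayCoeff_smul hξ hz hc) hη
        (differentiableAt_of_contDiffOn isOpen_compl_singleton hs hη)
      rw [pow_two, ← smul_smul] at h2
      exact congrArg (fun A : E →L[ℝ] E => A w) (smul_right_injective _ hc.ne' h2)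
  rw [← h1]
  refine isOpen_compl_singleton.is_const_of_fderiv_eq_zero (𝕜 := ℝ)
    (f := fun z => fderiv ℝ (fun z => fderiv ℝ (sprayCoeff L ξ) z w) z η)
    (isConnected_compl_singleton_of_one_lt_rank hE 0).isPreconnected
    ((contDiffOn_fderiv_apply isOpen_compl_singleton hs1 η).differentiableOn (by simp))
    (fun z hz => hB z hz w η) hη hη₀

lemma contDiffOn_connection (h : LocalFinsler U L) {η₀ : E} (hη₀ : η₀ ≠ 0) (w : E) :
    ContDiffOn ℝ ∞ (connection L η₀ w) U := by
  have hs := contDiffOn_fderiv_apply h.isOpen_dom h.contDiffOn_sprayCoeff (0, w)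
  have h2 : ContDiffOn ℝ ∞ (fun ξ => (fderiv ℝ (fun p : E × E =>
      fderiv ℝ (fun p : E × E => sprayCoeff L p.1 p.2) p (0, w)) (ξ, η₀)).comp
        (ContinuousLinearMap.inr ℝ E E)) U :=
    ((contDiffOn_fderiv_of_isOpen h.isOpen_dom hs).comp (f := fun x : E => (x, η₀))
      (by fun_prop) (fun x hx => ⟨hx, hη₀⟩)).clm_comp
        (contDiffOn_const (c := ContinuousLinearMap.inr ℝ E E))
  refine h2.congr fun ξ hξ => ?_
  have h3 : ∀ z ∈ ({0}ᶜ : Set E), fderiv ℝ (sprayCoeff L ξ) z w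
      = fderiv ℝ (fun p : E × E => sprayCoeff L p.1 p.2) (ξ, z) (0, w) := by
    intro z hz
    have h4 := (differentiableAt_of_contDiffOn h.isOpen_dom h.contDiffOn_sprayCoeff
      (z := (ξ, z)) ⟨hξ, hz⟩).hasFDerivAt.comp z (hasFDerivAt_prodMk_right (𝕜 := ℝ) ξ z)
    have h5 := congrArg (fun A : E →L[ℝ] E => A w) h4.fderiv
    simpa [Function.comp_def] using h5
  rw [connection, fderiv_eq_of_eqOn isOpen_compl_singleton h3 hη₀]
  exact ((differentiableAt_of_contDiffOn h.isOpen_dom hs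
    (z := (ξ, η₀)) ⟨hξ, hη₀⟩).hasFDerivAt.comp η₀ (hasFDerivAt_prodMk_right (𝕜 := ℝ) ξ η₀)).fderiv

lemma isQuad_iff_eventually (h : LocalFinsler U L) (hE : 1 < Module.rank ℝ E)
    (hB : ∀ ξ ∈ U, ∀ η, η ≠ 0 → ∀ u v, berwaldCurv L ξ η u v = 0) {ξ₀ : E} (hξ₀ : ξ₀ ∈ U)
    (w : E) : ∀ᶠ t : ℝ in 𝓝 0, (IsQuad (L (ξ₀ + t • w)) ↔ IsQuad (L ξ₀)) := by
  have : Nontrivial E := rank_pos_iff_nontrivial.1 (lt_trans zero_lt_one hE)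
  obtain ⟨η₀, hη₀⟩ := exists_ne (0 : E)
  set Γ := connection L η₀ w with hΓ
  set V : E × (E →L[ℝ] E) → E × (E →L[ℝ] E) := fun p => (w, -(Γ p.1).comp p.2) with hV
  have hVs : ContDiffAt ℝ 1 V (ξ₀, ContinuousLinearMap.id ℝ E) := by
    have h1 : ContDiffAt ℝ 1 Γ ξ₀ :=
      ((h.contDiffOn_connection hη₀ w).contDiffAt (h.isOpen.mem_nhds hξ₀)).of_le (by simp)
    have h2 : ContDiffAt ℝ 1 (fun p : E × (E →L[ℝ] E) => Γ p.1) (ξ₀, ContinuousLinearMap.id ℝ E) :=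
      ContDiffAt.comp (g := Γ) (f := Prod.fst) _ h1 contDiffAt_fst
    exact contDiffAt_const.prodMk (h2.clm_comp contDiffAt_snd).neg
  obtain ⟨α, hα0, ε, hε, hα⟩ :=
    hVs.exists_forall_mem_closedBall_exists_eq_forall_mem_Ioo_hasDerivAt₀ 0
  rw [zero_sub, zero_add] at hα
  have hαc : ContinuousAt α 0 := (hα 0 ⟨by linarith, hε⟩).continuousAt
  have hev : ∀ᶠ t in 𝓝 (0 : ℝ), (α t).1 ∈ U ∧
      (α t).2 ∈ range ((↑) : (E ≃L[ℝ] E) → E →L[ℝ] E) := by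
    refine (hαc.fst.eventually_mem ?_).and (hαc.snd.eventually_mem ?_)
    · rw [hα0]; exact h.isOpen.mem_nhds hξ₀
    · rw [hα0]; exact (ContinuousLinearEquiv.refl ℝ E).nhds
  obtain ⟨δ, hδ, hball⟩ := Metric.eventually_nhds_iff_ball.1 (hev.and (Ioo_mem_nhds
    (by linarith : -ε < 0) hε))
  have hd1 : ∀ t ∈ Metric.ball (0 : ℝ) δ, HasDerivAt (fun t => (α t).1) w t := fun t ht =>
    (hα t (hball t ht).2).fst
  have hd2 : ∀ t ∈ Metric.ball (0 : ℝ) δ,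
      HasDerivAt (fun t => (α t).2) (-(Γ (α t).1).comp (α t).2) t := fun t ht =>
    (hα t (hball t ht).2).snd
  have h0 : (0 : ℝ) ∈ Metric.ball (0 : ℝ) δ := Metric.mem_ball_self hδ
  have hpc : IsPreconnected (Metric.ball (0 : ℝ) δ) := (convex_ball (0 : ℝ) δ).isPreconnected
  have hα1 : ∀ t ∈ Metric.ball (0 : ℝ) δ, (α t).1 = ξ₀ + t • w := by
    intro t ht
    have hd : ∀ t ∈ Metric.ball (0 : ℝ) δ, HasDerivAt (fun t => (α t).1 - t • w) 0 t := by
      intro t ht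
      exact ((hd1 t ht).sub ((hasDerivAt_id t).smul_const w)).congr_deriv (by simp)
    have := Metric.isOpen_ball.is_const_of_deriv_eq_zero hpc
      (fun t ht => (hd t ht).differentiableAt.differentiableWithinAt)
      (fun t ht => (hd t ht).deriv) ht h0
    simp only [hα0, zero_smul, sub_zero] at this
    rw [← this]; simp
  have hconst : ∀ t ∈ Metric.ball (0 : ℝ) δ, ∀ y, L (α t).1 ((α t).2 y) = L ξ₀ y := by
    intro t ht y
    by_cases hy : y = 0
    · simp [hy, h.map_zero]
    have hd : ∀ t ∈ Metric.ball (0 : ℝ) δ,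
        HasDerivAt (fun t => L (α t).1 ((α t).2 y)) 0 t := by
      intro t ht
      obtain ⟨⟨hU, e, he⟩, -⟩ := hball t ht
      have hne : (α t).2 y ≠ 0 := by
        rw [← he]; simpa using hy
      have h1 : HasDerivAt (fun t => (α t).2 y) (-(Γ (α t).1 ((α t).2 y))) t := by
        simpa using (hd2 t ht).clm_apply (hasDerivAt_const t y)
      have h2 := (h.hasFDerivAt hU hne).comp_hasDerivAt t ((hd1 t ht).prodMk h1)
      refine h2.congr_deriv ?_
      have h3 : ((w, -(Γ (α t).1 ((α t).2 y))) : E × E)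
          = (w, 0) - (0, Γ (α t).1 ((α t).2 y)) := by simp
      rw [h3, map_sub, h.fderiv_base_eq hU hne,
        h.fderiv_sprayCoeff_eq_connection hE hη₀ hU (hB _ hU) hne, sub_self]
    have := Metric.isOpen_ball.is_const_of_deriv_eq_zero hpc
      (fun t ht => (hd t ht).differentiableAt.differentiableWithinAt)
      (fun t ht => (hd t ht).deriv) ht h0
    simpa [hα0] using this
  filter_upwards [Metric.ball_mem_nhds (0 : ℝ) hδ] with t ht
  obtain ⟨⟨-, e, he⟩, -⟩ := hball t ht
  rw [← hα1 t ht, ← isQuad_comp_linear_iff e.toLinearEquiv]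
  have : (fun y => L (α t).1 (e.toLinearEquiv y)) = L ξ₀ := by
    funext y
    rw [← hconst t ht y, ← he]; rfl
  rw [this]

/-- On a convex coordinate domain, a Berwald metric which is quadratic at one point is quadratic
everywhere. -/
lemma isQuad_iff_of_convex (h : LocalFinsler U L) (hE : 1 < Module.rank ℝ E)
    (hB : ∀ ξ ∈ U, ∀ η, η ≠ 0 → ∀ u v, berwaldCurv L ξ η u v = 0) (hU : Convex ℝ U) {ξ ξ' : E}
    (hξ : ξ ∈ U) (hξ' : ξ' ∈ U) : IsQuad (L ξ) ↔ IsQuad (L ξ') := by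
  have hmem : ∀ t : Icc (0 : ℝ) 1, ξ + (t : ℝ) • (ξ' - ξ) ∈ U := fun t =>
    hU.add_smul_sub_mem hξ hξ' t.2
  have hloc : IsLocallyConstant fun t : Icc (0 : ℝ) 1 => IsQuad (L (ξ + (t : ℝ) • (ξ' - ξ))) := by
    rw [IsLocallyConstant.iff_eventually_eq]
    intro t
    have h1 := h.isQuad_iff_eventually hE hB (hmem t) (ξ' - ξ)
    have h2 : Tendsto (fun s : Icc (0 : ℝ) 1 => (s : ℝ) - t) (𝓝 t) (𝓝 0) := by
      have : Continuous fun s : Icc (0 : ℝ) 1 => (s : ℝ) - t := by fun_prop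
      simpa using this.tendsto t
    filter_upwards [h2.eventually h1] with s hs
    have h3 : ξ + (t : ℝ) • (ξ' - ξ) + ((s : ℝ) - t) • (ξ' - ξ) = ξ + (s : ℝ) • (ξ' - ξ) := by
      rw [add_assoc, ← add_smul]; congr 2; ring
    rw [h3] at hs
    exact propext hs
  have := hloc.apply_eq_of_preconnectedSpace ⟨0, by simp⟩ ⟨1, by simp⟩
  simpa using this

end LocalFinsler

end Transport

/-! ### The spray of a doubly warped product in coordinates -/

section ProductSpray

variable {E₁ : Type*} [NormedAddCommGroup E₁] [NormedSpace ℝ E₁]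
  {E₂ : Type*} [NormedAddCommGroup E₂] [NormedSpace ℝ E₂]

/-- The square of a doubly warped product metric in coordinates. -/
def prodSq (L₁ : E₁ → E₁ → ℝ) (L₂ : E₂ → E₂ → ℝ) (a : E₁ → ℝ) (b : E₂ → ℝ) (ξ η : E₁ × E₂) : ℝ :=
  b ξ.2 ^ 2 * L₁ ξ.1 η.1 + a ξ.1 ^ 2 * L₂ ξ.2 η.2

variable (E₁ E₂) in
/-- The pairs of vectors with both components nonzero. -/
def slit : Set (E₁ × E₂) := {0}ᶜ ×ˢ {0}ᶜ

omit [NormedSpace ℝ E₁] [NormedSpace ℝ E₂] in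
lemma isOpen_slit : IsOpen (slit E₁ E₂) :=
  isOpen_compl_singleton.prod isOpen_compl_singleton

lemma lineDeriv_add_prod {f : E₁ → ℝ} {g : E₂ → ℝ} {z : E₁ × E₂}
    (hf : DifferentiableAt ℝ f z.1) (hg : DifferentiableAt ℝ g z.2) (c d : ℝ) (w : E₁ × E₂) :
    lineDeriv ℝ (fun z : E₁ × E₂ => c * f z.1 + d * g z.2) z w
      = c * fderiv ℝ f z.1 w.1 + d * fderiv ℝ g z.2 w.2 := by
  have h1 := ((hf.hasFDerivAt.comp z hasFDerivAt_fst).const_mul c).add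
    ((hg.hasFDerivAt.comp z hasFDerivAt_snd).const_mul d)
  exact (h1.hasLineDerivAt w).lineDeriv.trans (by simp)

lemma lineDeriv_warped {p a : E₁ → ℝ} {q b : E₂ → ℝ} {z : E₁ × E₂} {p' : E₁ →L[ℝ] ℝ}
    {q' : E₂ →L[ℝ] ℝ} (hp : HasFDerivAt p p' z.1) (hq : HasFDerivAt q q' z.2)
    (ha : DifferentiableAt ℝ a z.1) (hb : DifferentiableAt ℝ b z.2) (w : E₁ × E₂) :
    lineDeriv ℝ (fun z : E₁ × E₂ => b z.2 ^ 2 * p z.1 + a z.1 ^ 2 * q z.2) z w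
      = 2 * b z.2 * fderiv ℝ b z.2 w.2 * p z.1 + b z.2 ^ 2 * p' w.1
        + 2 * a z.1 * fderiv ℝ a z.1 w.1 * q z.2 + a z.1 ^ 2 * q' w.2 := by
  have h1 := (((hb.hasFDerivAt.comp z hasFDerivAt_snd).pow 2).mul
      (hp.comp z hasFDerivAt_fst)).add
    (((ha.hasFDerivAt.comp z hasFDerivAt_fst).pow 2).mul (hq.comp z hasFDerivAt_snd))
  refine (h1.hasLineDerivAt w).lineDeriv.trans ?_
  simp
  ring

variable {U₁ : Set E₁} {U₂ : Set E₂} {L₁ : E₁ → E₁ → ℝ} {L₂ : E₂ → E₂ → ℝ} {a : E₁ → ℝ}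
  {b : E₂ → ℝ}

lemma lineDeriv_prodSq (h₁ : LocalFinsler U₁ L₁) (h₂ : LocalFinsler U₂ L₂) {ξ η : E₁ × E₂}
    (hξ : ξ ∈ U₁ ×ˢ U₂) (hη : η ∈ slit E₁ E₂) (w : E₁ × E₂) :
    lineDeriv ℝ (prodSq L₁ L₂ a b ξ) η w
      = b ξ.2 ^ 2 * fderiv ℝ (L₁ ξ.1) η.1 w.1 + a ξ.1 ^ 2 * fderiv ℝ (L₂ ξ.2) η.2 w.2 :=
  lineDeriv_add_prod
    (differentiableAt_of_contDiffOn isOpen_compl_singleton (h₁.contDiffOn_fibre hξ.1) hη.1)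
    (differentiableAt_of_contDiffOn isOpen_compl_singleton (h₂.contDiffOn_fibre hξ.2) hη.2) _ _ w

lemma fundTensor_prodSq (h₁ : LocalFinsler U₁ L₁) (h₂ : LocalFinsler U₂ L₂) {ξ η : E₁ × E₂}
    (hξ : ξ ∈ U₁ ×ˢ U₂) (hη : η ∈ slit E₁ E₂) (u w : E₁ × E₂) :
    fundTensor (prodSq L₁ L₂ a b ξ) η u w
      = b ξ.2 ^ 2 * fundOp L₁ (ξ.1, η.1) u.1 w.1 + a ξ.1 ^ 2 * fundOp L₂ (ξ.2, η.2) u.2 w.2 := by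
  have h3 : lineDeriv ℝ (fun z => lineDeriv ℝ (prodSq L₁ L₂ a b ξ) z w) η u
      = lineDeriv ℝ (fun z : E₁ × E₂ => b ξ.2 ^ 2 * fderiv ℝ (L₁ ξ.1) z.1 w.1
        + a ξ.1 ^ 2 * fderiv ℝ (L₂ ξ.2) z.2 w.2) η u := by
    refine Filter.EventuallyEq.lineDeriv_eq ?_
    filter_upwards [isOpen_slit.mem_nhds hη] with z hz using lineDeriv_prodSq h₁ h₂ hξ hz w
  rw [fundTensor, h3, lineDeriv_add_prod (f := fun z => fderiv ℝ (L₁ ξ.1) z w.1)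
    (g := fun z => fderiv ℝ (L₂ ξ.2) z w.2)
    (differentiableAt_of_contDiffOn isOpen_compl_singleton (contDiffOn_fderiv_apply
      isOpen_compl_singleton (h₁.contDiffOn_fibre hξ.1) _) hη.1)
    (differentiableAt_of_contDiffOn isOpen_compl_singleton (contDiffOn_fderiv_apply
      isOpen_compl_singleton (h₂.contDiffOn_fibre hξ.2) _) hη.2),
    h₁.fderiv_fderiv_fibre hξ.1 hη.1, h₂.fderiv_fderiv_fibre hξ.2 hη.2]
  ring

lemma sprayCovector_prodSq (h₁ : LocalFinsler U₁ L₁) (h₂ : LocalFinsler U₂ L₂)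
    (ha : ContDiffOn ℝ ∞ a U₁) (hb : ContDiffOn ℝ ∞ b U₂) {ξ η : E₁ × E₂}
    (hξ : ξ ∈ U₁ ×ˢ U₂) (hη : η ∈ slit E₁ E₂) (w : E₁ × E₂) :
    sprayCovector (prodSq L₁ L₂ a b) ξ η w
      = b ξ.2 ^ 2 * covOp L₁ (ξ.1, η.1) w.1 + a ξ.1 ^ 2 * covOp L₂ (ξ.2, η.2) w.2
        + b ξ.2 * fderiv ℝ b ξ.2 η.2 * fundOp L₁ (ξ.1, η.1) η.1 w.1
        + a ξ.1 * fderiv ℝ a ξ.1 η.1 * fundOp L₂ (ξ.2, η.2) η.2 w.2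
        - (1 / 2 : ℝ) * b ξ.2 * fderiv ℝ b ξ.2 w.2 * L₁ ξ.1 η.1
        - (1 / 2 : ℝ) * a ξ.1 * fderiv ℝ a ξ.1 w.1 * L₂ ξ.2 η.2 := by
  have hda := differentiableAt_of_contDiffOn h₁.isOpen ha hξ.1
  have hdb := differentiableAt_of_contDiffOn h₂.isOpen hb hξ.2
  have h3 : lineDeriv ℝ (fun x => lineDeriv ℝ (prodSq L₁ L₂ a b x) η w) ξ η
      = lineDeriv ℝ (fun x : E₁ × E₂ =>
        b x.2 ^ 2 * fderiv ℝ (fun p : E₁ × E₁ => L₁ p.1 p.2) (x.1, η.1) (0, w.1)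
        + a x.1 ^ 2 * fderiv ℝ (fun p : E₂ × E₂ => L₂ p.1 p.2) (x.2, η.2) (0, w.2)) ξ η := by
    refine Filter.EventuallyEq.lineDeriv_eq ?_
    filter_upwards [(h₁.isOpen.prod h₂.isOpen).mem_nhds hξ] with x hx
    rw [lineDeriv_prodSq h₁ h₂ hx hη w, h₁.fderiv_fibre hx.1 hη.1, h₂.fderiv_fibre hx.2 hη.2]
  have h4 := lineDeriv_warped (z := ξ) (a := a) (b := b)
    ((h₁.hasFDerivAt_fderiv_apply hξ.1 hη.1 (0, w.1)).comp ξ.1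
      (hasFDerivAt_prodMk_left (𝕜 := ℝ) ξ.1 η.1))
    ((h₂.hasFDerivAt_fderiv_apply hξ.2 hη.2 (0, w.2)).comp ξ.2
      (hasFDerivAt_prodMk_left (𝕜 := ℝ) ξ.2 η.2)) hda hdb η
  have h5 := lineDeriv_warped (z := ξ) (a := a) (b := b)
    ((h₁.hasFDerivAt hξ.1 hη.1).comp ξ.1 (hasFDerivAt_prodMk_left (𝕜 := ℝ) ξ.1 η.1))
    ((h₂.hasFDerivAt hξ.2 hη.2).comp ξ.2 (hasFDerivAt_prodMk_left (𝕜 := ℝ) ξ.2 η.2)) hda hdb w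
  have h6 : lineDeriv ℝ (fun x => prodSq L₁ L₂ a b x η) ξ w
      = lineDeriv ℝ (fun x : E₁ × E₂ => b x.2 ^ 2 * L₁ x.1 η.1 + a x.1 ^ 2 * L₂ x.2 η.2) ξ w := rfl
  have h7 := h₁.fundOp_self_left hξ.1 hη.1 w.1
  have h8 := h₂.fundOp_self_left hξ.2 hη.2 w.2
  rw [h₁.fderiv_fibre hξ.1 hη.1] at h7
  rw [h₂.fderiv_fibre hξ.2 hη.2] at h8
  simp only [Function.comp, ContinuousLinearMap.comp_apply, ContinuousLinearMap.flip_apply,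
    ContinuousLinearMap.inl_apply] at h4 h5
  rw [sprayCovector, h3, h4, h6, h5, covOp_apply, covOp_apply, ← h7, ← h8]
  ring

variable [FiniteDimensional ℝ E₁] [FiniteDimensional ℝ E₂]

/-- The spray coefficients of a doubly warped product. -/
lemma sprayCoeff_prodSq (h₁ : LocalFinsler U₁ L₁) (h₂ : LocalFinsler U₂ L₂)
    (ha : ContDiffOn ℝ ∞ a U₁) (hb : ContDiffOn ℝ ∞ b U₂) {ξ η : E₁ × E₂}
    (hξ : ξ ∈ U₁ ×ˢ U₂) (ha0 : 0 < a ξ.1) (hb0 : 0 < b ξ.2) (hη : η ∈ slit E₁ E₂) :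
    sprayCoeff (prodSq L₁ L₂ a b) ξ η
      = (sprayCoeff L₁ ξ.1 η.1 + ((b ξ.2)⁻¹ • fderiv ℝ b ξ.2) η.2 • η.1
          + (-(a ξ.1 / (2 * b ξ.2 ^ 2)) * L₂ ξ.2 η.2) •
            (fundOp L₁ (ξ.1, η.1)).inverse (fderiv ℝ a ξ.1),
        sprayCoeff L₂ ξ.2 η.2 + ((a ξ.1)⁻¹ • fderiv ℝ a ξ.1) η.1 • η.2
          + (-(b ξ.2 / (2 * a ξ.1 ^ 2)) * L₁ ξ.1 η.1) •
            (fundOp L₂ (ξ.2, η.2)).inverse (fderiv ℝ b ξ.2)) := by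
  set S : E₁ × E₂ := (_, _) with hS
  have hsol : ∀ w, fundTensor (prodSq L₁ L₂ a b ξ) η S w
      = sprayCovector (prodSq L₁ L₂ a b) ξ η w := by
    intro w
    rw [fundTensor_prodSq h₁ h₂ hξ hη, sprayCovector_prodSq h₁ h₂ ha hb hξ hη, hS]
    simp only [map_add, map_smul, add_apply, smul_apply, smul_eq_mul,
      h₁.fundOp_sprayCoeff hξ.1 hη.1, h₂.fundOp_sprayCoeff hξ.2 hη.2,
      h₁.fundOp_inverse hξ.1 hη.1, h₂.fundOp_inverse hξ.2 hη.2]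
    field_simp
    ring
  have hex : ∃ G, ∀ w, fundTensor (prodSq L₁ L₂ a b ξ) η G w
      = sprayCovector (prodSq L₁ L₂ a b) ξ η w := ⟨S, hsol⟩
  rw [sprayCoeff, dif_pos hex]
  have huniq : ∀ w, fundTensor (prodSq L₁ L₂ a b ξ) η hex.choose w
      = fundTensor (prodSq L₁ L₂ a b ξ) η S w := fun w => by rw [hsol, hex.choose_spec w]
  generalize hex.choose = T at huniq ⊢
  simp only [fundTensor_prodSq h₁ h₂ hξ hη] at huniq
  refine Prod.ext ?_ ?_
  · apply h₁.fundOp_injective hξ.1 hη.1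
    ext w
    have := huniq (w, 0)
    simp only [map_zero, mul_zero, add_zero] at this
    exact mul_left_cancel₀ (pow_pos hb0 2).ne' this
  · apply h₂.fundOp_injective hξ.2 hη.2
    ext w
    have := huniq (0, w)
    simp only [map_zero, mul_zero, zero_add] at this
    exact mul_left_cancel₀ (pow_pos ha0 2).ne' this

end ProductSpray

/-! ### Fibre derivatives of sprays of product type -/

section DirDeriv

variable {E : Type*} [NormedAddCommGroup E] [NormedSpace ℝ E]
  {F : Type*} [NormedAddCommGroup F] [NormedSpace ℝ F]

/-- The derivative of `f` in the direction `u`, as a function of the point. -/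
noncomputable def ddir (f : E → F) (u : E) : E → F := fun z => fderiv ℝ f z u

lemma ddir_const (c : F) (u : E) : ddir (fun _ : E => c) u = fun _ => 0 := by
  funext z; simp [ddir]

lemma ddir_id (u : E) : ddir (id : E → E) u = fun _ => u := by
  funext z; simp [ddir]

lemma ddir_clm (A : E →L[ℝ] F) (u : E) : ddir (A : E → F) u = fun _ => A u := by
  funext z; simp [ddir]

lemma _root_.ContDiffOn.ddir {O : Set E} (hO : IsOpen O) {f : E → F} (hf : ContDiffOn ℝ ∞ f O) (u : E) :
    ContDiffOn ℝ ∞ (ddir f u) O :=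
  contDiffOn_fderiv_apply hO hf u

end DirDeriv

section Bisum

variable {E₁ : Type*} [NormedAddCommGroup E₁] [NormedSpace ℝ E₁]
  {E₂ : Type*} [NormedAddCommGroup E₂] [NormedSpace ℝ E₂]
  {F₁ : Type*} [NormedAddCommGroup F₁] [NormedSpace ℝ F₁]
  {F₂ : Type*} [NormedAddCommGroup F₂] [NormedSpace ℝ F₂]
  {F : Type*} [NormedAddCommGroup F] [NormedSpace ℝ F] {ι : Type*} [Fintype ι]

/-- The sum `∑ i, β (X i y, p i v)` as a function of `(y, v)`. -/
noncomputable def bisum (β : F₁ →L[ℝ] F₂ →L[ℝ] F) (X : ι → E₁ → F₁) (p : ι → E₂ → F₂) (z : E₁ × E₂) : F :=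
  ∑ i, β (X i z.1) (p i z.2)

variable {β : F₁ →L[ℝ] F₂ →L[ℝ] F} {X : ι → E₁ → F₁} {p : ι → E₂ → F₂}

lemma fderiv_bisum {f : E₁ × E₂ → F} (hf : EqOn f (bisum β X p) (slit E₁ E₂))
    (hX : ∀ i, ContDiffOn ℝ ∞ (X i) {0}ᶜ) (hp : ∀ i, ContDiffOn ℝ ∞ (p i) {0}ᶜ)
    {z : E₁ × E₂} (hz : z ∈ slit E₁ E₂) (w : E₁ × E₂) :
    fderiv ℝ f z w = bisum β (fun i => ddir (X i) w.1) p z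
      + bisum β X (fun i => ddir (p i) w.2) z := by
  have h1 : ∀ i, HasFDerivAt (fun z : E₁ × E₂ => β (X i z.1) (p i z.2)) _ z := fun i =>
    (β.hasFDerivAt.comp z ((differentiableAt_of_contDiffOn isOpen_compl_singleton (hX i)
      hz.1).hasFDerivAt.comp z hasFDerivAt_fst)).clm_apply
      ((differentiableAt_of_contDiffOn isOpen_compl_singleton (hp i)
      hz.2).hasFDerivAt.comp z hasFDerivAt_snd)
  have h2 := HasFDerivAt.fun_sum (u := Finset.univ) fun i _ => h1 i
  rw [fderiv_eq_of_eqOn isOpen_slit hf hz]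
  unfold bisum
  rw [h2.fderiv]
  simp [Finset.sum_add_distrib, add_comm, ddir]

lemma ddir_bisum_left {f : E₁ × E₂ → F} (hf : EqOn f (bisum β X p) (slit E₁ E₂))
    (hX : ∀ i, ContDiffOn ℝ ∞ (X i) {0}ᶜ) (hp : ∀ i, ContDiffOn ℝ ∞ (p i) {0}ᶜ) (a : E₁) :
    EqOn (ddir f (a, 0)) (bisum β (fun i => ddir (X i) a) p)
      (slit E₁ E₂) := by
  intro z hz
  rw [ddir, fderiv_bisum hf hX hp hz]
  simp [bisum, ddir]

lemma ddir_bisum_right {f : E₁ × E₂ → F} (hf : EqOn f (bisum β X p) (slit E₁ E₂))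
    (hX : ∀ i, ContDiffOn ℝ ∞ (X i) {0}ᶜ) (hp : ∀ i, ContDiffOn ℝ ∞ (p i) {0}ᶜ) (b : E₂) :
    EqOn (ddir f (0, b)) (bisum β X (fun i => ddir (p i) b))
      (slit E₁ E₂) := by
  intro z hz
  rw [ddir, fderiv_bisum hf hX hp hz]
  simp [bisum, ddir]

lemma contDiffOn_bisum (β : F₁ →L[ℝ] F₂ →L[ℝ] F) (hX : ∀ i, ContDiffOn ℝ ∞ (X i) {0}ᶜ)
    (hp : ∀ i, ContDiffOn ℝ ∞ (p i) {0}ᶜ) :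
    ContDiffOn ℝ ∞ (bisum β X p) (slit E₁ E₂) := by
  unfold bisum
  refine ContDiffOn.sum fun i _ => ContDiffOn.clm_apply ?_ ?_
  · exact β.contDiff.comp_contDiffOn
      ((hX i).comp contDiffOn_fst (fun z hz => hz.1))
  · exact (hp i).comp contDiffOn_snd (fun z hz => hz.2)

end Bisum

section Trace

variable {E₁ : Type*} [NormedAddCommGroup E₁] [NormedSpace ℝ E₁] [FiniteDimensional ℝ E₁]
  {E₂ : Type*} [NormedAddCommGroup E₂] [NormedSpace ℝ E₂] [FiniteDimensional ℝ E₂]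

variable (E₁) in
/-- The trace as a continuous linear functional. -/
noncomputable def traceL : (E₁ →L[ℝ] E₁) →L[ℝ] ℝ :=
  LinearMap.toContinuousLinearMap
    ((LinearMap.trace ℝ E₁).comp (ContinuousLinearMap.coeLM ℝ))

lemma traceL_apply (A : E₁ →L[ℝ] E₁) :
    traceL E₁ A = LinearMap.trace ℝ E₁ (A : E₁ →ₗ[ℝ] E₁) := rfl

lemma trace_prod_eq (A : E₁ × E₂ →L[ℝ] E₁ × E₂) :
    LinearMap.trace ℝ (E₁ × E₂) (A : E₁ × E₂ →ₗ[ℝ] E₁ × E₂)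
      = traceL E₁ ((ContinuousLinearMap.fst ℝ E₁ E₂).comp
          (A.comp (ContinuousLinearMap.inl ℝ E₁ E₂)))
        + traceL E₂ ((ContinuousLinearMap.snd ℝ E₁ E₂).comp
          (A.comp (ContinuousLinearMap.inr ℝ E₁ E₂))) := by
  have h : (A : E₁ × E₂ →ₗ[ℝ] E₁ × E₂)
      = ((A : E₁ × E₂ →ₗ[ℝ] E₁ × E₂) ∘ₗ LinearMap.inl ℝ E₁ E₂) ∘ₗ LinearMap.fst ℝ E₁ E₂
        + ((A : E₁ × E₂ →ₗ[ℝ] E₁ × E₂) ∘ₗ LinearMap.inr ℝ E₁ E₂) ∘ₗ LinearMap.snd ℝ E₁ E₂ := by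
    refine LinearMap.ext fun z => ?_
    simp only [LinearMap.add_apply, LinearMap.comp_apply, LinearMap.fst_apply,
      LinearMap.snd_apply, ← map_add]
    simp
  rw [h, map_add, LinearMap.trace_comp_comm', LinearMap.trace_comp_comm' (LinearMap.snd ℝ E₁ E₂)]
  rfl

end Trace

section ProdSpray

variable {E₁ : Type*} [NormedAddCommGroup E₁] [NormedSpace ℝ E₁]
  {E₂ : Type*} [NormedAddCommGroup E₂] [NormedSpace ℝ E₂]

/-- A function of the form `(G₁(y) + α(v) y + q(v) X₁(y), G₂(v) + β(y) v + r(y) X₂(v))`. -/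
structure IsProdSpray (S : E₁ × E₂ → E₁ × E₂) (G₁ X₁ : E₁ → E₁) (q : E₂ → ℝ) (α : E₂ →L[ℝ] ℝ)
    (G₂ X₂ : E₂ → E₂) (r : E₁ → ℝ) (β : E₁ →L[ℝ] ℝ) : Prop where
  smooth_G₁ : ContDiffOn ℝ ∞ G₁ {0}ᶜ
  smooth_X₁ : ContDiffOn ℝ ∞ X₁ {0}ᶜ
  smooth_q : ContDiffOn ℝ ∞ q {0}ᶜ
  smooth_G₂ : ContDiffOn ℝ ∞ G₂ {0}ᶜ
  smooth_X₂ : ContDiffOn ℝ ∞ X₂ {0}ᶜ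
  smooth_r : ContDiffOn ℝ ∞ r {0}ᶜ
  eq : ∀ z ∈ slit E₁ E₂, S z = (G₁ z.1 + α z.2 • z.1 + q z.2 • X₁ z.1,
    G₂ z.2 + β z.1 • z.2 + r z.1 • X₂ z.2)

namespace IsProdSpray

variable {S : E₁ × E₂ → E₁ × E₂} {G₁ X₁ : E₁ → E₁} {q : E₂ → ℝ} {α : E₂ →L[ℝ] ℝ}
    {G₂ X₂ : E₂ → E₂} {r : E₁ → ℝ} {β : E₁ →L[ℝ] ℝ}

/-- The coefficients of the first component. -/
def vec (G₁ X₁ : E₁ → E₁) : Fin 3 → E₁ → E₁ := ![G₁, id, X₁]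

/-- The scalar coefficients. -/
def coef (α : E₂ →L[ℝ] ℝ) (q : E₂ → ℝ) : Fin 3 → E₂ → ℝ := ![fun _ => 1, α, q]

lemma contDiffOn_vec (hG : ContDiffOn ℝ ∞ G₁ {0}ᶜ) (hX : ContDiffOn ℝ ∞ X₁ {0}ᶜ) (i : Fin 3) :
    ContDiffOn ℝ ∞ (vec G₁ X₁ i) {0}ᶜ := by
  fin_cases i
  · exact hG
  · exact contDiffOn_id
  · exact hX

lemma contDiffOn_coef (hq : ContDiffOn ℝ ∞ q {0}ᶜ) (i : Fin 3) :
    ContDiffOn ℝ ∞ (coef α q i) {0}ᶜ := by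
  fin_cases i
  · exact contDiffOn_const
  · exact α.contDiff.contDiffOn
  · exact hq

lemma fst_eqOn (h : IsProdSpray S G₁ X₁ q α G₂ X₂ r β) :
    EqOn (fun z => (S z).1) (bisum (ContinuousLinearMap.lsmul ℝ ℝ).flip (vec G₁ X₁) (coef α q))
      (slit E₁ E₂) := by
  intro z hz
  simp [h.eq z hz, bisum, Fin.sum_univ_three, vec, coef]

lemma snd_eqOn (h : IsProdSpray S G₁ X₁ q α G₂ X₂ r β) :
    EqOn (fun z => (S z).2) (bisum (ContinuousLinearMap.lsmul ℝ ℝ) (coef β r) (vec G₂ X₂))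
      (slit E₁ E₂) := by
  intro z hz
  simp [h.eq z hz, bisum, Fin.sum_univ_three, vec, coef]

lemma contDiffOn (h : IsProdSpray S G₁ X₁ q α G₂ X₂ r β) : ContDiffOn ℝ ∞ S (slit E₁ E₂) := by
  have h1 := (contDiffOn_bisum (ContinuousLinearMap.lsmul ℝ ℝ).flip
    (contDiffOn_vec h.smooth_G₁ h.smooth_X₁) (contDiffOn_coef (α := α) h.smooth_q)).congr h.fst_eqOn
  have h2 := (contDiffOn_bisum (ContinuousLinearMap.lsmul ℝ ℝ)
    (contDiffOn_coef (α := β) h.smooth_r) (contDiffOn_vec h.smooth_G₂ h.smooth_X₂)).congr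
    h.snd_eqOn
  exact h1.prodMk h2

end IsProdSpray

end ProdSpray

section Components

variable {E : Type*} [NormedAddCommGroup E] [NormedSpace ℝ E]
  {E₁ : Type*} [NormedAddCommGroup E₁] [NormedSpace ℝ E₁]
  {E₂ : Type*} [NormedAddCommGroup E₂] [NormedSpace ℝ E₂] {O : Set E} {S : E → E₁ × E₂}

lemma ddir_congr {F : Type*} [NormedAddCommGroup F] [NormedSpace ℝ F] (hO : IsOpen O)
    {f g : E → F} (h : EqOn f g O) (u : E) : EqOn (ddir f u) (ddir g u) O := fun z hz => by
  rw [ddir, ddir, fderiv_eq_of_eqOn hO h hz]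

lemma ddir_fst (hO : IsOpen O) (hS : ContDiffOn ℝ ∞ S O) (w : E) :
    EqOn (fun z => (ddir S w z).1) (ddir (fun z => (S z).1) w) O := fun z hz => by
  simp only [ddir, (differentiableAt_of_contDiffOn hO hS hz).hasFDerivAt.fst.fderiv]; rfl

lemma ddir_snd (hO : IsOpen O) (hS : ContDiffOn ℝ ∞ S O) (w : E) :
    EqOn (fun z => (ddir S w z).2) (ddir (fun z => (S z).2) w) O := fun z hz => by
  simp only [ddir, (differentiableAt_of_contDiffOn hO hS hz).hasFDerivAt.snd.fderiv]; rfl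

lemma ddir_ddir_ddir_fst (hO : IsOpen O) (hS : ContDiffOn ℝ ∞ S O) (u v w : E) :
    EqOn (fun z => (ddir (ddir (ddir S u) v) w z).1)
      (ddir (ddir (ddir (fun z => (S z).1) u) v) w) O :=
  (ddir_fst hO ((hS.ddir hO u).ddir hO v) w).trans (ddir_congr hO
    ((ddir_fst hO (hS.ddir hO u) v).trans (ddir_congr hO (ddir_fst hO hS u) v)) w)

lemma ddir_ddir_ddir_snd (hO : IsOpen O) (hS : ContDiffOn ℝ ∞ S O) (u v w : E) :
    EqOn (fun z => (ddir (ddir (ddir S u) v) w z).2)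
      (ddir (ddir (ddir (fun z => (S z).2) u) v) w) O :=
  (ddir_snd hO ((hS.ddir hO u).ddir hO v) w).trans (ddir_congr hO
    ((ddir_snd hO (hS.ddir hO u) v).trans (ddir_congr hO (ddir_snd hO hS u) v)) w)

end Components

section Mean

variable {E₁ : Type*} [NormedAddCommGroup E₁] [NormedSpace ℝ E₁]
  {E₂ : Type*} [NormedAddCommGroup E₂] [NormedSpace ℝ E₂]

/-- The mean Berwald curvature of a spray on a vector space. -/
noncomputable def meanOf (S : E₁ → E₁) (u v z : E₁) : ℝ :=
  (1 / 2 : ℝ) * LinearMap.trace ℝ E₁ (fderiv ℝ (ddir (ddir S u) v) z : E₁ →ₗ[ℝ] E₁)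

namespace IsProdSpray

variable {S : E₁ × E₂ → E₁ × E₂} {G₁ X₁ : E₁ → E₁} {q : E₂ → ℝ} {α : E₂ →L[ℝ] ℝ}
    {G₂ X₂ : E₂ → E₂} {r : E₁ → ℝ} {β : E₁ →L[ℝ] ℝ}

/-! #### Third derivatives -/

lemma third_vvv_fst (h : IsProdSpray S G₁ X₁ q α G₂ X₂ r β) {z : E₁ × E₂} (hz : z ∈ slit E₁ E₂)
    (b b' b'' : E₂) : (ddir (ddir (ddir S (0, b)) (0, b')) (0, b'') z).1
      = ddir (ddir (ddir q b) b') b'' z.2 • X₁ z.1 := by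
  have hX := contDiffOn_vec h.smooth_G₁ h.smooth_X₁
  have hp := contDiffOn_coef (α := α) h.smooth_q
  have hp1 := fun i => (hp i).ddir isOpen_compl_singleton b
  have hp2 := fun i => (hp1 i).ddir isOpen_compl_singleton b'
  have e := ddir_bisum_right (ddir_bisum_right (ddir_bisum_right h.fst_eqOn hX hp b) hX hp1 b')
    hX hp2 b''
  refine (ddir_ddir_ddir_fst isOpen_slit h.contDiffOn _ _ _ hz).trans ((e hz).trans ?_)
  simp [bisum, Fin.sum_univ_three, vec, coef, ddir_const, ddir_clm]

lemma third_vvy_fst (h : IsProdSpray S G₁ X₁ q α G₂ X₂ r β) {z : E₁ × E₂} (hz : z ∈ slit E₁ E₂)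
    (b b' : E₂) (a : E₁) : (ddir (ddir (ddir S (0, b)) (0, b')) (a, 0) z).1
      = ddir (ddir q b) b' z.2 • ddir X₁ a z.1 := by
  have hX := contDiffOn_vec h.smooth_G₁ h.smooth_X₁
  have hp := contDiffOn_coef (α := α) h.smooth_q
  have hp1 := fun i => (hp i).ddir isOpen_compl_singleton b
  have hp2 := fun i => (hp1 i).ddir isOpen_compl_singleton b'
  have e := ddir_bisum_left (ddir_bisum_right (ddir_bisum_right h.fst_eqOn hX hp b) hX hp1 b')
    hX hp2 a
  refine (ddir_ddir_ddir_fst isOpen_slit h.contDiffOn _ _ _ hz).trans ((e hz).trans ?_)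
  simp [bisum, Fin.sum_univ_three, vec, coef, ddir_const, ddir_clm]

lemma third_yyy_fst (h : IsProdSpray S G₁ X₁ q α G₂ X₂ r β) {z : E₁ × E₂} (hz : z ∈ slit E₁ E₂)
    (a a' a'' : E₁) : (ddir (ddir (ddir S (a, 0)) (a', 0)) (a'', 0) z).1
      = ddir (ddir (ddir G₁ a) a') a'' z.1 + q z.2 • ddir (ddir (ddir X₁ a) a') a'' z.1 := by
  have hX := contDiffOn_vec h.smooth_G₁ h.smooth_X₁
  have hp := contDiffOn_coef (α := α) h.smooth_q
  have hX1 := fun i => (hX i).ddir isOpen_compl_singleton a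
  have hX2 := fun i => (hX1 i).ddir isOpen_compl_singleton a'
  have e := ddir_bisum_left (ddir_bisum_left (ddir_bisum_left h.fst_eqOn hX hp a) hX1 hp a')
    hX2 hp a''
  refine (ddir_ddir_ddir_fst isOpen_slit h.contDiffOn _ _ _ hz).trans ((e hz).trans ?_)
  simp [bisum, Fin.sum_univ_three, vec, coef, ddir_const, ddir_id]

lemma third_yyy_snd (h : IsProdSpray S G₁ X₁ q α G₂ X₂ r β) {z : E₁ × E₂} (hz : z ∈ slit E₁ E₂)
    (a a' a'' : E₁) : (ddir (ddir (ddir S (a, 0)) (a', 0)) (a'', 0) z).2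
      = ddir (ddir (ddir r a) a') a'' z.1 • X₂ z.2 := by
  have hX := contDiffOn_vec h.smooth_G₂ h.smooth_X₂
  have hp := contDiffOn_coef (α := β) h.smooth_r
  have hp1 := fun i => (hp i).ddir isOpen_compl_singleton a
  have hp2 := fun i => (hp1 i).ddir isOpen_compl_singleton a'
  have e := ddir_bisum_left (ddir_bisum_left (ddir_bisum_left h.snd_eqOn hp hX a) hp1 hX a')
    hp2 hX a''
  refine (ddir_ddir_ddir_snd isOpen_slit h.contDiffOn _ _ _ hz).trans ((e hz).trans ?_)
  simp [bisum, Fin.sum_univ_three, vec, coef, ddir_const, ddir_clm]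

/-! #### Mean curvatures -/

variable [FiniteDimensional ℝ E₁] [FiniteDimensional ℝ E₂]

lemma meanOf_eq (h : IsProdSpray S G₁ X₁ q α G₂ X₂ r β) {z : E₁ × E₂} (hz : z ∈ slit E₁ E₂)
    {u v : E₁ × E₂} {X : Fin 3 → E₁ → E₁} {p : Fin 3 → E₂ → ℝ} {Y : Fin 3 → E₂ → E₂}
    {s : Fin 3 → E₁ → ℝ}
    (hX : ∀ i, ContDiffOn ℝ ∞ (X i) {0}ᶜ) (hp : ∀ i, ContDiffOn ℝ ∞ (p i) {0}ᶜ)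
    (hY : ∀ i, ContDiffOn ℝ ∞ (Y i) {0}ᶜ) (hs : ∀ i, ContDiffOn ℝ ∞ (s i) {0}ᶜ)
    (e₁ : EqOn (ddir (ddir (fun z => (S z).1) u) v)
      (bisum (ContinuousLinearMap.lsmul ℝ ℝ).flip X p) (slit E₁ E₂))
    (e₂ : EqOn (ddir (ddir (fun z => (S z).2) u) v)
      (bisum (ContinuousLinearMap.lsmul ℝ ℝ) s Y) (slit E₁ E₂)) :
    meanOf S u v z = (1 / 2 : ℝ) * (∑ i, p i z.2 * traceL E₁ (fderiv ℝ (X i) z.1)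
      + ∑ i, s i z.1 * traceL E₂ (fderiv ℝ (Y i) z.2)) := by
  rw [meanOf, trace_prod_eq]
  have h1 : (ContinuousLinearMap.fst ℝ E₁ E₂).comp ((fderiv ℝ (ddir (ddir S u) v) z).comp
      (ContinuousLinearMap.inl ℝ E₁ E₂)) = ∑ i, p i z.2 • fderiv ℝ (X i) z.1 := by
    ext w
    refine (ddir_ddir_ddir_fst isOpen_slit h.contDiffOn u v (w, 0) hz).trans
      ((ddir_bisum_left e₁ hX hp w hz).trans ?_)
    simp [bisum, ddir]
  have h2 : (ContinuousLinearMap.snd ℝ E₁ E₂).comp ((fderiv ℝ (ddir (ddir S u) v) z).comp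
      (ContinuousLinearMap.inr ℝ E₁ E₂)) = ∑ i, s i z.1 • fderiv ℝ (Y i) z.2 := by
    ext w
    refine (ddir_ddir_ddir_snd isOpen_slit h.contDiffOn u v (0, w) hz).trans
      ((ddir_bisum_right e₂ hs hY w hz).trans ?_)
    simp [bisum, ddir]
  rw [h1, h2]
  simp only [map_sum, map_smul, smul_eq_mul]

lemma meanOf_yv (h : IsProdSpray S G₁ X₁ q α G₂ X₂ r β) {z : E₁ × E₂} (hz : z ∈ slit E₁ E₂)
    (a : E₁) (b : E₂) : meanOf S (a, 0) (0, b) z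
      = (1 / 2 : ℝ) * (ddir q b z.2 * traceL E₁ (fderiv ℝ (ddir X₁ a) z.1)
        + ddir r a z.1 * traceL E₂ (fderiv ℝ (ddir X₂ b) z.2)) := by
  have hX := contDiffOn_vec h.smooth_G₁ h.smooth_X₁
  have hp := contDiffOn_coef (α := α) h.smooth_q
  have hY := contDiffOn_vec h.smooth_G₂ h.smooth_X₂
  have hs := contDiffOn_coef (α := β) h.smooth_r
  have hX1 := fun i => (hX i).ddir isOpen_compl_singleton a
  have hp1 := fun i => (hp i).ddir isOpen_compl_singleton b
  have hY1 := fun i => (hY i).ddir isOpen_compl_singleton b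
  have hs1 := fun i => (hs i).ddir isOpen_compl_singleton a
  rw [h.meanOf_eq hz hX1 hp1 hY1 hs1
    (ddir_bisum_right (ddir_bisum_left h.fst_eqOn hX hp a) hX1 hp b)
    (ddir_bisum_right (ddir_bisum_left h.snd_eqOn hs hY a) hs1 hY b)]
  simp [Fin.sum_univ_three, vec, coef, ddir_const, ddir_clm, ddir_id]

lemma meanOf_yy (h : IsProdSpray S G₁ X₁ q α G₂ X₂ r β) {z : E₁ × E₂} (hz : z ∈ slit E₁ E₂)
    (a a' : E₁) : meanOf S (a, 0) (a', 0) z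
      = (1 / 2 : ℝ) * (traceL E₁ (fderiv ℝ (ddir (ddir G₁ a) a') z.1)
        + q z.2 * traceL E₁ (fderiv ℝ (ddir (ddir X₁ a) a') z.1)
        + ddir (ddir r a) a' z.1 * traceL E₂ (fderiv ℝ X₂ z.2)) := by
  have hX := contDiffOn_vec h.smooth_G₁ h.smooth_X₁
  have hp := contDiffOn_coef (α := α) h.smooth_q
  have hY := contDiffOn_vec h.smooth_G₂ h.smooth_X₂
  have hs := contDiffOn_coef (α := β) h.smooth_r
  have hX1 := fun i => (hX i).ddir isOpen_compl_singleton a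
  have hX2 := fun i => (hX1 i).ddir isOpen_compl_singleton a'
  have hs1 := fun i => (hs i).ddir isOpen_compl_singleton a
  have hs2 := fun i => (hs1 i).ddir isOpen_compl_singleton a'
  rw [h.meanOf_eq hz hX2 hp hY hs2
    (ddir_bisum_left (ddir_bisum_left h.fst_eqOn hX hp a) hX1 hp a')
    (ddir_bisum_left (ddir_bisum_left h.snd_eqOn hs hY a) hs1 hY a')]
  simp [Fin.sum_univ_three, vec, coef, ddir_const, ddir_clm, ddir_id]

lemma meanOf_vv (h : IsProdSpray S G₁ X₁ q α G₂ X₂ r β) {z : E₁ × E₂} (hz : z ∈ slit E₁ E₂)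
    (b b' : E₂) : meanOf S (0, b) (0, b') z
      = (1 / 2 : ℝ) * (ddir (ddir q b) b' z.2 * traceL E₁ (fderiv ℝ X₁ z.1)
        + (traceL E₂ (fderiv ℝ (ddir (ddir G₂ b) b') z.2)
        + r z.1 * traceL E₂ (fderiv ℝ (ddir (ddir X₂ b) b') z.2))) := by
  have hX := contDiffOn_vec h.smooth_G₁ h.smooth_X₁
  have hp := contDiffOn_coef (α := α) h.smooth_q
  have hY := contDiffOn_vec h.smooth_G₂ h.smooth_X₂
  have hs := contDiffOn_coef (α := β) h.smooth_r
  have hp1 := fun i => (hp i).ddir isOpen_compl_singleton b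
  have hp2 := fun i => (hp1 i).ddir isOpen_compl_singleton b'
  have hY1 := fun i => (hY i).ddir isOpen_compl_singleton b
  have hY2 := fun i => (hY1 i).ddir isOpen_compl_singleton b'
  rw [h.meanOf_eq hz hX hp2 hY2 hs
    (ddir_bisum_right (ddir_bisum_right h.fst_eqOn hX hp b) hX hp1 b')
    (ddir_bisum_right (ddir_bisum_right h.snd_eqOn hs hY b) hs hY1 b')]
  simp [Fin.sum_univ_three, vec, coef, ddir_const, ddir_clm, ddir_id]

end IsProdSpray

end Mean

section Homog

variable {E : Type*} [NormedAddCommGroup E] [NormedSpace ℝ E]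
  {F : Type*} [NormedAddCommGroup F] [NormedSpace ℝ F]

lemma fderiv_homog {f : E → F} {c a : ℝ} (hc : 0 < c)
    (h : ∀ z, z ≠ 0 → f (c • z) = a • f z) (hf : ContDiffOn ℝ ∞ f {0}ᶜ) {z : E} (hz : z ≠ 0) :
    fderiv ℝ f (c • z) = (c⁻¹ * a) • fderiv ℝ f z := by
  have h1 := fderiv_smul_of_homog h hz (differentiableAt_of_contDiffOn isOpen_compl_singleton hf hz)
  rw [← smul_smul, ← h1, smul_smul, inv_mul_cancel₀ hc.ne', one_smul]

lemma ddir_homog {f : E → F} {c a : ℝ} (hc : 0 < c)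
    (h : ∀ z, z ≠ 0 → f (c • z) = a • f z) (hf : ContDiffOn ℝ ∞ f {0}ᶜ) (u : E) {z : E}
    (hz : z ≠ 0) : ddir f u (c • z) = (c⁻¹ * a) • ddir f u z := by
  rw [ddir, fderiv_homog hc h hf hz]; rfl

lemma ddir_eq_zero {O : Set E} (hO : IsOpen O) {f : E → F} (h : ∀ z ∈ O, f z = 0) (u : E) {z : E}
    (hz : z ∈ O) : ddir f u z = 0 := by
  rw [ddir, fderiv_eq_of_eqOn hO (g := fun _ => (0 : F)) h hz]; simp

lemma ddir_const_mul {f : E → ℝ} (c : ℝ) (u : E) :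
    ddir (fun z => c * f z) u = fun z => c * ddir f u z := by
  funext z
  have := congrArg (fun A : E →L[ℝ] ℝ => A u) (congrFun (fderiv_const_smul_field (𝕜 := ℝ) (f := f) c) z)
  simpa [ddir, Pi.smul_def] using this

lemma contDiffOn_traceL [FiniteDimensional ℝ E] {f : E → E} (hf : ContDiffOn ℝ ∞ f {0}ᶜ) :
    ContDiffOn ℝ ∞ (fun y => traceL E (fderiv ℝ f y)) {0}ᶜ :=
  (traceL E).contDiff.comp_contDiffOn (contDiffOn_fderiv_of_isOpen isOpen_compl_singleton hf)

/-- The divergence of a homogeneous vector field of degree zero satisfies Euler's relation of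
degree minus one. -/
lemma fderiv_trace_self [FiniteDimensional ℝ E] {f : E → E} (hf : ContDiffOn ℝ ∞ f {0}ᶜ)
    (h : ∀ c : ℝ, 0 < c → ∀ z, z ≠ 0 → f (c • z) = f z) {z : E} (hz : z ≠ 0) :
    fderiv ℝ (fun y => traceL E (fderiv ℝ f y)) z z = -traceL E (fderiv ℝ f z) := by
  have h1 := fderiv_self_of_homog (f := fun y => traceL E (fderiv ℝ f y)) (p := fun c => c⁻¹)
    (k := -1) (z := z) (by simpa using hasDerivAt_inv (one_ne_zero (α := ℝ)))
    (fun c hc => by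
      have := fderiv_homog (a := 1) hc (fun z hz => by rw [h c hc z hz, one_smul]) hf hz
      simp only [this, mul_one, map_smul])
    (differentiableAt_of_contDiffOn isOpen_compl_singleton (contDiffOn_traceL hf) hz)
  simpa using h1

lemma fderiv_self_of_homog_zero {f : E → F} (hf : ContDiffOn ℝ ∞ f {0}ᶜ)
    (h : ∀ c : ℝ, 0 < c → ∀ z, z ≠ 0 → f (c • z) = f z) {z : E} (hz : z ≠ 0) :
    fderiv ℝ f z z = 0 := by
  have h1 := fderiv_self_of_homog (f := f) (p := fun _ => 1) (k := 0) (z := z)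
    (hasDerivAt_const _ _) (fun c hc => by rw [h c hc z hz, one_smul])
    (differentiableAt_of_contDiffOn isOpen_compl_singleton hf hz)
  simpa using h1

/-- For a field `f` of degree zero, the divergence of `∂f/∂y^l y^l` vanishes. -/
lemma trace_fderiv_ddir_self [FiniteDimensional ℝ E] {f : E → E} (hf : ContDiffOn ℝ ∞ f {0}ᶜ)
    (h : ∀ c : ℝ, 0 < c → ∀ z, z ≠ 0 → f (c • z) = f z) {z : E} (hz : z ≠ 0) :
    traceL E (fderiv ℝ (ddir f z) z) = -traceL E (fderiv ℝ f z) := by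
  have h1 : HasFDerivAt (fderiv ℝ f) (fderiv ℝ (fderiv ℝ f) z) z :=
    (differentiableAt_of_contDiffOn isOpen_compl_singleton
      (contDiffOn_fderiv_of_isOpen isOpen_compl_singleton hf) hz).hasFDerivAt
  have h2 := (h1.clm_apply (hasFDerivAt_id z)).fderiv
  have h3 := (h1.clm_apply (hasFDerivAt_const z z)).fderiv
  have h4 : fderiv ℝ (fun y => fderiv ℝ f y (id y)) z = 0 := by
    have h6 : EqOn (fun y => fderiv ℝ f y (id y)) (fun _ => (0 : E)) {0}ᶜ := fun y hy =>
      fderiv_self_of_homog_zero hf h hy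
    rw [fderiv_eq_of_eqOn isOpen_compl_singleton h6 hz]
    simp
  have h5 : fderiv ℝ (ddir f z) z = -fderiv ℝ f z := by
    have h6 : fderiv ℝ (ddir f z) z = (fderiv ℝ (fderiv ℝ f) z).flip z := by
      rw [ContinuousLinearMap.comp_zero, zero_add] at h3
      exact h3
    rw [h4, ContinuousLinearMap.comp_id, id, ← h6] at h2
    rw [eq_neg_iff_add_eq_zero, add_comm, ← h2]
  rw [h5, map_neg]

end Homog

namespace IsProdSpray

variable {E₁ : Type*} [NormedAddCommGroup E₁] [NormedSpace ℝ E₁]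
  {E₂ : Type*} [NormedAddCommGroup E₂] [NormedSpace ℝ E₂]
  {S : E₁ × E₂ → E₁ × E₂} {G₁ X₁ : E₁ → E₁} {q : E₂ → ℝ} {α : E₂ →L[ℝ] ℝ}
    {G₂ X₂ : E₂ → E₂} {r : E₁ → ℝ} {β : E₁ →L[ℝ] ℝ}

/-- The consequences of the vanishing of the Berwald curvature. -/
lemma of_third_eq_zero (h : IsProdSpray S G₁ X₁ q α G₂ X₂ r β) {b₀ b₁ v₀ : E₂} (hv₀ : v₀ ≠ 0)
    (hq : ddir (ddir q b₀) b₁ v₀ ≠ 0)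
    (hB : ∀ z ∈ slit E₁ E₂, ∀ u v w, ddir (ddir (ddir S u) v) w z = 0) :
    (∀ y, y ≠ 0 → fderiv ℝ X₁ y = 0) ∧
    (∀ y, y ≠ 0 → ∀ a a' a'', ddir (ddir (ddir G₁ a) a') a'' y = 0) ∧
    ∀ y v, y ≠ 0 → v ≠ 0 → ∀ b b' b'', ddir (ddir (ddir q b) b') b'' v • X₁ y = 0 := by
  have h1 : ∀ y, y ≠ 0 → fderiv ℝ X₁ y = 0 := by
    intro y hy
    ext a
    have := h.third_vvy_fst (z := (y, v₀)) ⟨hy, hv₀⟩ b₀ b₁ a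
    rw [hB (y, v₀) ⟨hy, hv₀⟩] at this
    exact (smul_eq_zero.1 this.symm).resolve_left hq
  refine ⟨h1, fun y hy a a' a'' => ?_, fun y v hy hv b b' b'' => ?_⟩
  · have h2 := h.third_yyy_fst (z := (y, v₀)) ⟨hy, hv₀⟩ a a' a''
    rw [hB (y, v₀) ⟨hy, hv₀⟩] at h2
    have h3 : ddir (ddir (ddir X₁ a) a') a'' y = 0 :=
      ddir_eq_zero isOpen_compl_singleton (fun y hy =>
        ddir_eq_zero isOpen_compl_singleton (fun y hy => by
          rw [ddir, h1 y hy]; rfl) a' hy) a'' hy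
    simp only [h3, smul_zero, add_zero] at h2
    exact h2.symm
  · have h2 := h.third_vvv_fst (z := (y, v)) ⟨hy, hv⟩ b b' b''
    rw [hB (y, v) ⟨hy, hv⟩] at h2
    exact h2.symm

variable [FiniteDimensional ℝ E₁] [FiniteDimensional ℝ E₂]

/-- The consequences of the vanishing of the mean Berwald curvature. -/
lemma of_meanOf_eq_zero (h : IsProdSpray S G₁ X₁ q α G₂ X₂ r β)
    (hX₁ : ∀ c : ℝ, 0 < c → ∀ y, y ≠ 0 → X₁ (c • y) = X₁ y)
    (hX₂ : ∀ c : ℝ, 0 < c → ∀ y, y ≠ 0 → X₂ (c • y) = X₂ y)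
    (hq : ∀ c : ℝ, 0 < c → ∀ y, q (c • y) = c ^ 2 * q y)
    (hr : ∀ c : ℝ, 0 < c → ∀ y, r (c • y) = c ^ 2 * r y)
    (hq0 : ∀ v, v ≠ 0 → q v ≠ 0) (hr0 : ∀ y, y ≠ 0 → r y ≠ 0)
    (hM : ∀ z ∈ slit E₁ E₂, ∀ u v, meanOf S u v z = 0) {y : E₁} {v : E₂} (hy : y ≠ 0)
    (hv : v ≠ 0) : traceL E₁ (fderiv ℝ X₁ y) = 0 ∧ traceL E₂ (fderiv ℝ X₂ v) = 0 := by
  have hqE : ∀ v, v ≠ 0 → ddir q v v = 2 * q v := fun v hv => by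
    have := fderiv_self_of_homog (f := q) (p := fun c => c ^ 2) (k := 2) (z := v)
      (by simpa using hasDerivAt_pow 2 (1 : ℝ)) (fun c hc => hq c hc v)
      (differentiableAt_of_contDiffOn isOpen_compl_singleton h.smooth_q hv)
    simpa [ddir] using this
  have hrE : ddir r y y = 2 * r y := by
    have := fderiv_self_of_homog (f := r) (p := fun c => c ^ 2) (k := 2) (z := y)
      (by simpa using hasDerivAt_pow 2 (1 : ℝ)) (fun c hc => hr c hc y)
      (differentiableAt_of_contDiffOn isOpen_compl_singleton h.smooth_r hy)
    simpa [ddir] using this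
  have key : ∀ v, v ≠ 0 → q v * traceL E₁ (fderiv ℝ X₁ y) + r y * traceL E₂ (fderiv ℝ X₂ v) = 0 := by
    intro v hv
    have h1 := h.meanOf_yv (z := (y, v)) ⟨hy, hv⟩ y v
    rw [hM (y, v) ⟨hy, hv⟩] at h1
    simp only [hqE v hv, hrE, trace_fderiv_ddir_self h.smooth_X₁ hX₁ hy,
      trace_fderiv_ddir_self h.smooth_X₂ hX₂ hv] at h1
    linarith
  have h1 := key v hv
  have h2v : (2 : ℝ) • v ≠ 0 := smul_ne_zero two_ne_zero hv
  have h2 := key _ h2v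
  rw [hq 2 two_pos v, fderiv_homog (a := 1) two_pos
    (fun z hz => by rw [hX₂ 2 two_pos z hz, one_smul]) h.smooth_X₂ hv, map_smul, smul_eq_mul] at h2
  have h3 : q v * traceL E₁ (fderiv ℝ X₁ y) = 0 := by linarith
  have h4 : r y * traceL E₂ (fderiv ℝ X₂ v) = 0 := by linarith
  exact ⟨(mul_eq_zero.1 h3).resolve_left (hq0 v hv), (mul_eq_zero.1 h4).resolve_left (hr0 y hy)⟩

omit [FiniteDimensional ℝ E₁] [FiniteDimensional ℝ E₂] in
lemma fderiv_mul_add_left {c d : E₂ → ℝ} {f : E₁ → ℝ} {m : E₁ × E₂ → ℝ}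
    (hm : EqOn m (fun z => c z.2 * f z.1 + d z.2) (slit E₁ E₂)) {z : E₁ × E₂}
    (hz : z ∈ slit E₁ E₂) (hc : ContDiffOn ℝ ∞ c {0}ᶜ) (hd : ContDiffOn ℝ ∞ d {0}ᶜ)
    (hf : ContDiffOn ℝ ∞ f {0}ᶜ) (a : E₁) :
    fderiv ℝ m z (a, 0) = c z.2 * fderiv ℝ f z.1 a := by
  have h1 := (((differentiableAt_of_contDiffOn isOpen_compl_singleton hc hz.2).hasFDerivAt.comp z
    hasFDerivAt_snd).mul ((differentiableAt_of_contDiffOn isOpen_compl_singleton hf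
      hz.1).hasFDerivAt.comp z hasFDerivAt_fst)).add
    ((differentiableAt_of_contDiffOn isOpen_compl_singleton hd hz.2).hasFDerivAt.comp z
      hasFDerivAt_snd)
  rw [fderiv_eq_of_eqOn isOpen_slit hm hz]
  exact (congrArg (fun A : E₁ × E₂ →L[ℝ] ℝ => A (a, 0)) h1.fderiv).trans (by simp)

/-- The consequences of the vanishing of the Douglas curvature. -/
lemma of_douglas_eq_zero (h : IsProdSpray S G₁ X₁ q α G₂ (fun _ => 0) r β)
    (hE : Module.finrank ℝ E₁ = 2)
    (hX₁ : ∀ c : ℝ, 0 < c → ∀ y, y ≠ 0 → X₁ (c • y) = X₁ y)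
    (hG₁ : ∀ c : ℝ, 0 < c → ∀ y, y ≠ 0 → G₁ (c • y) = c ^ 2 • G₁ y)
    {b₀ b₁ v₀ : E₂} (hv₀ : v₀ ≠ 0) (hq : ddir (ddir q b₀) b₁ v₀ ≠ 0)
    {κ : ℝ} (hκ : κ ≠ 0) (hκ2 : κ ≠ 2)
    (hD : ∀ z ∈ slit E₁ E₂, ∀ u v w, ddir (ddir (ddir S u) v) w z
      = κ • (meanOf S u v z • w + meanOf S u w z • v + meanOf S v w z • u
        + fderiv ℝ (meanOf S u v) z w • z)) :
    (∀ y, y ≠ 0 → fderiv ℝ X₁ y = 0) ∧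
    (∀ y, y ≠ 0 → ∀ a a' a'', ddir (ddir (ddir G₁ a) a') a'' y = 0) ∧
    ∀ y v, y ≠ 0 → v ≠ 0 → ∀ b b' b'', ddir (ddir (ddir q b) b') b'' v • X₁ y = 0 := by
  obtain ⟨y₀, hy₀⟩ : ∃ y : E₁, y ≠ 0 := by
    have : Nontrivial E₁ := Module.nontrivial_of_finrank_pos (R := ℝ) (by omega)
    exact exists_ne 0
  set τ : E₁ → ℝ := fun y => traceL E₁ (fderiv ℝ X₁ y) with hτ
  set e₂ : E₂ → E₂ → E₂ → ℝ := fun b b' v => traceL E₂ (fderiv ℝ (ddir (ddir G₂ b) b') v) with he₂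
  have hvv : ∀ b b', EqOn (meanOf S (0, b) (0, b')) (fun z =>
      (1 / 2 : ℝ) * ddir (ddir q b) b' z.2 * τ z.1 + (1 / 2 : ℝ) * e₂ b b' z.2) (slit E₁ E₂) := by
    intro b b' z hz
    simp only [h.meanOf_vv hz, ddir_const, hτ, he₂]
    simp
    ring
  have hq2 : ∀ b b', ContDiffOn ℝ ∞ (fun v => (1 / 2 : ℝ) * ddir (ddir q b) b' v) {0}ᶜ :=
    fun b b' => contDiffOn_const.mul
      ((h.smooth_q.ddir isOpen_compl_singleton b).ddir isOpen_compl_singleton b')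
  have he2s : ∀ b b', ContDiffOn ℝ ∞ (fun v => (1 / 2 : ℝ) * e₂ b b' v) {0}ᶜ :=
    fun b b' => contDiffOn_const.mul (contDiffOn_traceL
      ((h.smooth_G₂.ddir isOpen_compl_singleton b).ddir isOpen_compl_singleton b'))
  have hτs : ContDiffOn ℝ ∞ τ {0}ᶜ := contDiffOn_traceL h.smooth_X₁
  have hA : ∀ y v, y ≠ 0 → v ≠ 0 → ∀ b b' a, ddir (ddir q b) b' v • fderiv ℝ X₁ y a
      = κ • (((1 / 2 : ℝ) * ddir (ddir q b) b' v * τ y + (1 / 2 : ℝ) * e₂ b b' v) • a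
        + ((1 / 2 : ℝ) * ddir (ddir q b) b' v * fderiv ℝ τ y a) • y) := by
    intro y v hy hv b b' a
    have hz : ((y, v) : E₁ × E₂) ∈ slit E₁ E₂ := ⟨hy, hv⟩
    have h1 := h.third_vvy_fst hz b b' a
    rw [hD _ hz, fderiv_mul_add_left (hvv b b') hz (hq2 b b') (he2s b b') hτs a,
      hvv b b' hz] at h1
    simpa [ddir] using h1.symm
  have he₂0 : ∀ b b' v, v ≠ 0 → e₂ b b' v = 0 := by
    intro b b' v hv
    have h1 := hA y₀ v hy₀ hv b b' y₀
    rw [fderiv_self_of_homog_zero h.smooth_X₁ hX₁ hy₀, hτ,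
      fderiv_trace_self h.smooth_X₁ hX₁ hy₀, smul_zero, ← add_smul, smul_smul] at h1
    have h2 := (smul_eq_zero.1 h1.symm).resolve_right hy₀
    have h3 := (mul_eq_zero.1 h2).resolve_left hκ
    linarith
  have hDX : ∀ y, y ≠ 0 → fderiv ℝ X₁ y
      = (κ / 2) • (τ y • ContinuousLinearMap.id ℝ E₁ + (fderiv ℝ τ y).smulRight y) := by
    intro y hy
    ext a
    have h1 := hA y v₀ hy hv₀ b₀ b₁ a
    rw [he₂0 b₀ b₁ v₀ hv₀] at h1
    apply smul_right_injective E₁ hq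
    simp only [h1, add_apply, smul_apply, ContinuousLinearMap.smulRight_apply,
      ContinuousLinearMap.id_apply, smul_add, smul_smul]
    congr 2 <;> ring
  have hτ0 : ∀ y, y ≠ 0 → τ y = 0 := by
    intro y hy
    have h1 : τ y = κ / 2 * (τ y * 2 + fderiv ℝ τ y y) := by
      conv_lhs => rw [hτ]
      simp only
      rw [hDX y hy, map_smul, map_add, map_smul, smul_eq_mul, smul_eq_mul, traceL_apply,
        traceL_apply]
      congr 2
      · have := LinearMap.trace_id ℝ E₁
        rw [hE] at this
        congr 1
      · exact LinearMap.trace_smulRight (fderiv ℝ τ y : E₁ →ₗ[ℝ] ℝ) y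
    have h2 : fderiv ℝ τ y y = -τ y := fderiv_trace_self h.smooth_X₁ hX₁ hy
    rw [h2] at h1
    have h3 : (2 - κ) * τ y = 0 := by linarith
    exact (mul_eq_zero.1 h3).resolve_left (sub_ne_zero.2 hκ2.symm)
  have hDX0 : ∀ y, y ≠ 0 → fderiv ℝ X₁ y = 0 := by
    intro y hy
    have h1 : fderiv ℝ τ y = 0 := by
      rw [fderiv_eq_of_eqOn isOpen_compl_singleton (g := fun _ => (0 : ℝ)) hτ0 hy]; simp
    rw [hDX y hy, hτ0 y hy, h1]
    ext a
    simp
  have hX0 : ∀ a a' y, y ≠ 0 → ddir (ddir X₁ a) a' y = 0 := fun a a' y hy =>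
    ddir_eq_zero isOpen_compl_singleton (fun y hy => by rw [ddir, hDX0 y hy]; rfl) a' hy
  refine ⟨hDX0, fun y hy a a' a'' => ?_, fun y v hy hv b b' b'' => ?_⟩
  · set e₁ : E₁ → E₁ → E₁ → ℝ := fun a a' y => traceL E₁ (fderiv ℝ (ddir (ddir G₁ a) a') y) with he₁
    have hG2 : ∀ a a', ContDiffOn ℝ ∞ (ddir (ddir G₁ a) a') {0}ᶜ := fun a a' =>
      (h.smooth_G₁.ddir isOpen_compl_singleton a).ddir isOpen_compl_singleton a'
    have hyy : ∀ a a', EqOn (meanOf S (a, 0) (a', 0)) (fun z =>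
        (1 / 2 : ℝ) * e₁ a a' z.1 + 0) (slit E₁ E₂) := by
      intro a a' z hz
      have h1 : fderiv ℝ (ddir (ddir X₁ a) a') z.1 = 0 := by
        rw [fderiv_eq_of_eqOn isOpen_compl_singleton (g := fun _ => (0 : E₁))
          (fun y hy => hX0 a a' y hy) hz.1]
        simp
      simp only [h.meanOf_yy hz, h1, he₁]
      simp
    have he₁0 : ∀ a a' y, y ≠ 0 → e₁ a a' y = 0 := by
      intro a a' y hy
      have hz : ((y, v₀) : E₁ × E₂) ∈ slit E₁ E₂ := ⟨hy, hv₀⟩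
      have h1 := h.third_yyy_snd hz a a' y
      rw [hD _ hz, fderiv_mul_add_left (c := fun _ => (1 / 2 : ℝ)) (d := fun _ => 0) (hyy a a') hz
        contDiffOn_const contDiffOn_const (contDiffOn_traceL (hG2 a a')) y] at h1
      have hhom : ∀ c : ℝ, 0 < c → ∀ z, z ≠ 0 →
          ddir (ddir G₁ a) a' (c • z) = ddir (ddir G₁ a) a' z := by
        intro c hc z hz
        rw [ddir_homog (a := c) hc (fun z hz => ?_) (h.smooth_G₁.ddir isOpen_compl_singleton a) a' hz,
          inv_mul_cancel₀ hc.ne', one_smul]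
        rw [ddir_homog hc (hG₁ c hc) h.smooth_G₁ a hz]
        congr 1
        field_simp
      rw [fderiv_trace_self (hG2 a a') hhom hy] at h1
      simp [hκ, hv₀] at h1
      exact h1
    have hz : ((y, v₀) : E₁ × E₂) ∈ slit E₁ E₂ := ⟨hy, hv₀⟩
    have h1 := h.third_yyy_fst hz a a' a''
    have h2 : ddir (ddir (ddir X₁ a) a') a'' y = 0 :=
      ddir_eq_zero isOpen_compl_singleton (fun y hy => hX0 a a' y hy) a'' hy
    have h3 : fderiv ℝ (meanOf S (a, 0) (a', 0)) (y, v₀) (a'', 0) = 0 :=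
      ddir_eq_zero isOpen_slit (fun z hz => by rw [hyy a a' hz]; simp [he₁0 a a' z.1 hz.1]) _ hz
    rw [hD _ hz, hyy a a' hz, hyy a a'' hz, hyy a' a'' hz, h3] at h1
    simpa [he₁0 _ _ y hy, h2] using h1.symm
  · have hz : ((y, v) : E₁ × E₂) ∈ slit E₁ E₂ := ⟨hy, hv⟩
    have h1 := h.third_vvv_fst hz b b' b''
    have h3 : fderiv ℝ (meanOf S (0, b) (0, b')) (y, v) (0, b'') = 0 :=
      ddir_eq_zero isOpen_slit (fun z hz => by
        rw [hvv b b' hz]; simp [he₂0 b b' z.2 hz.2, hτ0 z.1 hz.1]) _ hz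
    rw [hD _ hz, h3] at h1
    simpa using h1.symm

end IsProdSpray

/-! ### Curvature conditions on doubly warped products in coordinates -/

section LocalConclusions

variable {E : Type*} [NormedAddCommGroup E] [NormedSpace ℝ E]

open Classical in
lemma sprayCoeff_congr {U : Set E} (hU : IsOpen U) {L L' : E → E → ℝ}
    (h : ∀ ξ ∈ U, L ξ = L' ξ) {ξ : E} (hξ : ξ ∈ U) : sprayCoeff L ξ = sprayCoeff L' ξ := by
  have h1 : ∀ η w, sprayCovector L ξ η w = sprayCovector L' ξ η w := by
    intro η w
    rw [sprayCovector, sprayCovector]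
    congr 2
    · refine Filter.EventuallyEq.lineDeriv_eq ?_
      filter_upwards [hU.mem_nhds hξ] with x hx
      rw [show (fun y => L x y) = L x from rfl, h x hx]
    · refine Filter.EventuallyEq.lineDeriv_eq ?_
      filter_upwards [hU.mem_nhds hξ] with x hx
      rw [h x hx]
  have h2 : ∀ p p' : E → Prop, p = p' →
      (if h : ∃ G, p G then h.choose else 0) = (if h : ∃ G, p' G then h.choose else 0) := by
    rintro p _ rfl; rfl
  funext η
  exact h2 _ _ (funext fun G => by simp only [h1, h ξ hξ])

lemma berwaldCurv_congr {L L' : E → E → ℝ} {ξ : E} (h : sprayCoeff L ξ = sprayCoeff L' ξ) :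
    berwaldCurv L ξ = berwaldCurv L' ξ := by
  funext η u v
  simp only [berwaldCurv, h]

lemma meanBerwaldCurv_congr {L L' : E → E → ℝ} {ξ : E} (h : sprayCoeff L ξ = sprayCoeff L' ξ) :
    meanBerwaldCurv L ξ = meanBerwaldCurv L' ξ := by
  funext η u v
  simp only [meanBerwaldCurv, berwaldCurv_congr h]

lemma douglasCurv_congr {L L' : E → E → ℝ} {ξ : E} (h : sprayCoeff L ξ = sprayCoeff L' ξ) :
    douglasCurv L ξ = douglasCurv L' ξ := by
  funext η u v w
  simp only [douglasCurv, berwaldCurv_congr h, meanBerwaldCurv_congr h]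

lemma meanBerwaldCurv_eq_zero {L : E → E → ℝ} {ξ η u v : E} (h : berwaldCurv L ξ η u v = 0) :
    meanBerwaldCurv L ξ η u v = 0 := by
  simp [meanBerwaldCurv, h]

lemma douglasCurv_eq_zero {O : Set E} (hO : IsOpen O) {L : E → E → ℝ} {ξ : E}
    (h : ∀ η ∈ O, ∀ u v, berwaldCurv L ξ η u v = 0) {η : E} (hη : η ∈ O) (u v w : E) :
    douglasCurv L ξ η u v w = 0 := by
  have h1 : fderiv ℝ (fun y => meanBerwaldCurv L ξ y u v) η w = 0 :=
    ddir_eq_zero hO (fun y hy => meanBerwaldCurv_eq_zero (h y hy u v)) w hη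
  simp [douglasCurv, h η hη, meanBerwaldCurv_eq_zero (h η hη _ _), h1]

variable {E₁ : Type*} [NormedAddCommGroup E₁] [NormedSpace ℝ E₁] [FiniteDimensional ℝ E₁]
  {E₂ : Type*} [NormedAddCommGroup E₂] [NormedSpace ℝ E₂] [FiniteDimensional ℝ E₂]
  {U₁ : Set E₁} {U₂ : Set E₂} {L₁ : E₁ → E₁ → ℝ} {L₂ : E₂ → E₂ → ℝ} {a : E₁ → ℝ}
  {b : E₂ → ℝ}

lemma isProdSpray_prodSq (h₁ : LocalFinsler U₁ L₁) (h₂ : LocalFinsler U₂ L₂)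
    (ha : ContDiffOn ℝ ∞ a U₁) (hb : ContDiffOn ℝ ∞ b U₂) {ξ : E₁ × E₂}
    (hξ : ξ ∈ U₁ ×ˢ U₂) (ha0 : 0 < a ξ.1) (hb0 : 0 < b ξ.2) :
    IsProdSpray (sprayCoeff (prodSq L₁ L₂ a b) ξ) (sprayCoeff L₁ ξ.1)
      (fun y => (fundOp L₁ (ξ.1, y)).inverse (fderiv ℝ a ξ.1))
      (fun v => -(a ξ.1 / (2 * b ξ.2 ^ 2)) * L₂ ξ.2 v) ((b ξ.2)⁻¹ • fderiv ℝ b ξ.2)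
      (sprayCoeff L₂ ξ.2) (fun v => (fundOp L₂ (ξ.2, v)).inverse (fderiv ℝ b ξ.2))
      (fun y => -(b ξ.2 / (2 * a ξ.1 ^ 2)) * L₁ ξ.1 y) ((a ξ.1)⁻¹ • fderiv ℝ a ξ.1) where
  smooth_G₁ := h₁.contDiffOn_sprayCoeff_fibre hξ.1
  smooth_X₁ := h₁.contDiffOn_grad hξ.1 _
  smooth_q := contDiffOn_const.mul (h₂.contDiffOn_fibre hξ.2)
  smooth_G₂ := h₂.contDiffOn_sprayCoeff_fibre hξ.2
  smooth_X₂ := h₂.contDiffOn_grad hξ.2 _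
  smooth_r := contDiffOn_const.mul (h₁.contDiffOn_fibre hξ.1)
  eq := fun _ hz => sprayCoeff_prodSq h₁ h₂ ha hb hξ ha0 hb0 hz

/-- What the vanishing of the Berwald or of the Douglas curvature of a warped product says about
the factors, at one point. -/
structure WarpedRigidity (L₁ : E₁ → E₁ → ℝ) (L₂ : E₂ → E₂ → ℝ) (a : E₁ → ℝ) (ξ : E₁ × E₂) :
    Prop where
  quad : fderiv ℝ a ξ.1 ≠ 0 → IsQuad (L₁ ξ.1)
  berwald : ∀ y, y ≠ 0 → ∀ u v, berwaldCurv L₁ ξ.1 y u v = 0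
  third : fderiv ℝ a ξ.1 ≠ 0 → ∀ v, v ≠ 0 → ∀ u u' u'',
    fderiv ℝ (fun y => fderiv ℝ (fun z => fderiv ℝ (L₂ ξ.2) z u) y u') v u'' = 0

omit [FiniteDimensional ℝ E₂] in
lemma LocalFinsler.ddir_ddir_ne_zero (h₂ : LocalFinsler U₂ L₂) {ξ v : E₂} (hξ : ξ ∈ U₂)
    (hv : v ≠ 0) {c : ℝ} (hc : c ≠ 0) : ddir (ddir (fun v => c * L₂ ξ v) v) v v ≠ 0 := by
  have h1 := h₂.fderiv_fderiv_fibre hξ hv v v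
  rw [h₂.fundOp_self_self hξ hv] at h1
  simp only [ddir_const_mul]
  rw [show ddir (ddir (L₂ ξ) v) v v = 2 * L₂ ξ v from h1]
  exact mul_ne_zero hc (mul_pos two_pos (h₂.pos hξ hv)).ne'

omit [FiniteDimensional ℝ E₂] in
lemma WarpedRigidity.mk_of_isProdSpray (h₁ : LocalFinsler U₁ L₁) (hE : Module.finrank ℝ E₁ = 2)
    {ξ : E₁ × E₂} (hξ : ξ ∈ U₁ ×ˢ U₂) {c : ℝ} (hc : c ≠ 0)
    (h : (∀ y, y ≠ 0 → fderiv ℝ (fun y => (fundOp L₁ (ξ.1, y)).inverse (fderiv ℝ a ξ.1)) y = 0) ∧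
      (∀ y, y ≠ 0 → ∀ u u' u'', ddir (ddir (ddir (sprayCoeff L₁ ξ.1) u) u') u'' y = 0) ∧
      ∀ y v, y ≠ 0 → v ≠ 0 → ∀ u u' u'', ddir (ddir (ddir (fun v => c * L₂ ξ.2 v) u) u') u'' v •
        (fundOp L₁ (ξ.1, y)).inverse (fderiv ℝ a ξ.1) = 0) :
    WarpedRigidity L₁ L₂ a ξ where
  quad h0 := h₁.isQuad_of_fderiv_grad_eq_zero hE hξ.1 h0 h.1
  berwald y hy u v := by
    ext w
    exact h.2.1 y hy u v w
  third h0 v hv u u' u'' := by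
    have : Nontrivial E₁ := Module.nontrivial_of_finrank_pos (R := ℝ) (by omega)
    obtain ⟨y, hy⟩ := exists_ne (0 : E₁)
    have h3 := h.2.2 y v hy hv u u' u''
    have h4 : (fundOp L₁ (ξ.1, y)).inverse (fderiv ℝ a ξ.1) ≠ 0 := by
      intro h5
      have := h₁.fundOp_inverse hξ.1 hy (fderiv ℝ a ξ.1)
      rw [h5, map_zero] at this
      exact h0 this.symm
    have h5 := (smul_eq_zero.1 h3).resolve_right h4
    simp only [ddir_const_mul] at h5
    exact (mul_eq_zero.1 h5).resolve_left hc

lemma warpedRigidity_of_berwald (h₁ : LocalFinsler U₁ L₁) (h₂ : LocalFinsler U₂ L₂)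
    (hE : Module.finrank ℝ E₁ = 2) [Nontrivial E₂]
    (ha : ContDiffOn ℝ ∞ a U₁) (hb : ContDiffOn ℝ ∞ b U₂) {ξ : E₁ × E₂}
    (hξ : ξ ∈ U₁ ×ˢ U₂) (ha0 : 0 < a ξ.1) (hb0 : 0 < b ξ.2)
    (hB : ∀ z ∈ slit E₁ E₂, ∀ u v w, berwaldCurv (prodSq L₁ L₂ a b) ξ z u v w = 0) :
    WarpedRigidity L₁ L₂ a ξ := by
  obtain ⟨v, hv⟩ := exists_ne (0 : E₂)
  have hc : -(a ξ.1 / (2 * b ξ.2 ^ 2)) ≠ 0 := neg_ne_zero.2 (by positivity)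
  exact WarpedRigidity.mk_of_isProdSpray h₁ hE hξ hc
    ((isProdSpray_prodSq h₁ h₂ ha hb hξ ha0 hb0).of_third_eq_zero hv
      (h₂.ddir_ddir_ne_zero hξ.2 hv hc) hB)

lemma warpedRigidity_of_douglas (h₁ : LocalFinsler U₁ L₁) (h₂ : LocalFinsler U₂ L₂)
    (hE : Module.finrank ℝ E₁ = 2) [Nontrivial E₂]
    (ha : ContDiffOn ℝ ∞ a U₁) (hb : ContDiffOn ℝ ∞ b U₂) {ξ : E₁ × E₂}
    (hξ : ξ ∈ U₁ ×ˢ U₂) (ha0 : 0 < a ξ.1) (hb0 : 0 < b ξ.2) (hdb : fderiv ℝ b ξ.2 = 0)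
    (hD : ∀ z ∈ slit E₁ E₂, ∀ u v w, douglasCurv (prodSq L₁ L₂ a b) ξ z u v w = 0) :
    WarpedRigidity L₁ L₂ a ξ := by
  obtain ⟨v, hv⟩ := exists_ne (0 : E₂)
  have hc : -(a ξ.1 / (2 * b ξ.2 ^ 2)) ≠ 0 := neg_ne_zero.2 (by positivity)
  have hS := isProdSpray_prodSq h₁ h₂ ha hb hξ ha0 hb0
  simp only [hdb, map_zero] at hS
  have hn : (0 : ℝ) < (Module.finrank ℝ (E₁ × E₂) : ℝ) := by
    rw [Module.finrank_prod, hE]; push_cast; positivity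
  have hκ : 2 / ((Module.finrank ℝ (E₁ × E₂) : ℝ) + 1) ≠ 0 := by positivity
  have hκ2 : 2 / ((Module.finrank ℝ (E₁ × E₂) : ℝ) + 1) ≠ 2 := by
    rw [Ne, div_eq_iff (by positivity)]
    intro h
    linarith
  exact WarpedRigidity.mk_of_isProdSpray h₁ hE hξ hc
    (hS.of_douglas_eq_zero hE (fun c hc y hy => h₁.grad_smul hξ.1 hy _ hc)
      (fun c hc y hy => h₁.sprayCoeff_smul hξ.1 hy hc) hv
      (h₂.ddir_ddir_ne_zero hξ.2 hv hc) hκ hκ2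
      (fun z hz u v w => sub_eq_zero.1 (hD z hz u v w)))

lemma isQuad_of_meanBerwald (h₁ : LocalFinsler U₁ L₁) (h₂ : LocalFinsler U₂ L₂)
    (hE₁ : Module.finrank ℝ E₁ = 2) (hE₂ : Module.finrank ℝ E₂ = 2)
    (ha : ContDiffOn ℝ ∞ a U₁) (hb : ContDiffOn ℝ ∞ b U₂) {ξ : E₁ × E₂}
    (hξ : ξ ∈ U₁ ×ˢ U₂) (ha0 : 0 < a ξ.1) (hb0 : 0 < b ξ.2)
    (hM : ∀ z ∈ slit E₁ E₂, ∀ u v, meanBerwaldCurv (prodSq L₁ L₂ a b) ξ z u v = 0) :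
    (fderiv ℝ a ξ.1 ≠ 0 → IsQuad (L₁ ξ.1)) ∧ (fderiv ℝ b ξ.2 ≠ 0 → IsQuad (L₂ ξ.2)) := by
  have : Nontrivial E₁ := Module.nontrivial_of_finrank_pos (R := ℝ) (by omega)
  have : Nontrivial E₂ := Module.nontrivial_of_finrank_pos (R := ℝ) (by omega)
  obtain ⟨y₀, hy₀⟩ := exists_ne (0 : E₁)
  obtain ⟨v₀, hv₀⟩ := exists_ne (0 : E₂)
  have key : ∀ (y : E₁) (v : E₂), y ≠ 0 → v ≠ 0 →
      traceL E₁ (fderiv ℝ (fun y => (fundOp L₁ (ξ.1, y)).inverse (fderiv ℝ a ξ.1)) y) = 0 ∧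
      traceL E₂ (fderiv ℝ (fun v => (fundOp L₂ (ξ.2, v)).inverse (fderiv ℝ b ξ.2)) v) = 0 := fun y v hy hv =>
    (isProdSpray_prodSq h₁ h₂ ha hb hξ ha0 hb0).of_meanOf_eq_zero
      (fun c hc y hy => h₁.grad_smul hξ.1 hy _ hc) (fun c hc y hy => h₂.grad_smul hξ.2 hy _ hc)
      (fun c hc v => by rw [h₂.homog _ _ c hc]; ring)
      (fun c hc v => by rw [h₁.homog _ _ c hc]; ring)
      (fun v hv => mul_ne_zero (neg_ne_zero.2 (by positivity)) (h₂.pos hξ.2 hv).ne')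
      (fun v hv => mul_ne_zero (neg_ne_zero.2 (by positivity)) (h₁.pos hξ.1 hv).ne')
      (fun z hz u v => hM z hz u v) hy hv
  exact ⟨fun h0 => h₁.isQuad_of_fderiv_grad_eq_zero hE₁ hξ.1 h0 fun y hy =>
      h₁.fderiv_grad_eq_zero hE₁ hξ.1 hy _ (key y v₀ hy hv₀).1,
    fun h0 => h₂.isQuad_of_fderiv_grad_eq_zero hE₂ hξ.2 h0 fun v hv =>
      h₂.fderiv_grad_eq_zero hE₂ hξ.2 hv _ (key y₀ v hy₀ hv).2⟩

/-- The Berwald curvature of a doubly warped product of quadratic metrics vanishes. -/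
lemma berwaldCurv_prodSq_of_isQuad (h₁ : LocalFinsler U₁ L₁) (h₂ : LocalFinsler U₂ L₂)
    (hq₁ : ∀ x ∈ U₁, IsQuad (L₁ x)) (hq₂ : ∀ x ∈ U₂, IsQuad (L₂ x))
    (ha : ContDiffOn ℝ ∞ a U₁) (hb : ContDiffOn ℝ ∞ b U₂) {ξ : E₁ × E₂}
    (hξ : ξ ∈ U₁ ×ˢ U₂) (ha0 : 0 < a ξ.1) (hb0 : 0 < b ξ.2) {z : E₁ × E₂}
    (hz : z ∈ slit E₁ E₂) (u v : E₁ × E₂) :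
    berwaldCurv (prodSq L₁ L₂ a b) ξ z u v = 0 := by
  obtain ⟨f₁, hf₁, hf₁'⟩ := h₁.homQuad_sprayCoeff hq₁ hξ.1
  obtain ⟨f₂, hf₂, hf₂'⟩ := h₂.homQuad_sprayCoeff hq₂ hξ.2
  have hL₁ : HomQuad (L₁ ξ.1) := ⟨_, (h₁.isQuad_iff hξ.1 hz.1).1 (hq₁ _ hξ.1)⟩
  have hL₂ : HomQuad (L₂ ξ.2) := ⟨_, (h₂.isQuad_iff hξ.2 hz.2).1 (hq₂ _ hξ.2)⟩
  set X₁ := (fundOp L₁ (ξ.1, z.1)).inverse (fderiv ℝ a ξ.1) with hX₁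
  set X₂ := (fundOp L₂ (ξ.2, z.2)).inverse (fderiv ℝ b ξ.2) with hX₂
  set fstL := ContinuousLinearMap.fst ℝ E₁ E₂
  set sndL := ContinuousLinearMap.snd ℝ E₁ E₂
  set α := (b ξ.2)⁻¹ • fderiv ℝ b ξ.2
  set β := (a ξ.1)⁻¹ • fderiv ℝ a ξ.1
  set c₁ := -(a ξ.1 / (2 * b ξ.2 ^ 2))
  set c₂ := -(b ξ.2 / (2 * a ξ.1 ^ 2))
  have hP : HomQuad fun y : E₁ × E₂ => f₁ y.1 + α y.2 • y.1 + L₂ ξ.2 y.2 • (c₁ • X₁) :=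
    ((hf₁.comp fstL).add (homQuad_smul (α.comp sndL) fstL)).add
      ((hL₂.comp sndL).map ((ContinuousLinearMap.id ℝ ℝ).smulRight (c₁ • X₁)))
  have hR : HomQuad fun y : E₁ × E₂ => f₂ y.2 + β y.1 • y.2 + L₁ ξ.1 y.1 • (c₂ • X₂) :=
    ((hf₂.comp sndL).add (homQuad_smul (β.comp fstL) sndL)).add
      ((hL₁.comp fstL).map ((ContinuousLinearMap.id ℝ ℝ).smulRight (c₂ • X₂)))
  refine ((hP.map (ContinuousLinearMap.inl ℝ E₁ E₂)).add
    (hR.map (ContinuousLinearMap.inr ℝ E₁ E₂))).third_fderiv isOpen_slit (fun y hy => ?_) hz u v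
  rw [sprayCoeff_prodSq h₁ h₂ ha hb hξ ha0 hb0 hy, hf₁' _ hy.1, hf₂' _ hy.2,
    h₁.grad_eq_of_isQuad hξ.1 (hq₁ _ hξ.1) _ hy.1 hz.1,
    h₂.grad_eq_of_isQuad hξ.2 (hq₂ _ hξ.2) _ hy.2 hz.2]
  simp [smul_smul, mul_comm, α, β, c₁, c₂, X₁, X₂]

end LocalConclusions

/-! ### Finsler metrics in the coordinates of a chart -/

lemma LocalFinsler.mono {E : Type*} [NormedAddCommGroup E] [NormedSpace ℝ E] {U V : Set E}
    {L : E → E → ℝ} (h : LocalFinsler U L) (hV : IsOpen V) (hVU : V ⊆ U) : LocalFinsler V L where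
  isOpen := hV
  smooth := h.smooth.mono (prod_mono hVU Subset.rfl)
  homog := h.homog
  posDef ξ hξ := h.posDef ξ (hVU hξ)

section Chart

variable {E : Type*} [NormedAddCommGroup E] [NormedSpace ℝ E]
  {H : Type*} [TopologicalSpace H] {I : ModelWithCorners ℝ E H} [I.Boundaryless]
  {M : Type*} [TopologicalSpace M] [ChartedSpace H M] [IsManifold I ∞ M]
  {e : OpenPartialHomeomorph M H}

omit [I.Boundaryless] in
lemma contMDiffOn_extend_symm_target (he : e ∈ atlas H M) :
    ContMDiffOn 𝓘(ℝ, E) I ∞ (e.extend I).symm (e.extend I).target := by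
  rw [e.extend_target']
  exact contMDiffOn_extend_symm (IsManifold.subset_maximalAtlas he)

lemma mdifferentiableAt_extend_symm (he : e ∈ atlas H M) {ξ : E} (hξ : ξ ∈ (e.extend I).target) :
    MDifferentiableAt 𝓘(ℝ, E) I (e.extend I).symm ξ :=
  ((contMDiffOn_extend_symm_target he).contMDiffAt
    (e.isOpen_extend_target.mem_nhds hξ)).mdifferentiableAt (by simp)

variable (I) in
omit [I.Boundaryless] [IsManifold I ∞ M] in
lemma localSq_eq (F : TangentBundle I M → ℝ) (e : OpenPartialHomeomorph M H) (ξ η : E) :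
    localSq I F e ξ η
      = F ⟨(e.extend I).symm ξ, mfderiv 𝓘(ℝ, E) I (e.extend I).symm ξ η⟩ ^ 2 := rfl

/-- The derivative of an inverse chart as a linear equivalence. -/
lemma exists_linearEquiv_mfderiv [FiniteDimensional ℝ E] (he : e ∈ atlas H M) {ξ : E}
    (hξ : ξ ∈ (e.extend I).target) :
    ∃ A : E ≃ₗ[ℝ] TangentSpace I ((e.extend I).symm ξ),
      ∀ η, A η = mfderiv 𝓘(ℝ, E) I (e.extend I).symm ξ η := by
  have h1 := mdifferentiableAt_extend_symm he hξ
  have hs : (e.extend I).symm ξ ∈ e.source := by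
    rw [← e.extend_source (I := I)]; exact (e.extend I).map_target hξ
  have h2 : MDifferentiableAt I 𝓘(ℝ, E) (e.extend I) ((e.extend I).symm ξ) :=
    (e.contMDiffAt_extend (n := ∞) (IsManifold.subset_maximalAtlas he) hs).mdifferentiableAt
      (by simp)
  have h3 := h2.hasMFDerivAt.comp ξ h1.hasMFDerivAt
  have h4 : HasMFDerivAt 𝓘(ℝ, E) 𝓘(ℝ, E) (e.extend I ∘ (e.extend I).symm) ξ
      (ContinuousLinearMap.id ℝ (TangentSpace 𝓘(ℝ, E) ξ)) := by
    refine (hasMFDerivAt_id ξ).congr_of_eventuallyEq ?_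
    filter_upwards [e.isOpen_extend_target.mem_nhds hξ] with x hx
    exact (e.extend I).right_inv hx
  have h5 := hasMFDerivAt_unique h3 h4
  have hinj : Function.Injective (mfderiv 𝓘(ℝ, E) I (e.extend I).symm ξ) := by
    intro x y hxy
    have hx := congrArg (fun f => f x) h5
    have hy := congrArg (fun f => f y) h5
    have : mfderiv I 𝓘(ℝ, E) (e.extend I) ((e.extend I).symm ξ)
        (mfderiv 𝓘(ℝ, E) I (e.extend I).symm ξ x) = x := hx
    rw [← this, hxy]
    exact hy
  have : FiniteDimensional ℝ (TangentSpace I ((e.extend I).symm ξ)) :=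
    inferInstanceAs (FiniteDimensional ℝ E)
  let B : E →ₗ[ℝ] TangentSpace I ((e.extend I).symm ξ) :=
    (mfderiv 𝓘(ℝ, E) I (e.extend I).symm ξ).toLinearMap
  exact ⟨LinearEquiv.ofInjectiveOfFinrankEq B hinj rfl, fun η => rfl⟩

omit [I.Boundaryless] in
lemma contDiffOn_comp_extend_symm {f : M → ℝ} (hf : ContMDiff I 𝓘(ℝ, ℝ) ∞ f)
    (he : e ∈ atlas H M) : ContDiffOn ℝ ∞ (f ∘ (e.extend I).symm) (e.extend I).target :=
  contMDiffOn_iff_contDiffOn.1 (hf.comp_contMDiffOn (contMDiffOn_extend_symm_target he))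

lemma contMDiff_tangentBundle_mk : ContMDiff 𝓘(ℝ, E × E) 𝓘(ℝ, E).tangent ∞
    (fun p : E × E => (⟨p.1, p.2⟩ : TangentBundle 𝓘(ℝ, E) E)) := by
  have h := contMDiff_tangentBundleModelSpaceHomeomorph_symm (I := 𝓘(ℝ, E)) (n := ∞)
  rw [modelWithCornersSelf_prod]
  exact h

lemma contMDiffOn_tangentMap_extend_symm (he : e ∈ atlas H M) :
    ContMDiffOn 𝓘(ℝ, E × E) I.tangent ∞
      (fun p : E × E => tangentMap 𝓘(ℝ, E) I (e.extend I).symm ⟨p.1, p.2⟩)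
      ((e.extend I).target ×ˢ univ) := by
  have : IsManifold I 1 M := .of_le (n := ∞) (by simp)
  have h1 := (contMDiffOn_extend_symm_target (I := I) he).contMDiffOn_tangentMapWithin (m := ∞)
    (by simp) e.isOpen_extend_target.uniqueMDiffOn
  refine (h1.comp contMDiff_tangentBundle_mk.contMDiffOn fun p hp => hp.1).congr fun p hp => ?_
  exact (tangentMapWithin_eq_tangentMap (e.isOpen_extend_target.uniqueMDiffWithinAt hp.1)
    (mdifferentiableAt_extend_symm he hp.1)).symm

lemma localFinsler_localSq [FiniteDimensional ℝ E] (F : FinslerMetric I M) (he : e ∈ atlas H M) :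
    LocalFinsler (e.extend I).target (localSq I F.toFun e) where
  isOpen := e.isOpen_extend_target
  smooth := by
    refine ContDiffOn.pow (f := fun p : E × E =>
      F.toFun (tangentMap 𝓘(ℝ, E) I (e.extend I).symm ⟨p.1, p.2⟩)) ?_ 2
    refine contMDiffOn_iff_contDiffOn.1 (F.smooth.comp
      ((contMDiffOn_tangentMap_extend_symm he).mono (prod_mono Subset.rfl (subset_univ _)))
      fun p hp => ?_)
    obtain ⟨A, hA⟩ := exists_linearEquiv_mfderiv (I := I) he hp.1
    change mfderiv 𝓘(ℝ, E) I (e.extend I).symm p.1 p.2 ≠ 0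
    rw [← hA]
    exact A.map_ne_zero_iff.2 hp.2
  homog ξ η c hc := by
    rw [localSq_eq, localSq_eq, ← mul_pow, ← F.homog _ _ c hc]
    congr 3
    exact map_smul (mfderiv 𝓘(ℝ, E) I (e.extend I).symm ξ) c η
  posDef ξ hξ η u hη hu := by
    obtain ⟨A, hA⟩ := exists_linearEquiv_mfderiv (I := I) he hξ
    have h1 := fundTensor_comp_linear
      (fun z : TangentSpace I ((e.extend I).symm ξ) => F.toFun ⟨(e.extend I).symm ξ, z⟩ ^ 2)
      (A : E →ₗ[ℝ] TangentSpace I ((e.extend I).symm ξ)) η u u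
    have h2 : localSq I F.toFun e ξ = fun η => F.toFun ⟨(e.extend I).symm ξ, A η⟩ ^ 2 := by
      funext η
      rw [hA]; rfl
    rw [h2]
    refine lt_of_lt_of_eq (F.posDef _ (A η) (A u) (A.map_ne_zero_iff.2 hη)
      (A.map_ne_zero_iff.2 hu)) h1.symm

lemma isQuad_localSq_iff [FiniteDimensional ℝ E] (F : TangentBundle I M → ℝ)
    (he : e ∈ atlas H M) {ξ : E} (hξ : ξ ∈ (e.extend I).target) :
    IsQuad (localSq I F e ξ) ↔
      IsQuad fun y : TangentSpace I ((e.extend I).symm ξ) => F ⟨(e.extend I).symm ξ, y⟩ ^ 2 := by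
  obtain ⟨A, hA⟩ := exists_linearEquiv_mfderiv (I := I) he hξ
  have h2 : localSq I F e ξ = fun η => F ⟨(e.extend I).symm ξ, A η⟩ ^ 2 := by
    funext η
    rw [hA]; rfl
  rw [h2]
  exact isQuad_comp_linear_iff
    (ℓ := fun y : TangentSpace I ((e.extend I).symm ξ) => F ⟨(e.extend I).symm ξ, y⟩ ^ 2) A

end Chart

/-! ### Locally constant properties on manifolds -/

section LocallyConstant

variable {E : Type*} [NormedAddCommGroup E] [NormedSpace ℝ E]
  {H : Type*} [TopologicalSpace H] {I : ModelWithCorners ℝ E H}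
  {M : Type*} [TopologicalSpace M] [ChartedSpace H M] {e : OpenPartialHomeomorph M H}

omit [ChartedSpace H M] in
lemma eventually_nhds_of_extend {ξ : E} (hξ : ξ ∈ (e.extend I).target) {p : M → Prop}
    (hp : ∀ᶠ x in 𝓝 ξ, p ((e.extend I).symm x)) : ∀ᶠ y in 𝓝 ((e.extend I).symm ξ), p y := by
  have hs : (e.extend I).symm ξ ∈ e.source := by
    rw [← e.extend_source (I := I)]; exact (e.extend I).map_target hξ
  have h1 := e.continuousAt_extend (I := I) hs
  rw [ContinuousAt, (e.extend I).right_inv hξ] at h1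
  filter_upwards [h1.eventually hp, e.open_source.mem_nhds hs] with y hy hys
  rwa [e.extend_left_inv hys] at hy

lemma eventually_nhds_of_forall_chart [I.Boundaryless] {p : M → M → Prop}
    (h : ∀ e ∈ atlas H M, ∀ ξ ∈ (e.extend I).target,
      ∀ᶠ x in 𝓝 ξ, p ((e.extend I).symm x) ((e.extend I).symm ξ)) (x : M) :
    ∀ᶠ y in 𝓝 x, p y x := by
  have hx : x ∈ (chartAt H x).source := mem_chart_source H x
  have h1 : (chartAt H x).extend I x ∈ ((chartAt H x).extend I).target :=
    ((chartAt H x).extend I).map_source (by rwa [OpenPartialHomeomorph.extend_source])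
  have h2 := eventually_nhds_of_extend (p := fun y => p y _) h1
    (h _ (chart_mem_atlas H x) _ h1)
  rwa [(chartAt H x).extend_left_inv hx] at h2

lemma eventually_eq_of_fderiv_eq_zero [I.Boundaryless] [IsManifold I ∞ M] {f : M → ℝ}
    (hf : ContMDiff I 𝓘(ℝ, ℝ) ∞ f) (he : e ∈ atlas H M) {ξ : E} (hξ : ξ ∈ (e.extend I).target)
    (h : ∀ᶠ x in 𝓝 ξ, fderiv ℝ (f ∘ (e.extend I).symm) x = 0) :
    ∀ᶠ x in 𝓝 ξ, f ((e.extend I).symm x) = f ((e.extend I).symm ξ) := by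
  have ho := e.isOpen_extend_target (I := I)
  obtain ⟨r, hr, hball⟩ := Metric.eventually_nhds_iff_ball.1 (h.and (ho.mem_nhds hξ))
  filter_upwards [Metric.ball_mem_nhds ξ hr] with x hx
  exact (convex_ball ξ r).is_const_of_fderivWithin_eq_zero (𝕜 := ℝ) (f := f ∘ (e.extend I).symm)
    (fun y hy => (differentiableAt_of_contDiffOn ho (contDiffOn_comp_extend_symm hf he)
      (hball y hy).2).differentiableWithinAt)
    (fun y hy => by rw [fderivWithin_of_isOpen Metric.isOpen_ball hy, (hball y hy).1])
    hx (Metric.mem_ball_self hr)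

lemma exists_fderiv_ne_zero [I.Boundaryless] [IsManifold I ∞ M] [PreconnectedSpace M] {f : M → ℝ}
    (hf : ContMDiff I 𝓘(ℝ, ℝ) ∞ f) (hc : ¬ ∃ c, ∀ x, f x = c) :
    ∃ e ∈ atlas H M, ∃ ξ ∈ (e.extend I).target, fderiv ℝ (f ∘ (e.extend I).symm) ξ ≠ 0 := by
  by_contra! h
  have h1 : IsLocallyConstant f := (IsLocallyConstant.iff_eventually_eq f).2
    (eventually_nhds_of_forall_chart (I := I) (p := fun y x => f y = f x) fun e he ξ hξ =>
      eventually_eq_of_fderiv_eq_zero hf he hξ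
        (by filter_upwards [e.isOpen_extend_target.mem_nhds hξ] with x hx using h e he x hx))
  rcases isEmpty_or_nonempty M with hM | ⟨⟨x₀⟩⟩
  · exact hc ⟨0, fun x => (hM.false x).elim⟩
  · exact hc ⟨f x₀, fun x => h1.apply_eq_of_preconnectedSpace x x₀⟩

lemma mem_closure_fderiv_ne_zero [I.Boundaryless] [IsManifold I ∞ M] {f : M → ℝ}
    (hf : ContMDiff I 𝓘(ℝ, ℝ) ∞ f)
    (hc : ∀ U : Set M, IsOpen U → U.Nonempty → ¬ ∃ c, ∀ x ∈ U, f x = c)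
    (he : e ∈ atlas H M) {ξ : E} (hξ : ξ ∈ (e.extend I).target) :
    ξ ∈ closure {x ∈ (e.extend I).target | fderiv ℝ (f ∘ (e.extend I).symm) x ≠ 0} := by
  by_contra h
  have h1 : ∀ᶠ x in 𝓝 ξ, fderiv ℝ (f ∘ (e.extend I).symm) x = 0 := by
    filter_upwards [isClosed_closure.isOpen_compl.mem_nhds h,
      e.isOpen_extend_target.mem_nhds hξ] with x hx hx'
    by_contra h2
    exact hx (subset_closure ⟨hx', h2⟩)
  obtain ⟨V, hV, hVo, hmem⟩ := eventually_nhds_iff.1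
    (eventually_nhds_of_extend (p := fun y => f y = f ((e.extend I).symm ξ)) hξ
      (eventually_eq_of_fderiv_eq_zero hf he hξ h1))
  exact hc V hVo ⟨_, hmem⟩ ⟨_, hV⟩

/-- The square of `F` is a quadratic form on the tangent space at `x`. -/
def IsQuadAt (F : TangentBundle I M → ℝ) (x : M) : Prop :=
  IsQuad fun y : TangentSpace I x => F ⟨x, y⟩ ^ 2

lemma IsQuadAt.of_berwaldCurv_eq_zero [FiniteDimensional ℝ E] [I.Boundaryless] [IsManifold I ∞ M]
    [PreconnectedSpace M] (F : FinslerMetric I M) (hE : 1 < Module.rank ℝ E)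
    (hB : ∀ e ∈ atlas H M, ∀ ξ ∈ (e.extend I).target, ∀ η, η ≠ 0 → ∀ u v,
      berwaldCurv (localSq I F.toFun e) ξ η u v = 0) {x : M} (hx : IsQuadAt F.toFun x) (y : M) :
    IsQuadAt F.toFun y := by
  have h1 : IsLocallyConstant (IsQuadAt F.toFun) := (IsLocallyConstant.iff_eventually_eq _).2
    (eventually_nhds_of_forall_chart (I := I)
      (p := fun y x => IsQuadAt F.toFun y = IsQuadAt F.toFun x) fun e he ξ hξ => by
        have ho := e.isOpen_extend_target (I := I)
        obtain ⟨r, hr, hball⟩ := Metric.isOpen_iff.1 ho ξ hξ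
        filter_upwards [Metric.ball_mem_nhds ξ hr] with x hx
        have h2 := ((localFinsler_localSq F he).mono Metric.isOpen_ball hball).isQuad_iff_of_convex
          hE (fun ζ hζ => hB e he ζ (hball hζ)) (convex_ball ξ r) hx (Metric.mem_ball_self hr)
        rw [isQuad_localSq_iff _ he (hball hx), isQuad_localSq_iff _ he hξ] at h2
        exact propext h2)
  rw [h1.apply_eq_of_preconnectedSpace y x]
  exact hx

lemma FinslerMetric.sq_pos [FiniteDimensional ℝ E] [I.Boundaryless] [IsManifold I ∞ M]
    (F : FinslerMetric I M) {x : M} {y : TangentSpace I x} (hy : y ≠ 0) :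
    0 < F.toFun ⟨x, y⟩ ^ 2 := by
  have hx : x ∈ (chartAt H x).source := mem_chart_source H x
  have h1 : (chartAt H x).extend I x ∈ ((chartAt H x).extend I).target :=
    ((chartAt H x).extend I).map_source (by rwa [OpenPartialHomeomorph.extend_source])
  have key : ∀ z : M, z = x → ∀ y : TangentSpace I x, y ≠ 0 →
      (∀ y : TangentSpace I z, y ≠ 0 → 0 < F.toFun ⟨z, y⟩ ^ 2) → 0 < F.toFun ⟨x, y⟩ ^ 2 := by
    rintro z rfl y hy h
    exact h y hy
  refine key _ ((chartAt H x).extend_left_inv (I := I) hx) y hy fun y hy => ?_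
  obtain ⟨A, hA⟩ := exists_linearEquiv_mfderiv (I := I) (chart_mem_atlas H x) h1
  have h2 := (localFinsler_localSq F (chart_mem_atlas H x)).pos h1
    (A.symm.map_ne_zero_iff.2 hy)
  rw [localSq_eq, ← hA, A.apply_symm_apply] at h2
  exact h2

lemma FinslerMetric.map_zero [IsManifold I ∞ M] (F : FinslerMetric I M) (x : M) :
    F.toFun ⟨x, (0 : TangentSpace I x)⟩ = 0 := by
  have h := F.homog x 0 2 two_pos
  rw [smul_zero] at h
  linarith

end LocallyConstant

/-! ### Doubly warped products in product charts -/

section ProductChart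

lemma IsQuad.const_mul {V : Type*} [AddCommGroup V] [Module ℝ V] {ℓ : V → ℝ} (h : IsQuad ℓ)
    (c : ℝ) : IsQuad fun y => c * ℓ y := by
  obtain ⟨Q, hs, hQ⟩ := h
  exact ⟨c • Q, fun y z => by simp [hs y z], fun y => by simp [hQ]⟩

lemma IsQuad.add {V : Type*} [AddCommGroup V] [Module ℝ V] {ℓ ℓ' : V → ℝ} (h : IsQuad ℓ)
    (h' : IsQuad ℓ') : IsQuad fun y => ℓ y + ℓ' y := by
  obtain ⟨Q, hs, hQ⟩ := h
  obtain ⟨Q', hs', hQ'⟩ := h'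
  exact ⟨Q + Q', fun y z => by simp [hs y z, hs' y z], fun y => by simp [hQ, hQ']⟩

variable {E₁ : Type*} [NormedAddCommGroup E₁] [NormedSpace ℝ E₁] [FiniteDimensional ℝ E₁]
  {H₁ : Type*} [TopologicalSpace H₁] {I₁ : ModelWithCorners ℝ E₁ H₁} [I₁.Boundaryless]
  {M₁ : Type*} [TopologicalSpace M₁] [ChartedSpace H₁ M₁] [IsManifold I₁ ∞ M₁]
  {E₂ : Type*} [NormedAddCommGroup E₂] [NormedSpace ℝ E₂] [FiniteDimensional ℝ E₂]
  {H₂ : Type*} [TopologicalSpace H₂] {I₂ : ModelWithCorners ℝ E₂ H₂} [I₂.Boundaryless]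
  {M₂ : Type*} [TopologicalSpace M₂] [ChartedSpace H₂ M₂] [IsManifold I₂ ∞ M₂]
  {e₁ : OpenPartialHomeomorph M₁ H₁} {e₂ : OpenPartialHomeomorph M₂ H₂}
  (F₁ : FinslerMetric I₁ M₁) (F₂ : FinslerMetric I₂ M₂) {f₁ : M₁ → ℝ} {f₂ : M₂ → ℝ}

omit [FiniteDimensional ℝ E₁] [I₁.Boundaryless] [FiniteDimensional ℝ E₂] [I₂.Boundaryless] in
lemma doublyWarped_sq (f₁ : M₁ → ℝ) (f₂ : M₂ → ℝ) (p : TangentBundle (I₁.prod I₂) (M₁ × M₂)) :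
    doublyWarped F₁ F₂ f₁ f₂ p ^ 2 = f₂ p.1.2 ^ 2 * F₁.toFun ⟨p.1.1, p.2.1⟩ ^ 2
      + f₁ p.1.1 ^ 2 * F₂.toFun ⟨p.1.2, p.2.2⟩ ^ 2 :=
  Real.sq_sqrt (by positivity)

omit [FiniteDimensional ℝ E₁] [I₁.Boundaryless] [ChartedSpace H₁ M₁] [IsManifold I₁ ∞ M₁]
  [FiniteDimensional ℝ E₂] [I₂.Boundaryless] [ChartedSpace H₂ M₂] [IsManifold I₂ ∞ M₂] in
lemma extend_prod_target : ((e₁.prod e₂).extend (I₁.prod I₂)).target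
    = (e₁.extend I₁).target ×ˢ (e₂.extend I₂).target := by
  rw [OpenPartialHomeomorph.extend_prod]; rfl

omit [FiniteDimensional ℝ E₁] [FiniteDimensional ℝ E₂] in
lemma tangentMap_extend_prod_symm (he₁ : e₁ ∈ atlas H₁ M₁) (he₂ : e₂ ∈ atlas H₂ M₂) {ξ : E₁ × E₂}
    (hξ : ξ ∈ (e₁.extend I₁).target ×ˢ (e₂.extend I₂).target) (η : E₁ × E₂) :
    tangentMap 𝓘(ℝ, E₁ × E₂) (I₁.prod I₂) ((e₁.prod e₂).extend (I₁.prod I₂)).symm ⟨ξ, η⟩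
      = ⟨((e₁.extend I₁).symm ξ.1, (e₂.extend I₂).symm ξ.2),
        (mfderiv 𝓘(ℝ, E₁) I₁ (e₁.extend I₁).symm ξ.1 η.1,
          mfderiv 𝓘(ℝ, E₂) I₂ (e₂.extend I₂).symm ξ.2 η.2)⟩ := by
  have h1 : HasMFDerivAt 𝓘(ℝ, E₁ × E₂) 𝓘(ℝ, E₁) Prod.fst ξ (ContinuousLinearMap.fst ℝ E₁ E₂) :=
    hasFDerivAt_fst.hasMFDerivAt
  have h2 : HasMFDerivAt 𝓘(ℝ, E₁ × E₂) 𝓘(ℝ, E₂) Prod.snd ξ (ContinuousLinearMap.snd ℝ E₁ E₂) :=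
    hasFDerivAt_snd.hasMFDerivAt
  have h3 := ((mdifferentiableAt_extend_symm he₁ hξ.1).hasMFDerivAt.comp ξ h1).prodMk
    ((mdifferentiableAt_extend_symm he₂ hξ.2).hasMFDerivAt.comp ξ h2)
  have h4 : (⇑((e₁.prod e₂).extend (I₁.prod I₂)).symm : E₁ × E₂ → M₁ × M₂)
      = fun ξ => ((e₁.extend I₁).symm ξ.1, (e₂.extend I₂).symm ξ.2) := by
    rw [OpenPartialHomeomorph.extend_prod]; rfl
  rw [h4]
  change (⟨_, mfderiv 𝓘(ℝ, E₁ × E₂) (I₁.prod I₂)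
    (fun ξ : E₁ × E₂ => ((e₁.extend I₁).symm ξ.1, (e₂.extend I₂).symm ξ.2)) ξ η⟩ :
      TangentBundle (I₁.prod I₂) (M₁ × M₂)) = _
  erw [h3.mfderiv]
  rfl

omit [FiniteDimensional ℝ E₁] [FiniteDimensional ℝ E₂] in
lemma localSq_doublyWarped (he₁ : e₁ ∈ atlas H₁ M₁) (he₂ : e₂ ∈ atlas H₂ M₂) {ξ : E₁ × E₂}
    (hξ : ξ ∈ (e₁.extend I₁).target ×ˢ (e₂.extend I₂).target) :
    localSq (I₁.prod I₂) (doublyWarped F₁ F₂ f₁ f₂) (e₁.prod e₂) ξ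
      = prodSq (localSq I₁ F₁.toFun e₁) (localSq I₂ F₂.toFun e₂) (f₁ ∘ (e₁.extend I₁).symm)
        (f₂ ∘ (e₂.extend I₂).symm) ξ := by
  funext η
  rw [localSq, tangentMap_extend_prod_symm he₁ he₂ hξ, doublyWarped_sq]
  rfl

omit [FiniteDimensional ℝ E₁] [FiniteDimensional ℝ E₂] in
lemma sprayCoeff_doublyWarped (he₁ : e₁ ∈ atlas H₁ M₁) (he₂ : e₂ ∈ atlas H₂ M₂) {ξ : E₁ × E₂}
    (hξ : ξ ∈ (e₁.extend I₁).target ×ˢ (e₂.extend I₂).target) :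
    sprayCoeff (localSq (I₁.prod I₂) (doublyWarped F₁ F₂ f₁ f₂) (e₁.prod e₂)) ξ
      = sprayCoeff (prodSq (localSq I₁ F₁.toFun e₁) (localSq I₂ F₂.toFun e₂)
        (f₁ ∘ (e₁.extend I₁).symm) (f₂ ∘ (e₂.extend I₂).symm)) ξ :=
  sprayCoeff_congr (e₁.isOpen_extend_target.prod e₂.isOpen_extend_target)
    (fun _ hξ => localSq_doublyWarped F₁ F₂ he₁ he₂ hξ) hξ

lemma inCharts_slitProd_iff {F : TangentBundle (I₁.prod I₂) (M₁ × M₂) → ℝ}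
    {P : (E₁ × E₂ → E₁ × E₂ → ℝ) → E₁ × E₂ → E₁ × E₂ → Prop} :
    InCharts (I₁.prod I₂) F (slitProd I₁ M₁ I₂ M₂) P ↔
      ∀ e₁ ∈ atlas H₁ M₁, ∀ e₂ ∈ atlas H₂ M₂,
        ∀ ξ ∈ (e₁.extend I₁).target ×ˢ (e₂.extend I₂).target, ∀ η ∈ slit E₁ E₂,
          P (localSq (I₁.prod I₂) F (e₁.prod e₂)) ξ η := by
  have key : ∀ e₁ ∈ atlas H₁ M₁, ∀ e₂ ∈ atlas H₂ M₂,
      ∀ ξ ∈ (e₁.extend I₁).target ×ˢ (e₂.extend I₂).target, ∀ η : E₁ × E₂,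
      (tangentMap 𝓘(ℝ, E₁ × E₂) (I₁.prod I₂) ((e₁.prod e₂).extend (I₁.prod I₂)).symm ⟨ξ, η⟩
        ∈ slitProd I₁ M₁ I₂ M₂ ↔ η ∈ slit E₁ E₂) := by
    intro e₁ he₁ e₂ he₂ ξ hξ η
    rw [tangentMap_extend_prod_symm he₁ he₂ hξ]
    obtain ⟨A₁, hA₁⟩ := exists_linearEquiv_mfderiv (I := I₁) he₁ hξ.1
    obtain ⟨A₂, hA₂⟩ := exists_linearEquiv_mfderiv (I := I₂) he₂ hξ.2
    rw [← hA₁, ← hA₂]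
    exact and_congr A₁.map_ne_zero_iff A₂.map_ne_zero_iff
  constructor
  · intro h e₁ he₁ e₂ he₂ ξ hξ η hη
    exact h _ ⟨e₁, he₁, e₂, he₂, rfl⟩ ξ (by rwa [extend_prod_target]) η
      ((key e₁ he₁ e₂ he₂ ξ hξ η).2 hη)
  · rintro h _ ⟨e₁, he₁, e₂, he₂, rfl⟩ ξ hξ η hη
    rw [extend_prod_target] at hξ
    exact h e₁ he₁ e₂ he₂ ξ hξ η ((key e₁ he₁ e₂ he₂ ξ hξ η).1 hη)

lemma isRiemannian_doublyWarped_iff (hf₁ : ∀ x, 0 < f₁ x) (hf₂ : ∀ x, 0 < f₂ x) :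
    IsRiemannian (I₁.prod I₂) (doublyWarped F₁ F₂ f₁ f₂) ↔
      ∀ x₁ x₂, IsQuadAt F₁.toFun x₁ ∧ IsQuadAt F₂.toFun x₂ := by
  constructor
  · intro h x₁ x₂
    obtain ⟨Q, hs, -, hQ⟩ := h (x₁, x₂)
    have hq : IsQuad fun y : TangentSpace I₁ x₁ × TangentSpace I₂ x₂ =>
        doublyWarped F₁ F₂ f₁ f₂ ⟨(x₁, x₂), y⟩ ^ 2 := ⟨Q, hs, hQ⟩
    constructor
    · have h1 := (hq.comp_linear (LinearMap.inl ℝ (TangentSpace I₁ x₁)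
        (TangentSpace I₂ x₂))).const_mul (f₂ x₂ ^ 2)⁻¹
      have h2 : ∀ y : TangentSpace I₁ x₁, doublyWarped F₁ F₂ f₁ f₂
          ⟨(x₁, x₂), (LinearMap.inl ℝ (TangentSpace I₁ x₁) (TangentSpace I₂ x₂) y)⟩ ^ 2
          = f₂ x₂ ^ 2 * F₁.toFun ⟨x₁, y⟩ ^ 2 := by
        intro y
        rw [doublyWarped_sq]
        change _ + f₁ x₁ ^ 2 * F₂.toFun ⟨x₂, 0⟩ ^ 2 = _
        rw [F₂.map_zero]
        simp
      simpa only [IsQuadAt, h2, inv_mul_cancel_left₀ (pow_ne_zero 2 (hf₂ x₂).ne')] using h1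
    · have h1 := (hq.comp_linear (LinearMap.inr ℝ (TangentSpace I₁ x₁)
        (TangentSpace I₂ x₂))).const_mul (f₁ x₁ ^ 2)⁻¹
      have h2 : ∀ y : TangentSpace I₂ x₂, doublyWarped F₁ F₂ f₁ f₂
          ⟨(x₁, x₂), (LinearMap.inr ℝ (TangentSpace I₁ x₁) (TangentSpace I₂ x₂) y)⟩ ^ 2
          = f₁ x₁ ^ 2 * F₂.toFun ⟨x₂, y⟩ ^ 2 := by
        intro y
        rw [doublyWarped_sq]
        change f₂ x₂ ^ 2 * F₁.toFun ⟨x₁, 0⟩ ^ 2 + _ = _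
        rw [F₁.map_zero]
        simp
      simpa only [IsQuadAt, h2, inv_mul_cancel_left₀ (pow_ne_zero 2 (hf₁ x₁).ne')] using h1
  · rintro h ⟨x₁, x₂⟩
    obtain ⟨h1, h2⟩ := h x₁ x₂
    obtain ⟨Q, hs, hQ⟩ := ((h1.comp_linear (LinearMap.fst ℝ (TangentSpace I₁ x₁)
      (TangentSpace I₂ x₂))).const_mul (f₂ x₂ ^ 2)).add
        ((h2.comp_linear (LinearMap.snd ℝ (TangentSpace I₁ x₁)
          (TangentSpace I₂ x₂))).const_mul (f₁ x₁ ^ 2))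
    refine ⟨Q, hs, fun y hy => ?_, fun y => ?_⟩
    · refine lt_of_lt_of_eq ?_ (hQ y)
      change 0 < f₂ x₂ ^ 2 * F₁.toFun ⟨x₁, y.1⟩ ^ 2 + f₁ x₁ ^ 2 * F₂.toFun ⟨x₂, y.2⟩ ^ 2
      by_cases hy1 : y.1 = 0
      · have hy2 : y.2 ≠ 0 := fun hy2 => hy (Prod.ext hy1 hy2)
        have := mul_pos (pow_pos (hf₁ x₁) 2) (F₂.sq_pos (x := x₂) hy2)
        positivity
      · have := mul_pos (pow_pos (hf₂ x₂) 2) (F₁.sq_pos (x := x₁) hy1)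
        positivity
    · exact (doublyWarped_sq F₁ F₂ f₁ f₂ ⟨(x₁, x₂), y⟩).trans (hQ y)

end ProductChart

/-! ### Curvature conditions on doubly warped products -/

section Main

variable {E₁ : Type*} [NormedAddCommGroup E₁] [NormedSpace ℝ E₁] [FiniteDimensional ℝ E₁]
  {H₁ : Type*} [TopologicalSpace H₁] {I₁ : ModelWithCorners ℝ E₁ H₁} [I₁.Boundaryless]
  {M₁ : Type*} [TopologicalSpace M₁] [ChartedSpace H₁ M₁] [IsManifold I₁ ∞ M₁]
  {E₂ : Type*} [NormedAddCommGroup E₂] [NormedSpace ℝ E₂] [FiniteDimensional ℝ E₂]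
  {H₂ : Type*} [TopologicalSpace H₂] {I₂ : ModelWithCorners ℝ E₂ H₂} [I₂.Boundaryless]
  {M₂ : Type*} [TopologicalSpace M₂] [ChartedSpace H₂ M₂] [IsManifold I₂ ∞ M₂]
  {F₁ : FinslerMetric I₁ M₁} {F₂ : FinslerMetric I₂ M₂} {f₁ : M₁ → ℝ} {f₂ : M₂ → ℝ}

lemma IsBerwald.isWeaklyBerwald {E : Type*} [NormedAddCommGroup E] [NormedSpace ℝ E]
    {H : Type*} [TopologicalSpace H] {I : ModelWithCorners ℝ E H} {M : Type*} [TopologicalSpace M]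
    [ChartedSpace H M] {F : TangentBundle I M → ℝ} {S : Set (TangentBundle I M)}
    (h : IsBerwald I F S) : IsWeaklyBerwald I F S := fun e he ξ hξ η hη u v =>
  meanBerwaldCurv_eq_zero (ContinuousLinearMap.ext fun w => h e he ξ hξ η hη u v w)

lemma IsBerwald.isDouglas {F : TangentBundle (I₁.prod I₂) (M₁ × M₂) → ℝ}
    (h : IsBerwald (I₁.prod I₂) F (slitProd I₁ M₁ I₂ M₂)) :
    IsDouglas (I₁.prod I₂) F (slitProd I₁ M₁ I₂ M₂) := by
  refine inCharts_slitProd_iff.2 fun e₁ he₁ e₂ he₂ ξ hξ η hη => ?_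
  exact douglasCurv_eq_zero isOpen_slit (fun η hη u v => ContinuousLinearMap.ext fun w =>
    inCharts_slitProd_iff.1 h e₁ he₁ e₂ he₂ ξ hξ η hη u v w) hη

lemma IsRiemannian.isBerwald_doublyWarped (hf₁ : ContMDiff I₁ 𝓘(ℝ, ℝ) ∞ f₁)
    (hf₂ : ContMDiff I₂ 𝓘(ℝ, ℝ) ∞ f₂) (hf₁pos : ∀ x, 0 < f₁ x) (hf₂pos : ∀ x, 0 < f₂ x)
    (h : IsRiemannian (I₁.prod I₂) (doublyWarped F₁ F₂ f₁ f₂)) :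
    IsBerwald (I₁.prod I₂) (doublyWarped F₁ F₂ f₁ f₂) (slitProd I₁ M₁ I₂ M₂) := by
  rw [isRiemannian_doublyWarped_iff F₁ F₂ hf₁pos hf₂pos] at h
  refine inCharts_slitProd_iff.2 fun e₁ he₁ e₂ he₂ ξ hξ η hη u v w => ?_
  rw [berwaldCurv_congr (sprayCoeff_doublyWarped F₁ F₂ he₁ he₂ hξ),
    berwaldCurv_prodSq_of_isQuad (localFinsler_localSq F₁ he₁) (localFinsler_localSq F₂ he₂)
      (fun x hx => (isQuad_localSq_iff _ he₁ hx).2 (h _ ((e₂.extend I₂).symm ξ.2)).1)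
      (fun x hx => (isQuad_localSq_iff _ he₂ hx).2 (h ((e₁.extend I₁).symm ξ.1) _).2)
      (contDiffOn_comp_extend_symm hf₁ he₁) (contDiffOn_comp_extend_symm hf₂ he₂) hξ
      (hf₁pos _) (hf₂pos _) hη]
  rfl

lemma isRiemannian_of_warpedRigidity [PreconnectedSpace M₁] (hE₁ : Module.finrank ℝ E₁ = 2)
    (hE₂ : 1 ≤ Module.finrank ℝ E₂)
    (hF₂ : Module.finrank ℝ E₂ = 1 → ∀ (x : M₂) (v : TangentSpace I₂ x),
      F₂.toFun ⟨x, -v⟩ = F₂.toFun ⟨x, v⟩)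
    (hf₁ : ContMDiff I₁ 𝓘(ℝ, ℝ) ∞ f₁) (hf₁pos : ∀ x, 0 < f₁ x) (hf₂pos : ∀ x, 0 < f₂ x)
    (hc : ¬ ∃ c, ∀ x, f₁ x = c)
    (h : ∀ e₁ ∈ atlas H₁ M₁, ∀ e₂ ∈ atlas H₂ M₂,
      ∀ ξ ∈ (e₁.extend I₁).target ×ˢ (e₂.extend I₂).target,
        WarpedRigidity (localSq I₁ F₁.toFun e₁) (localSq I₂ F₂.toFun e₂)
          (f₁ ∘ (e₁.extend I₁).symm) ξ) :
    IsRiemannian (I₁.prod I₂) (doublyWarped F₁ F₂ f₁ f₂) := by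
  rw [isRiemannian_doublyWarped_iff F₁ F₂ hf₁pos hf₂pos]
  intro x₁ x₂
  obtain ⟨e₁, he₁, ξ₁, hξ₁, hd⟩ := exists_fderiv_ne_zero hf₁ hc
  have he₂ := chart_mem_atlas H₂ x₂
  have hx₂ : x₂ ∈ (chartAt H₂ x₂).source := mem_chart_source H₂ x₂
  have hξ₂ : (chartAt H₂ x₂).extend I₂ x₂ ∈ ((chartAt H₂ x₂).extend I₂).target :=
    ((chartAt H₂ x₂).extend I₂).map_source (by rwa [OpenPartialHomeomorph.extend_source])
  have hloc := localFinsler_localSq F₂ he₂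
  have hW := h e₁ he₁ _ he₂ (ξ₁, (chartAt H₂ x₂).extend I₂ x₂) ⟨hξ₁, hξ₂⟩
  constructor
  · refine IsQuadAt.of_berwaldCurv_eq_zero F₁ ?_ (fun e he ξ hξ =>
      (h e he _ he₂ (ξ, (chartAt H₂ x₂).extend I₂ x₂) ⟨hξ, hξ₂⟩).berwald)
      ((isQuad_localSq_iff _ he₁ hξ₁).1 (hW.quad hd)) x₁
    rw [← Module.finrank_eq_rank, hE₁]
    norm_num
  · have h1 : IsQuad (localSq I₂ F₂.toFun (chartAt H₂ x₂) ((chartAt H₂ x₂).extend I₂ x₂)) := by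
      rcases hE₂.eq_or_lt with h1 | h1
      · refine hloc.isQuad_of_reversible h1.symm hξ₂ fun η => ?_
        rw [localSq_eq, localSq_eq, ← hF₂ h1.symm]
        congr 3
        exact (congrArg Neg.neg (map_neg (mfderiv 𝓘(ℝ, E₂) I₂
          ((chartAt H₂ x₂).extend I₂).symm _) η)).trans (neg_neg _)
      · refine hloc.isQuad_of_fderiv_eq_zero ?_ hξ₂ (hW.third hd)
        rw [← Module.finrank_eq_rank]
        exact_mod_cast h1
    have h2 := (isQuad_localSq_iff F₂.toFun he₂ hξ₂).1 h1
    rwa [(chartAt H₂ x₂).extend_left_inv hx₂] at h2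

lemma isRiemannian_of_isBerwald_doublyWarped [PreconnectedSpace M₁]
    (hE₁ : Module.finrank ℝ E₁ = 2) (hE₂ : 1 ≤ Module.finrank ℝ E₂)
    (hF₂ : Module.finrank ℝ E₂ = 1 → ∀ (x : M₂) (v : TangentSpace I₂ x),
      F₂.toFun ⟨x, -v⟩ = F₂.toFun ⟨x, v⟩)
    (hf₁ : ContMDiff I₁ 𝓘(ℝ, ℝ) ∞ f₁) (hf₂ : ContMDiff I₂ 𝓘(ℝ, ℝ) ∞ f₂)
    (hf₁pos : ∀ x, 0 < f₁ x) (hf₂pos : ∀ x, 0 < f₂ x) (hc : ¬ ∃ c, ∀ x, f₁ x = c)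
    (h : IsBerwald (I₁.prod I₂) (doublyWarped F₁ F₂ f₁ f₂) (slitProd I₁ M₁ I₂ M₂)) :
    IsRiemannian (I₁.prod I₂) (doublyWarped F₁ F₂ f₁ f₂) := by
  refine isRiemannian_of_warpedRigidity hE₁ hE₂ hF₂ hf₁ hf₁pos hf₂pos hc
    fun e₁ he₁ e₂ he₂ ξ hξ => ?_
  have : Nontrivial E₂ := Module.nontrivial_of_finrank_pos (R := ℝ) (by omega)
  refine warpedRigidity_of_berwald (localFinsler_localSq F₁ he₁) (localFinsler_localSq F₂ he₂) hE₁
    (contDiffOn_comp_extend_symm hf₁ he₁) (contDiffOn_comp_extend_symm hf₂ he₂) hξ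
    (hf₁pos _) (hf₂pos _) fun η hη u v w => ?_
  rw [← berwaldCurv_congr (sprayCoeff_doublyWarped F₁ F₂ he₁ he₂ hξ)]
  exact inCharts_slitProd_iff.1 h e₁ he₁ e₂ he₂ ξ hξ η hη u v w

lemma isRiemannian_of_isDouglas_warped [PreconnectedSpace M₁]
    (hE₁ : Module.finrank ℝ E₁ = 2) (hE₂ : 1 ≤ Module.finrank ℝ E₂)
    (hF₂ : Module.finrank ℝ E₂ = 1 → ∀ (x : M₂) (v : TangentSpace I₂ x),
      F₂.toFun ⟨x, -v⟩ = F₂.toFun ⟨x, v⟩)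
    (hf₁ : ContMDiff I₁ 𝓘(ℝ, ℝ) ∞ f₁) (hf₁pos : ∀ x, 0 < f₁ x) (hc : ¬ ∃ c, ∀ x, f₁ x = c)
    (h : IsDouglas (I₁.prod I₂) (warped F₁ F₂ f₁) (slitProd I₁ M₁ I₂ M₂)) :
    IsRiemannian (I₁.prod I₂) (warped F₁ F₂ f₁) := by
  refine isRiemannian_of_warpedRigidity hE₁ hE₂ hF₂ hf₁ hf₁pos (fun _ => one_pos) hc
    fun e₁ he₁ e₂ he₂ ξ hξ => ?_
  have : Nontrivial E₂ := Module.nontrivial_of_finrank_pos (R := ℝ) (by omega)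
  refine warpedRigidity_of_douglas (b := (fun _ : M₂ => (1 : ℝ)) ∘ (e₂.extend I₂).symm)
    (localFinsler_localSq F₁ he₁) (localFinsler_localSq F₂ he₂) hE₁
    (contDiffOn_comp_extend_symm hf₁ he₁) contDiffOn_const hξ
    (hf₁pos _) one_pos ?_ fun η hη u v w => ?_
  · exact congrFun (fderiv_const (1 : ℝ)) ξ.2
  rw [← douglasCurv_congr (sprayCoeff_doublyWarped F₁ F₂ he₁ he₂ hξ)]
  exact inCharts_slitProd_iff.1 h e₁ he₁ e₂ he₂ ξ hξ η hη u v w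

lemma isRiemannian_of_isWeaklyBerwald_doublyWarped
    (hE₁ : Module.finrank ℝ E₁ = 2) (hE₂ : Module.finrank ℝ E₂ = 2)
    (hf₁ : ContMDiff I₁ 𝓘(ℝ, ℝ) ∞ f₁) (hf₂ : ContMDiff I₂ 𝓘(ℝ, ℝ) ∞ f₂)
    (hf₁pos : ∀ x, 0 < f₁ x) (hf₂pos : ∀ x, 0 < f₂ x)
    (hc₁ : ∀ U : Set M₁, IsOpen U → U.Nonempty → ¬ ∃ c, ∀ x ∈ U, f₁ x = c)
    (hc₂ : ∀ U : Set M₂, IsOpen U → U.Nonempty → ¬ ∃ c, ∀ x ∈ U, f₂ x = c)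
    (h : IsWeaklyBerwald (I₁.prod I₂) (doublyWarped F₁ F₂ f₁ f₂) (slitProd I₁ M₁ I₂ M₂)) :
    IsRiemannian (I₁.prod I₂) (doublyWarped F₁ F₂ f₁ f₂) := by
  rw [isRiemannian_doublyWarped_iff F₁ F₂ hf₁pos hf₂pos]
  intro x₁ x₂
  have he₁ := chart_mem_atlas H₁ x₁
  have he₂ := chart_mem_atlas H₂ x₂
  have hx₁ : x₁ ∈ (chartAt H₁ x₁).source := mem_chart_source H₁ x₁
  have hx₂ : x₂ ∈ (chartAt H₂ x₂).source := mem_chart_source H₂ x₂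
  have hξ₁ : (chartAt H₁ x₁).extend I₁ x₁ ∈ ((chartAt H₁ x₁).extend I₁).target :=
    ((chartAt H₁ x₁).extend I₁).map_source (by rwa [OpenPartialHomeomorph.extend_source])
  have hξ₂ : (chartAt H₂ x₂).extend I₂ x₂ ∈ ((chartAt H₂ x₂).extend I₂).target :=
    ((chartAt H₂ x₂).extend I₂).map_source (by rwa [OpenPartialHomeomorph.extend_source])
  have hloc₁ := localFinsler_localSq F₁ he₁
  have hloc₂ := localFinsler_localSq F₂ he₂
  have key : ∀ ξ ∈ ((chartAt H₁ x₁).extend I₁).target ×ˢ ((chartAt H₂ x₂).extend I₂).target,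
      (fderiv ℝ (f₁ ∘ ((chartAt H₁ x₁).extend I₁).symm) ξ.1 ≠ 0 →
        IsQuad (localSq I₁ F₁.toFun (chartAt H₁ x₁) ξ.1)) ∧
      (fderiv ℝ (f₂ ∘ ((chartAt H₂ x₂).extend I₂).symm) ξ.2 ≠ 0 →
        IsQuad (localSq I₂ F₂.toFun (chartAt H₂ x₂) ξ.2)) :=
    fun ξ hξ => isQuad_of_meanBerwald hloc₁ hloc₂ hE₁ hE₂
      (contDiffOn_comp_extend_symm hf₁ he₁) (contDiffOn_comp_extend_symm hf₂ he₂) hξ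
      (hf₁pos _) (hf₂pos _) fun η hη u v => by
        rw [← meanBerwaldCurv_congr (sprayCoeff_doublyWarped F₁ F₂ he₁ he₂ hξ)]
        exact inCharts_slitProd_iff.1 h _ he₁ _ he₂ ξ hξ η hη u v
  constructor
  · have h1 := hloc₁.isQuad_of_mem_closure hξ₁ (mem_of_subset_of_mem (closure_mono fun ζ hζ =>
      And.intro hζ.1 ((key (ζ, (chartAt H₂ x₂).extend I₂ x₂) ⟨hζ.1, hξ₂⟩).1 hζ.2))
      (mem_closure_fderiv_ne_zero hf₁ hc₁ he₁ hξ₁))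
    have h2 := (isQuad_localSq_iff F₁.toFun he₁ hξ₁).1 h1
    rwa [(chartAt H₁ x₁).extend_left_inv hx₁] at h2
  · have h1 := hloc₂.isQuad_of_mem_closure hξ₂ (mem_of_subset_of_mem (closure_mono fun ζ hζ =>
      And.intro hζ.1 ((key ((chartAt H₁ x₁).extend I₁ x₁, ζ) ⟨hξ₁, hζ.1⟩).2 hζ.2))
      (mem_closure_fderiv_ne_zero hf₂ hc₂ he₂ hξ₂))
    have h2 := (isQuad_localSq_iff F₂.toFun he₂ hξ₂).1 h1
    rwa [(chartAt H₂ x₂).extend_left_inv hx₂] at h2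

end Main

end FinslerGeom

theorem mainTheorem2 (n₂ : ℕ) (hn₂ : 1 ≤ n₂)
    {M₁ : Type*} [TopologicalSpace M₁] [ChartedSpace (EuclideanSpace ℝ (Fin 2)) M₁]
    [IsManifold (𝓡 2) ∞ M₁] [ConnectedSpace M₁]
    {M₂ : Type*} [TopologicalSpace M₂] [ChartedSpace (EuclideanSpace ℝ (Fin n₂)) M₂]
    [IsManifold (𝓡 n₂) ∞ M₂]
    (F₁ : FinslerGeom.FinslerMetric (𝓡 2) M₁) (F₂ : FinslerGeom.FinslerMetric (𝓡 n₂) M₂)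
    (hF₂ : n₂ = 1 → ∀ (x : M₂) (v : TangentSpace (𝓡 n₂) x),
      F₂.toFun ⟨x, -v⟩ = F₂.toFun ⟨x, v⟩)
    (f₁ : M₁ → ℝ) (hf₁ : ContMDiff (𝓡 2) 𝓘(ℝ, ℝ) ∞ f₁) (hf₁pos : ∀ x, 0 < f₁ x)
    (f₂ : M₂ → ℝ) (hf₂ : ContMDiff (𝓡 n₂) 𝓘(ℝ, ℝ) ∞ f₂) (hf₂pos : ∀ x, 0 < f₂ x) :
    ((¬ ∃ c, ∀ x, f₁ x = c) →
      (FinslerGeom.IsBerwald ((𝓡 2).prod (𝓡 n₂)) (FinslerGeom.warped F₁ F₂ f₁)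
          (FinslerGeom.slitProd (𝓡 2) M₁ (𝓡 n₂) M₂) ↔
        FinslerGeom.IsRiemannian ((𝓡 2).prod (𝓡 n₂)) (FinslerGeom.warped F₁ F₂ f₁))) ∧
    (n₂ = 2 →
      (∀ U : Set M₁, IsOpen U → U.Nonempty → ¬ ∃ c, ∀ x ∈ U, f₁ x = c) →
      (∀ U : Set M₂, IsOpen U → U.Nonempty → ¬ ∃ c, ∀ x ∈ U, f₂ x = c) →
      (FinslerGeom.IsWeaklyBerwald ((𝓡 2).prod (𝓡 n₂)) (FinslerGeom.doublyWarped F₁ F₂ f₁ f₂)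
          (FinslerGeom.slitProd (𝓡 2) M₁ (𝓡 n₂) M₂) ↔
        FinslerGeom.IsRiemannian ((𝓡 2).prod (𝓡 n₂)) (FinslerGeom.doublyWarped F₁ F₂ f₁ f₂))) ∧
    ((¬ ∃ c, ∀ x, f₁ x = c) →
      (FinslerGeom.IsDouglas ((𝓡 2).prod (𝓡 n₂)) (FinslerGeom.warped F₁ F₂ f₁)
          (FinslerGeom.slitProd (𝓡 2) M₁ (𝓡 n₂) M₂) ↔
        FinslerGeom.IsRiemannian ((𝓡 2).prod (𝓡 n₂)) (FinslerGeom.warped F₁ F₂ f₁))) := by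
  have hE₁ : Module.finrank ℝ (EuclideanSpace ℝ (Fin 2)) = 2 := finrank_euclideanSpace_fin
  have hE₂ : Module.finrank ℝ (EuclideanSpace ℝ (Fin n₂)) = n₂ := finrank_euclideanSpace_fin
  have h₂ : 1 ≤ Module.finrank ℝ (EuclideanSpace ℝ (Fin n₂)) := by rwa [hE₂]
  have h₂' : Module.finrank ℝ (EuclideanSpace ℝ (Fin n₂)) = 1 →
      ∀ (x : M₂) (v : TangentSpace (𝓡 n₂) x), F₂.toFun ⟨x, -v⟩ = F₂.toFun ⟨x, v⟩ := by
    rwa [hE₂]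
  refine ⟨fun hc => ⟨fun h => ?_, fun h => ?_⟩, fun h2 hc₁ hc₂ => ⟨fun h => ?_, fun h => ?_⟩,
    fun hc => ⟨fun h => ?_, fun h => ?_⟩⟩
  · exact FinslerGeom.isRiemannian_of_isBerwald_doublyWarped hE₁ h₂ h₂' hf₁ contMDiff_const hf₁pos
      (fun _ => one_pos) hc h
  · exact FinslerGeom.IsRiemannian.isBerwald_doublyWarped hf₁ contMDiff_const hf₁pos
      (fun _ => one_pos) h
  · exact FinslerGeom.isRiemannian_of_isWeaklyBerwald_doublyWarped hE₁ (hE₂.trans h2) hf₁ hf₂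
      hf₁pos hf₂pos hc₁ hc₂ h
  · exact (FinslerGeom.IsRiemannian.isBerwald_doublyWarped hf₁ hf₂ hf₁pos hf₂pos h).isWeaklyBerwald
  · exact FinslerGeom.isRiemannian_of_isDouglas_warped hE₁ h₂ h₂' hf₁ hf₁pos hc h
  · exact (FinslerGeom.IsRiemannian.isBerwald_doublyWarped hf₁ contMDiff_const hf₁pos
      (fun _ => one_pos) h).isDouglas
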